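/- For a $C^2$ function $u$ on an open subset of $\mathbb{C}^n$, let $du_z$ be its real differential, let $\bar\partial u_z(v)=\tfrac12\bigl(du_z(v)+i\,du_z(iv)\bigr)$, and let $\nabla\bar\partial u$ be the derivative of $\bar\partial u$; all norms of linear maps are operator norms with respect to the Euclidean norm on $\mathbb{C}^n$. For $\eta>0$, a complex-valued function $s$ is called $\eta$-transverse to $0$ over a set $U$ if, for every $z\in U$ with $|s(z)|<\eta$, the real differential $ds_z:\mathbb{C}^n\to\mathbb{C}$ has an $\mathbb{R}$-linear right inverse $\theta$ with $|\theta|<\eta^{-1}$. **Proposition.** Let $n\ge 0$ be an integer and let $C>0$, $\kappa>0$. There exist an integer $p\ge 0$ and a constant $\delta_0>0$, depending only on $C$, $\kappa$ and $n$, with the following property. Let $0<\delta<\delta_0$ and $\sigma=\delta\,(\log(\delta^{-1}))^{-p}$. (a) Let $f,h$ be two complex-valued $C^2$ functions on the open ball $B^+=B(0,\tfrac{11}{10})\subset\mathbb{C}^n$ satisfying, at every point of $B^+$, $$|f|\le 1,\quad |\bar\partial f|\le\sigma,\quad |\nabla\bar\partial f|\le\sigma,\qquad |h|\le 1-\kappa,\quad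 |dh|\le C,\quad |\bar\partial h|\le\sigma,\quad |\nabla\bar\partial h|\le\sigma .$$ Then there exists $w\in\mathbb{C}$ with $|w|<\delta$ such that $f-w-\bar w\,h$ is $\sigma$-transverse to $0$ over the closed unit ball in $\mathbb{C}^n$. (b) Let $(f_t)_{t\in[0,1]}$, $(h_t)_{t\in[0,1]}$ be families of complex-valued functions on $B^+$ depending continuously on $t$, in the sense that $(t,z)\mapsto f_t(z)$ and $(t,z)\mapsto h_t(z)$ are continuous on $[0,1]\times B^+$, and such that for every $t\in[0,1]$ the pair $f_t,h_t$ is $C^2$ and satisfies the bounds in (a). Then there is a continuous path $t\mapsto w_t\in\mathbb{C}$, $t\in[0,1]$, such that for every $t\in[0,1]$, $|w_t|<\delta$ and $f_t-w_t-\bar w_t\,h_t$ is $\sigma$-transverse to $0$ over the closed unit ball. -/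

import Mathlib

open scoped ComplexConjugate

/-- Complex Euclidean space `ℂⁿ`, with the standard Hermitian norm. -/
abbrev CSpace (n : ℕ) : Type := EuclideanSpace ℂ (Fin n)

/-- The `(0,1)`-part of the differential of `f : ℂⁿ → ℂ` at `z`, as a real-linear map:
`(∂̄f)_z (v) = (1/2) * (df_z (v) + i * df_z (i v))`. -/
noncomputable def dbar {n : ℕ} (f : CSpace n → ℂ) (z : CSpace n) : CSpace n →L[ℝ] ℂ :=
  (1 / 2 : ℂ) • (fderiv ℝ f z +
    Complex.I • (fderiv ℝ f z).comp (Complex.I • ContinuousLinearMap.id ℝ (CSpace n)))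

/-- Estimated transversality: `s` is `η`-transverse to `0` over `U` if, at every point `z` of `U`
with `|s z| < η`, the (real) derivative of `s` at `z` has a right inverse of norm `< η⁻¹`. -/
def TransverseToZeroOn {n : ℕ} (η : ℝ) (s : CSpace n → ℂ) (U : Set (CSpace n)) : Prop :=
  ∀ z ∈ U, ‖s z‖ < η →
    ∃ θ : ℂ →L[ℝ] CSpace n,
      (fderiv ℝ s z).comp θ = ContinuousLinearMap.id ℝ ℂ ∧ ‖θ‖ < η⁻¹

/-- The bounds imposed on `f` and `h` over the open ball `B⁺ = B(0, 11/10)` of `ℂⁿ`. -/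
structure LocalBounds {n : ℕ} (C κ σ : ℝ) (f h : CSpace n → ℂ) : Prop where
  contDiff_f : ContDiffOn ℝ 2 f (Metric.ball 0 (11 / 10))
  contDiff_h : ContDiffOn ℝ 2 h (Metric.ball 0 (11 / 10))
  norm_f : ∀ z ∈ Metric.ball (0 : CSpace n) (11 / 10), ‖f z‖ ≤ 1
  dbar_f : ∀ z ∈ Metric.ball (0 : CSpace n) (11 / 10), ‖dbar f z‖ ≤ σ
  grad_dbar_f : ∀ z ∈ Metric.ball (0 : CSpace n) (11 / 10), ‖fderiv ℝ (dbar f) z‖ ≤ σ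
  norm_h : ∀ z ∈ Metric.ball (0 : CSpace n) (11 / 10), ‖h z‖ ≤ 1 - κ
  deriv_h : ∀ z ∈ Metric.ball (0 : CSpace n) (11 / 10), ‖fderiv ℝ h z‖ ≤ C
  dbar_h : ∀ z ∈ Metric.ball (0 : CSpace n) (11 / 10), ‖dbar h z‖ ≤ σ
  grad_dbar_h : ∀ z ∈ Metric.ball (0 : CSpace n) (11 / 10), ‖fderiv ℝ (dbar h) z‖ ≤ σ

/-! Write s = f - w - w̄h. Since ds_z is complex-linear up to an error 2σ, it has a right inverse of
norm below σ⁻¹ as soon as its norm exceeds 10σ (`exists_rightInverse`). So transversality fails only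
where s and ds are both O(σ). As |h| ≤ 1 - κ, the equation w + w̄h = f has the solution w = (f - h
f̄)/(1 - |h|²), and a failure at z means that this function is nearly critical at z with a value
close to w.

Near each point the solution is replaced by a real polynomial G. Up to O(σ) in C¹, f and h are
holomorphic polynomials of degree O(log δ⁻¹) (`exists_holomorphic_poly_approx`,
`norm_fderiv_sub_le`), and the geometric series of 1/(1 - |h|²) can be cut after O(log δ⁻¹) terms.
Hence G has degree O((log δ⁻¹)²) (`exists_local_model`).

For a bad w, Re w and Im w lie within O(σ) of nearly critical values of Re G and Im G. A
quantitative Morse–Sard theorem (`volume_nhd_nearCriticalValues_le`) bounds the measure of such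
values by σ times a power of the degree, which the logarithm in the definition of σ compensates. The
bad w therefore lie in a product X × Y of sets of measure below δ/2 (`exists_bad_sets`), and
avoiding X with Re w, or Y with Im w, is enough. For families, X and Y serve a whole short time
interval; while one coordinate rests at a good value the other moves freely, so a staircase path
exists (`exists_staircase`).

Morse–Sard is proved as follows. For c close to a nearly critical value of g and a in the unit cube,
the energy ½(|∇g|²/ε² + |x|² + (c - g)²/ε²) - a·x has a minimum, at which x and t = (c - g)/ε are
bounded. So the set of such c, times the cube, is covered by the image of a polynomial map in (x, t)
one of whose Jacobian rows, the differential of g + εt, is O(ε). Expanding the determinant along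
that row leaves maps with image in a fixed box; their Jacobian integrals are at most the volume of
the box times the size of a generic fibre, which is polynomial in the degree. -/

/-! ### Zero sets and generic fibres of real polynomial maps -/

section PolynomialFibres

open MvPolynomial MeasureTheory

/-- Fubini and induction: for almost every value of the other variables the leading coefficient in
the first variable is nonzero, and then the slice is finite. -/
lemma MvPolynomial.volume_zeros_fin : ∀ (n : ℕ) (p : MvPolynomial (Fin n) ℝ), p ≠ 0 →
    volume {x : Fin n → ℝ | eval x p = 0} = 0 := by
  intro n
  induction n with
  | zero =>
    intro p hp
    have : {x : Fin 0 → ℝ | eval x p = 0} = ∅ := by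
      rw [Set.eq_empty_iff_forall_notMem]
      intro x hx
      apply hp
      apply MvPolynomial.funext
      intro y
      rw [Subsingleton.elim y x, map_zero]
      exact hx
    rw [this, measure_empty]
  | succ n ih =>
    intro p hp
    set q := finSuccEquiv ℝ n p with hq
    have hq0 : q ≠ 0 := by simpa [hq] using hp
    have hlead : q.leadingCoeff ≠ 0 := Polynomial.leadingCoeff_ne_zero.mpr hq0
    have hmeas : MeasurableSet {x : Fin (n + 1) → ℝ | eval x p = 0} :=
      (isClosed_eq (continuous_eval p) continuous_const).measurableSet
    have hpres := (volume_preserving_piFinSuccAbove (fun _ : Fin (n + 1) => ℝ) 0).symm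
    rw [← hpres.measure_preimage hmeas.nullMeasurableSet, Measure.volume_eq_prod,
      Measure.prod_apply_symm (measurableSet_preimage (MeasurableEquiv.measurable _) hmeas)]
    rw [lintegral_eq_zero_of_ae_eq_zero]
    have hae : ∀ᵐ y : Fin n → ℝ, eval y q.leadingCoeff ≠ 0 := by
      rw [ae_iff]
      simpa using ih _ hlead
    filter_upwards [hae] with y hy
    have hmap : Polynomial.map (eval y) q ≠ 0 := by
      intro h0
      apply hy
      have := congrArg (fun r => Polynomial.coeff r q.natDegree) h0
      simpa [Polynomial.coeff_map] using this
    refine measure_mono_null (t := {x : ℝ | (Polynomial.map (eval y) q).IsRoot x}) ?_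
      (Set.Finite.measure_zero (Polynomial.finite_setOfPred_isRoot hmap) _)
    intro x hx
    have hx' : eval ((MeasurableEquiv.piFinSuccAbove (fun _ : Fin (n + 1) => ℝ) 0).symm (x, y)) p
        = 0 := hx
    have hcons : (MeasurableEquiv.piFinSuccAbove (fun _ : Fin (n + 1) => ℝ) 0).symm (x, y)
        = (Fin.cons x y : Fin (n + 1) → ℝ) := by
      simp [MeasurableEquiv.piFinSuccAbove, Fin.insertNthEquiv]
    rw [hcons, eval_eq_eval_mv_eval'] at hx'
    exact hx'

lemma MvPolynomial.volume_zeros {κ : Type*} [Fintype κ] (p : MvPolynomial κ ℝ) (hp : p ≠ 0) :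
    volume {x : κ → ℝ | eval x p = 0} = 0 := by
  classical
  set e := Fintype.equivFin κ
  have hp' : rename e p ≠ 0 := by
    intro h
    exact hp (rename_injective e e.injective (by simpa using h))
  have h := volume_zeros_fin _ _ hp'
  have hpres := volume_measurePreserving_piCongrLeft (fun _ : Fin (Fintype.card κ) => ℝ) e
  have hmeas : MeasurableSet {x : Fin (Fintype.card κ) → ℝ | eval x (rename e p) = 0} :=
    (isClosed_eq (continuous_eval _) continuous_const).measurableSet
  rw [← hpres.measure_preimage hmeas.nullMeasurableSet] at h
  refine measure_mono_null ?_ h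
  intro x hx
  have : (MeasurableEquiv.piCongrLeft (fun _ : Fin (Fintype.card κ) => ℝ) e x) ∘ e = x := by
    ext i
    simp [MeasurableEquiv.coe_piCongrLeft, Equiv.piCongrLeft_apply]
  simp only [Set.mem_preimage, Set.mem_ofPred_eq, eval_rename, this]
  exact hx

lemma MvPolynomial.ae_eval_ne_zero {κ : Type*} [Fintype κ] (p : MvPolynomial κ ℝ) (hp : p ≠ 0) :
    ∀ᵐ x : κ → ℝ, eval x p ≠ 0 := by
  rw [ae_iff]
  simpa using volume_zeros p hp

/-- If `M` polynomials in `M` variables have degree at most `e`, then each variable satisfies a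
polynomial relation over them, of degree at most `(1 + M e) ^ M`. -/
lemma MvPolynomial.exists_relation {κ : Type*} [Fintype κ] (Ψ : κ → MvPolynomial κ ℝ) (e r : ℕ)
    (hΨ : ∀ i, (Ψ i).totalDegree ≤ e)
    (hr : (1 + Fintype.card κ * e) ^ Fintype.card κ ≤ r) (j : κ) :
    ∃ P : Fin (r + 1) → MvPolynomial κ ℝ, P ≠ 0 ∧
      ∀ x : κ → ℝ, ∑ k, eval (fun i => eval x (Ψ i)) (P k) * x j ^ (k : ℕ) = 0 := by
  classical
  set M := Fintype.card κ
  -- Bounds the degree of every product x_j^k ∏ Ψ_i^{α_i} with all exponents at most r.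
  set B := r + M * (e * r)
  let term : Fin (r + 1) × (κ → Fin (r + 1)) → MvPolynomial κ ℝ :=
    fun a => X j ^ (a.1 : ℕ) * ∏ i, Ψ i ^ (a.2 i : ℕ)
  let S : (Fin (r + 1) × (κ → Fin (r + 1)) → ℝ) →ₗ[ℝ] MvPolynomial κ ℝ :=
    Fintype.linearCombination ℝ term
  let T : (Fin (r + 1) × (κ → Fin (r + 1)) → ℝ) →ₗ[ℝ] ((κ → Fin (B + 1)) → ℝ) :=
    LinearMap.pi fun β => (lcoeff ℝ (Finsupp.equivFunOnFinite.symm fun i => (β i : ℕ))) ∘ₗ S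
  -- Dimension count: there are (r + 1)^(M + 1) products but at most (B + 1)^M coefficients to
  -- annihilate, and B + 1 ≤ (1 + Me)(r + 1) with (1 + Me)^M ≤ r.
  have hlt : Module.finrank ℝ ((κ → Fin (B + 1)) → ℝ)
      < Module.finrank ℝ (Fin (r + 1) × (κ → Fin (r + 1)) → ℝ) := by
    simp only [Module.finrank_fintype_fun_eq_card, Fintype.card_prod, Fintype.card_fun,
      Fintype.card_fin]
    calc (B + 1) ^ M ≤ ((1 + M * e) * (r + 1)) ^ M := by
          apply Nat.pow_le_pow_left
          simp only [B]
          nlinarith [Nat.zero_le (M * e)]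
      _ = (1 + M * e) ^ M * (r + 1) ^ M := by rw [mul_pow]
      _ ≤ r * (r + 1) ^ M := Nat.mul_le_mul_right _ hr
      _ < (r + 1) * (r + 1) ^ M := by
          apply Nat.mul_lt_mul_of_pos_right (Nat.lt_succ_self r) (by positivity)
  obtain ⟨c, hc, hc0⟩ := (Submodule.ne_bot_iff _).mp (LinearMap.ker_ne_bot_of_finrank_lt hlt)
  have hTc : T c = 0 := LinearMap.mem_ker.mp hc
  have hdeg : ∀ a, (term a).totalDegree ≤ B := by
    intro a
    refine (totalDegree_mul _ _).trans (add_le_add ?_ ?_)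
    · refine (totalDegree_pow _ _).trans ?_
      rw [totalDegree_X, mul_one]
      exact Nat.lt_succ_iff.mp a.1.2
    · refine (totalDegree_finsetProd _ _).trans ?_
      calc ∑ i, (Ψ i ^ (a.2 i : ℕ)).totalDegree ≤ ∑ _i : κ, e * r := by
            apply Finset.sum_le_sum
            intro i _
            refine (totalDegree_pow _ _).trans ?_
            rw [mul_comm]
            exact Nat.mul_le_mul (hΨ i) (Nat.lt_succ_iff.mp (a.2 i).2)
        _ = M * (e * r) := by simp [M]
  have hS : S c = ∑ a, c a • term a := by
    simp [S, Fintype.linearCombination_apply]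
  have hSdeg : (S c).totalDegree ≤ B := by
    rw [hS]
    refine totalDegree_finsetSum_le fun a _ => (totalDegree_smul_le _ _).trans (hdeg a)
  have hS0 : S c = 0 := by
    ext m
    by_cases hm : m ∈ (S c).support
    · have hmB : ∀ i, m i < B + 1 := by
        intro i
        have h1 : (m.sum fun _ e => e) ≤ B := (le_totalDegree hm).trans hSdeg
        have h2 : m i ≤ m.sum fun _ e => e := by
          by_cases hi : i ∈ m.support
          · exact Finset.single_le_sum (f := fun i => m i) (fun _ _ => Nat.zero_le _) hi
          · simp [Finsupp.notMem_support_iff.mp hi]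
        omega
      have h3 : coeff (Finsupp.equivFunOnFinite.symm fun i => m i) (S c) = 0 :=
        congrFun hTc (fun i => (⟨m i, hmB i⟩ : Fin (B + 1)))
      have h4 : (Finsupp.equivFunOnFinite.symm fun i => m i) = m := by ext; simp
      rw [h4] at h3
      simpa using h3
    · simpa using hm
  refine ⟨fun k => ∑ α : κ → Fin (r + 1),
    monomial (Finsupp.equivFunOnFinite.symm fun i => (α i : ℕ)) (c (k, α)), ?_, ?_⟩
  · intro h0
    apply hc0
    ext ⟨k, α⟩
    have h1 := congrArg (coeff (Finsupp.equivFunOnFinite.symm fun i => (α i : ℕ))) (congrFun h0 k)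
    simp only [coeff_sum, coeff_monomial, Pi.zero_apply, coeff_zero] at h1
    rw [Finset.sum_eq_single α] at h1
    · simpa using h1
    · intro β _ hβ
      rw [if_neg]
      intro h
      apply hβ
      ext i
      exact congrFun (Finsupp.equivFunOnFinite.symm.injective h) i
    · simp
  · intro x
    have h1 := congrArg (eval x) (hS.symm.trans hS0)
    rw [map_zero, map_sum, Fintype.sum_prod_type] at h1
    rw [← h1]
    refine Finset.sum_congr rfl fun k _ => ?_
    rw [map_sum, Finset.sum_mul]
    refine Finset.sum_congr rfl fun α _ => ?_
    simp [term, eval_monomial, Finsupp.prod_fintype, smul_eval]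
    ring

/-- For generic y, some coefficient of each relation survives the substitution of y. Every
coordinate of a preimage of y is then a root of a nonzero polynomial of degree at most r, so the
fibre lies in a finite grid. -/
lemma MvPolynomial.ae_fibre_card_le {κ : Type*} [Fintype κ] (Ψ : κ → MvPolynomial κ ℝ) (e r : ℕ)
    (hΨ : ∀ i, (Ψ i).totalDegree ≤ e)
    (hr : (1 + Fintype.card κ * e) ^ Fintype.card κ ≤ r) :
    ∀ᵐ y : κ → ℝ, ∀ F : Finset (κ → ℝ), (∀ x ∈ F, (fun i => eval x (Ψ i)) = y) →
      F.card ≤ r ^ Fintype.card κ := by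
  classical
  choose P hP0 hP using fun j => exists_relation Ψ e r hΨ hr j
  have hk : ∀ j, ∃ k, P j k ≠ 0 := fun j => by
    by_contra! h
    exact hP0 j (_root_.funext h)
  choose k hk using hk
  have hae : ∀ᵐ y : κ → ℝ, ∀ j, eval y (P j (k j)) ≠ 0 :=
    ae_all_iff.mpr fun j => ae_eval_ne_zero _ (hk j)
  filter_upwards [hae] with y hy F hF
  let Q : κ → Polynomial ℝ := fun j =>
    ∑ k : Fin (r + 1), Polynomial.C (eval y (P j k)) * Polynomial.X ^ (k : ℕ)
  have hQ0 : ∀ j, Q j ≠ 0 := by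
    intro j h0
    apply hy j
    have h1 := congrArg (fun q => Polynomial.coeff q (k j : ℕ)) h0
    simp only [Q, Polynomial.finsetSum_coeff, Polynomial.coeff_C_mul_X_pow,
      Polynomial.coeff_zero] at h1
    rw [Finset.sum_eq_single (k j)] at h1
    · simpa using h1
    · intro b _ hb
      rw [if_neg]
      intro h
      exact hb (Fin.ext h.symm)
    · simp
  have hQdeg : ∀ j, (Q j).natDegree ≤ r := by
    intro j
    refine Polynomial.natDegree_sum_le_of_forall_le _ _ fun k _ => ?_
    exact (Polynomial.natDegree_C_mul_X_pow_le _ _).trans (Nat.lt_succ_iff.mp k.2)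
  have hroot : ∀ x ∈ F, ∀ j, x j ∈ (Q j).roots.toFinset := by
    intro x hx j
    rw [Multiset.mem_toFinset, Polynomial.mem_roots (hQ0 j), Polynomial.IsRoot]
    have := hP j x
    rw [hF x hx] at this
    simpa [Q, Polynomial.eval_finsetSum] using this
  calc F.card ≤ (Fintype.piFinset fun j => (Q j).roots.toFinset).card := by
        apply Finset.card_le_card
        intro x hx
        rw [Fintype.mem_piFinset]
        exact hroot x hx
    _ = ∏ j, (Q j).roots.toFinset.card := Fintype.card_piFinset _
    _ ≤ ∏ _j : κ, r := Finset.prod_le_prod' fun j _ =>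
        (Multiset.toFinset_card_le _).trans ((Polynomial.card_roots' _).trans (hQdeg j))
    _ = r ^ Fintype.card κ := by simp

end PolynomialFibres

/-! ### The area formula for finite-to-one maps -/

section AreaMultiplicity

open MeasureTheory

/-- The area formula with multiplicity, as an inequality. -/
lemma lintegral_abs_det_le_mul_addHaar_image {E : Type*} [NormedAddCommGroup E] [NormedSpace ℝ E]
    [FiniteDimensional ℝ E] [Nontrivial E] [MeasurableSpace E] [BorelSpace E]
    (μ : Measure E) [μ.IsAddHaarMeasure] {s : Set E} (hs : MeasurableSet s) {f : E → E}
    {f' : E → E →L[ℝ] E} (hf : ∀ x, HasFDerivAt f (f' x) x)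
    (hdet : Measurable fun x => (f' x).det) (D : ℕ)
    (hD : ∀ᵐ y ∂μ, ∀ F : Finset E, (∀ x ∈ F, f x = y) → F.card ≤ D) :
    ∫⁻ x in s, ENNReal.ofReal |(f' x).det| ∂μ ≤ D * μ (f '' s) := by
  classical
  -- Critical points contribute nothing to the integral; away from them the map is injective on
  -- countably many pieces.
  set Z : Set E := {x | (f' x).det ≠ 0}
  have hZ : MeasurableSet Z := hdet (measurableSet_singleton (0 : ℝ)).compl
  set s0 := s ∩ Z
  have hs0 : MeasurableSet s0 := hs.inter hZ
  have h1 : ∫⁻ x in s, ENNReal.ofReal |(f' x).det| ∂μ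
      = ∫⁻ x in s0, ENNReal.ofReal |(f' x).det| ∂μ := by
    rw [← lintegral_indicator hs, ← lintegral_indicator hs0]
    congr 1
    ext x
    by_cases hx : x ∈ s
    · by_cases hx' : x ∈ Z
      · rw [Set.indicator_of_mem hx, Set.indicator_of_mem (show x ∈ s0 from ⟨hx, hx'⟩)]
      · have : (f' x).det = 0 := by simpa [Z] using hx'
        rw [Set.indicator_of_mem hx, Set.indicator_of_notMem (fun h : x ∈ s0 => hx' h.2), this]
        simp
    · rw [Set.indicator_of_notMem hx, Set.indicator_of_notMem (fun h : x ∈ s0 => hx h.1)]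
  -- An approximation of an invertible A with constant below ‖A⁻¹‖⁻¹ is injective. The value 1 for
  -- singular A is never used, since each A n is a derivative at a point of `s0`.
  let r : (E →L[ℝ] E) → NNReal := fun A =>
    if h : A.det ≠ 0 then ‖((A.toContinuousLinearEquivOfDetNeZero h).symm : E →L[ℝ] E)‖₊⁻¹ / 2
    else 1
  have rpos : ∀ A, r A ≠ 0 := by
    intro A
    by_cases h : A.det ≠ 0
    · have := (A.toContinuousLinearEquivOfDetNeZero h).nnnorm_symm_pos
      simp only [r, dif_pos h]
      positivity
    · simp only [r, dif_neg h]
      exact one_ne_zero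
  obtain ⟨t, A, tdisj, tmeas, tcov, tapp, tA⟩ :=
    exists_partition_approximatesLinearOn_of_hasFDerivWithinAt f s0 f'
      (fun x _ => (hf x).hasFDerivWithinAt) r rpos
  rcases s0.eq_empty_or_nonempty with hempty | hne
  · rw [h1, hempty]
    simp
  have hinj : ∀ n, Set.InjOn f (s0 ∩ t n) := by
    intro n
    obtain ⟨y, hy, hAy⟩ := tA hne n
    have hdetA : (A n).det ≠ 0 := by rw [hAy]; exact hy.2
    have happ := tapp n
    have hr : r (A n) =
        ‖(((A n).toContinuousLinearEquivOfDetNeZero hdetA).symm : E →L[ℝ] E)‖₊⁻¹ / 2 := by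
      simp only [r, dif_pos hdetA]
    have hlt : r (A n) <
        ‖(((A n).toContinuousLinearEquivOfDetNeZero hdetA).symm : E →L[ℝ] E)‖₊⁻¹ := by
      rw [hr]
      exact NNReal.half_lt_self (inv_pos.mpr
        ((A n).toContinuousLinearEquivOfDetNeZero hdetA).nnnorm_symm_pos).ne'
    refine ApproximatesLinearOn.injOn (f' := (A n).toContinuousLinearEquivOfDetNeZero hdetA)
      (c := r (A n)) ?_ (Or.inr hlt)
    simpa using happ
  have hmeasn : ∀ n, MeasurableSet (s0 ∩ t n) := fun n => hs0.inter (tmeas n)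
  have himg : ∀ n, MeasurableSet (f '' (s0 ∩ t n)) := fun n =>
    measurable_image_of_fderivWithin (hmeasn n) (fun x _ => (hf x).hasFDerivWithinAt) (hinj n)
  have hs0eq : s0 = ⋃ n, s0 ∩ t n := by
    rw [← Set.inter_iUnion]
    exact (Set.inter_eq_left.mpr tcov).symm
  have h2 : ∫⁻ x in s0, ENNReal.ofReal |(f' x).det| ∂μ = ∑' n, μ (f '' (s0 ∩ t n)) := by
    conv_lhs => rw [hs0eq]
    rw [lintegral_iUnion hmeasn]
    · congr 1
      ext n
      exact lintegral_abs_det_fderiv_eq_addHaar_image μ (hmeasn n)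
        (fun x _ => (hf x).hasFDerivWithinAt) (hinj n)
    · intro i j hij
      exact (tdisj hij).mono Set.inter_subset_right Set.inter_subset_right
  have himgU : MeasurableSet (f '' s0) := by
    rw [hs0eq, Set.image_iUnion]
    exact MeasurableSet.iUnion himg
  -- The pieces are disjoint, so pieces whose images contain y give distinct preimages of y: at most
  -- D of them.
  have h3 : ∀ᵐ y ∂μ, ∑' n, (f '' (s0 ∩ t n)).indicator (1 : E → ENNReal) y
      ≤ (f '' s0).indicator (fun _ => (D : ENNReal)) y := by
    filter_upwards [hD] with y hy
    by_cases hy0 : y ∈ f '' s0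
    · rw [Set.indicator_of_mem hy0, ENNReal.tsum_eq_iSup_sum]
      refine iSup_le fun F => ?_
      have hsum : ∑ n ∈ F, (f '' (s0 ∩ t n)).indicator (1 : E → ENNReal) y
          = ((F.filter fun n => y ∈ f '' (s0 ∩ t n)).card : ENNReal) := by
        rw [Finset.card_filter, Nat.cast_sum]
        refine Finset.sum_congr rfl fun n _ => ?_
        by_cases h : y ∈ f '' (s0 ∩ t n) <;> simp [Set.indicator, h]
      rw [hsum]
      have hex : ∀ n, ∃ x, y ∈ f '' (s0 ∩ t n) → (x ∈ s0 ∩ t n ∧ f x = y) := by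
        intro n
        by_cases h : y ∈ f '' (s0 ∩ t n)
        · obtain ⟨x, hx, hxy⟩ := h
          exact ⟨x, fun _ => ⟨hx, hxy⟩⟩
        · exact ⟨y, fun h' => absurd h' h⟩
      choose x hx using hex
      have hcard := hy ((F.filter fun n => y ∈ f '' (s0 ∩ t n)).image x) (by
        intro z hz
        obtain ⟨n, hn, rfl⟩ := Finset.mem_image.mp hz
        exact (hx n (Finset.mem_filter.mp hn).2).2)
      rw [Finset.card_image_of_injOn] at hcard
      · exact_mod_cast hcard
      · intro n hn k hk hnk
        have hn' := (hx n (Finset.mem_filter.mp hn).2).1.2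
        have hk' := (hx k (Finset.mem_filter.mp hk).2).1.2
        by_contra hne'
        rw [hnk] at hn'
        exact Set.disjoint_left.mp (tdisj hne') hn' hk'
    · rw [Set.indicator_of_notMem hy0]
      simp only [nonpos_iff_eq_zero, ENNReal.tsum_eq_zero]
      intro n
      refine Set.indicator_of_notMem (fun h => hy0 (Set.image_mono Set.inter_subset_left h)) _
  calc ∫⁻ x in s, ENNReal.ofReal |(f' x).det| ∂μ
      = ∑' n, μ (f '' (s0 ∩ t n)) := by rw [h1, h2]
    _ = ∑' n, ∫⁻ y, (f '' (s0 ∩ t n)).indicator 1 y ∂μ := by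
        congr 1
        ext n
        rw [lintegral_indicator_one (himg n)]
    _ = ∫⁻ y, ∑' n, (f '' (s0 ∩ t n)).indicator 1 y ∂μ :=
        (lintegral_tsum fun n => (measurable_one.indicator (himg n)).aemeasurable).symm
    _ ≤ ∫⁻ y, (f '' s0).indicator (fun _ => (D : ENNReal)) y ∂μ := lintegral_mono_ae h3
    _ = D * μ (f '' s0) := by rw [lintegral_indicator himgU, setLIntegral_const]
    _ ≤ D * μ (f '' s) := by gcongr; exact Set.inter_subset_left

end AreaMultiplicity

/-! ### Jacobians of polynomial maps -/

section PolynomialMaps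

open MvPolynomial MeasureTheory

lemma MvPolynomial.totalDegree_pderiv_le {κ : Type*} (p : MvPolynomial κ ℝ) (i : κ) :
    (pderiv i p).totalDegree ≤ p.totalDegree := by
  conv_lhs => rw [p.as_sum, map_sum]
  refine totalDegree_finsetSum_le fun m hm => ?_
  rw [pderiv_monomial]
  refine (totalDegree_monomial_le _ _).trans (le_trans ?_ (le_totalDegree hm))
  exact Finsupp.degree_mono (tsub_le_self : m - Finsupp.single i 1 ≤ m)

variable {κ : Type*}

/-- The polynomial map with components `Ψ`. -/
noncomputable def MvPolynomial.evalMap (Ψ : κ → MvPolynomial κ ℝ) (x : κ → ℝ) : κ → ℝ :=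
  fun i => eval x (Ψ i)

/-- The Jacobian matrix of a polynomial map. -/
noncomputable def MvPolynomial.jacobian (Ψ : κ → MvPolynomial κ ℝ) (x : κ → ℝ) : Matrix κ κ ℝ :=
  fun i j => eval x (pderiv j (Ψ i))

lemma MvPolynomial.continuous_jacobian (Ψ : κ → MvPolynomial κ ℝ) : Continuous (jacobian Ψ) :=
  continuous_pi fun _ => continuous_pi fun _ => continuous_eval _

variable [Fintype κ]

lemma MvPolynomial.hasFDerivAt_eval (p : MvPolynomial κ ℝ) (x : κ → ℝ) :
    HasFDerivAt (fun x => eval x p)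
      (∑ i, eval x (pderiv i p) • (ContinuousLinearMap.proj i : (κ → ℝ) →L[ℝ] ℝ)) x := by
  classical
  induction p using MvPolynomial.induction_on with
  | C a => simpa using hasFDerivAt_const a x
  | add p q hp hq =>
    simp only [map_add, add_smul, Finset.sum_add_distrib]
    exact hp.add hq
  | mul_X p j hp =>
    have hX : HasFDerivAt (fun x : κ → ℝ => x j)
        (ContinuousLinearMap.proj j : (κ → ℝ) →L[ℝ] ℝ) x :=
      (ContinuousLinearMap.proj j : (κ → ℝ) →L[ℝ] ℝ).hasFDerivAt
    have h := hp.mul hX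
    simp only [eval_mul, eval_X]
    refine h.congr_fderiv ?_
    ext v
    simp only [Derivation.leibniz, pderiv_X, smul_eq_mul, map_add, map_mul, eval_X,
      sum_apply, add_apply, smul_apply,
      ContinuousLinearMap.proj_apply, add_mul, Finset.sum_add_distrib, Finset.mul_sum]
    congr 1
    · rw [Finset.sum_eq_single j]
      · simp
      · intro b _ hb
        simp [hb.symm]
      · simp
    · refine Finset.sum_congr rfl fun i _ => by ring

variable [DecidableEq κ]

lemma MvPolynomial.hasFDerivAt_evalMap (Ψ : κ → MvPolynomial κ ℝ) (x : κ → ℝ) :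
    HasFDerivAt (evalMap Ψ) (LinearMap.toContinuousLinearMap (Matrix.toLin' (jacobian Ψ x))) x := by
  rw [hasFDerivAt_pi']
  intro i
  refine (hasFDerivAt_eval (Ψ i) x).congr_fderiv ?_
  ext v
  simp [jacobian, Matrix.mulVec_eq_sum, mul_comm]

lemma MvPolynomial.volume_image_le (Ψ : κ → MvPolynomial κ ℝ) {s : Set (κ → ℝ)}
    (hs : MeasurableSet s) :
    volume (evalMap Ψ '' s) ≤ ∫⁻ x in s, ENNReal.ofReal |(jacobian Ψ x).det| := by
  have h := addHaar_image_le_lintegral_abs_det_fderiv volume hs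
    fun x _ => (hasFDerivAt_evalMap Ψ x).hasFDerivWithinAt
  simpa [ContinuousLinearMap.det] using h

lemma MvPolynomial.lintegral_jacobian_le [Nonempty κ] (Ψ : κ → MvPolynomial κ ℝ) (e r : ℕ)
    (hΨ : ∀ i, (Ψ i).totalDegree ≤ e) (hr : (1 + Fintype.card κ * e) ^ Fintype.card κ ≤ r)
    {s : Set (κ → ℝ)} (hs : MeasurableSet s) :
    ∫⁻ x in s, ENNReal.ofReal |(jacobian Ψ x).det|
      ≤ (r ^ Fintype.card κ : ℕ) * volume (evalMap Ψ '' s) := by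
  have h := lintegral_abs_det_le_mul_addHaar_image volume hs (hasFDerivAt_evalMap Ψ)
    (by
      simp only [ContinuousLinearMap.det, LinearMap.coe_toContinuousLinearMap, LinearMap.det_toLin']
      exact ((continuous_jacobian Ψ).matrix_det).measurable)
    (r ^ Fintype.card κ) (ae_fibre_card_le Ψ e r hΨ hr)
  simpa [ContinuousLinearMap.det] using h

end PolynomialMaps

/-! ### Quantitative Morse–Sard theorem for polynomials -/

section NearCriticalValues

open MvPolynomial MeasureTheory

variable {ι : Type*} [Fintype ι]

/-- The polynomial `½(|∇g|²/ε² + |x|² + (c - g)²/ε²) - a·x`. -/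
noncomputable def penalizedEnergy (g : MvPolynomial ι ℝ) (ε c : ℝ) (a : ι → ℝ) :
    MvPolynomial ι ℝ :=
  C (1 / 2) * (C (ε⁻¹ ^ 2) * ∑ i, pderiv i g ^ 2 + ∑ i, X i ^ 2 + C (ε⁻¹ ^ 2) * (C c - g) ^ 2)
    - ∑ i, C (a i) * X i

lemma eval_penalizedEnergy (g : MvPolynomial ι ℝ) (ε c : ℝ) (a x : ι → ℝ) :
    eval x (penalizedEnergy g ε c a) =
      1 / 2 * (∑ i, (ε⁻¹ * eval x (pderiv i g)) ^ 2 + ∑ i, x i ^ 2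
        + (ε⁻¹ * (c - eval x g)) ^ 2) - ∑ i, a i * x i := by
  simp [penalizedEnergy, mul_pow, Finset.mul_sum]

lemma eval_pderiv_penalizedEnergy (g : MvPolynomial ι ℝ) (ε c : ℝ) (a x : ι → ℝ) (j : ι) :
    eval x (pderiv j (penalizedEnergy g ε c a)) =
      ε⁻¹ ^ 2 * ∑ i, eval x (pderiv i g) * eval x (pderiv j (pderiv i g)) + x j
        - ε⁻¹ * (ε⁻¹ * (c - eval x g)) * eval x (pderiv j g) - a j := by
  classical
  have h1 : ∑ i, (eval x) (a i • (pderiv j) (X i : MvPolynomial ι ℝ)) = a j := by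
    rw [Finset.sum_eq_single j]
    · simp
    · intro b _ hb
      simp [pderiv_X_of_ne hb]
    · simp
  have h2 : ∑ i, (eval x) ((pderiv j) ((X i : MvPolynomial ι ℝ) ^ 2)) = 2 * x j := by
    rw [Finset.sum_eq_single j]
    · simp [Derivation.leibniz_pow]
    · intro b _ hb
      simp [Derivation.leibniz_pow, pderiv_X_of_ne hb]
    · simp
  have h3 : ∑ i, eval x ((pderiv j) (pderiv i g ^ 2))
      = 2 * ∑ i, eval x (pderiv i g) * eval x (pderiv j (pderiv i g)) := by
    rw [Finset.mul_sum]
    refine Finset.sum_congr rfl fun i _ => ?_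
    simp [Derivation.leibniz_pow]
  have h4 : eval x (pderiv j ((C c - g) ^ 2)) = -2 * ((c - eval x g) * eval x (pderiv j g)) := by
    simp [Derivation.leibniz_pow]
  simp only [penalizedEnergy, map_sub, map_add, map_sum, ← smul_eq_C_mul, Derivation.map_smul, h1]
  simp only [smul_eval, map_add, map_sum, h2, h3, h4]
  ring

/-- Near every nearly critical point of `g` there is a minimum of the penalized energy. -/
lemma exists_penalized_critical_point (g : MvPolynomial ι ℝ) {ε : ℝ} (hε : 0 < ε) (c : ℝ)
    (a : ι → ℝ) (ha : ∀ i, a i ∈ Set.Icc (0 : ℝ) 1) (x₀ : ι → ℝ) (hx₀ : ∀ i, |x₀ i| ≤ 1)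
    (hg : ∀ i, |eval x₀ (pderiv i g)| ≤ ε) (hc : |c - eval x₀ g| ≤ ε) :
    ∃ x : ι → ℝ, (∀ j, eval x (pderiv j (penalizedEnergy g ε c a)) = 0) ∧
      (∀ i, |x i| ≤ 4 * (Fintype.card ι + 1)) ∧
      (∀ i, |eval x (pderiv i g)| ≤ 4 * (Fintype.card ι + 1) * ε) ∧
      |ε⁻¹ * (c - eval x g)| ≤ 4 * (Fintype.card ι + 1) := by
  classical
  set H := penalizedEnergy g ε c a
  set m : ℝ := (Fintype.card ι : ℝ)
  have hm : 0 ≤ m := Nat.cast_nonneg _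
  have hax : ∀ x : ι → ℝ, ∑ i, a i * x i ≤ ∑ i, |x i| := fun x => by
    refine Finset.sum_le_sum fun i _ => ?_
    calc a i * x i ≤ a i * |x i| := mul_le_mul_of_nonneg_left (le_abs_self _) (ha i).1
      _ ≤ 1 * |x i| := mul_le_mul_of_nonneg_right (ha i).2 (abs_nonneg _)
      _ = |x i| := one_mul _
  have hunit : ∀ u : ℝ, |u| ≤ ε → (ε⁻¹ * u) ^ 2 ≤ 1 := fun u hu => by
    rw [sq_le_one_iff_abs_le_one, abs_mul, abs_of_pos (inv_pos.mpr hε), inv_mul_le_iff₀ hε]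
    simpa using hu
  have hH₀ : eval x₀ H ≤ 2 * m + 1 / 2 := by
    rw [eval_penalizedEnergy]
    have h1 : ∑ i, (ε⁻¹ * eval x₀ (pderiv i g)) ^ 2 ≤ m := by
      calc _ ≤ ∑ _i : ι, (1 : ℝ) := Finset.sum_le_sum fun i _ => hunit _ (hg i)
        _ = m := by simp [m]
    have h2 : ∑ i, x₀ i ^ 2 ≤ m := by
      calc _ ≤ ∑ _i : ι, (1 : ℝ) :=
            Finset.sum_le_sum fun i _ => (sq_le_one_iff_abs_le_one _).mpr (hx₀ i)
        _ = m := by simp [m]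
    have h3 := hunit _ hc
    have h4 : -∑ i, a i * x₀ i ≤ m := by
      have := hax (-x₀)
      simp only [Pi.neg_apply, mul_neg, Finset.sum_neg_distrib, abs_neg] at this
      refine this.trans ?_
      calc _ ≤ ∑ _i : ι, (1 : ℝ) := Finset.sum_le_sum fun i _ => hx₀ i
        _ = m := by simp [m]
    linarith
  -- The linear term is absorbed by |x_i| ≤ x_i²/4 + 1, which makes the energy coercive.
  have hlow : ∀ x : ι → ℝ, 1 / 2 * (∑ i, (ε⁻¹ * eval x (pderiv i g)) ^ 2
      + (ε⁻¹ * (c - eval x g)) ^ 2) + 1 / 4 * ∑ i, x i ^ 2 - m ≤ eval x H := by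
    intro x
    rw [eval_penalizedEnergy]
    have h5 : ∑ i, |x i| ≤ 1 / 4 * ∑ i, x i ^ 2 + m := by
      have : m = ∑ _i : ι, (1 : ℝ) := by simp [m]
      rw [this, Finset.mul_sum, ← Finset.sum_add_distrib]
      refine Finset.sum_le_sum fun i _ => ?_
      nlinarith [sq_abs (x i), sq_nonneg (|x i| - 2)]
    linarith [hax x]
  have hsingle : ∀ (u : ι → ℝ) i, u i ^ 2 ≤ ∑ i, u i ^ 2 := fun u i =>
    Finset.single_le_sum (f := fun i => u i ^ 2) (fun _ _ => sq_nonneg _) (Finset.mem_univ i)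
  have hcont : Continuous fun x => eval x H := continuous_eval _
  obtain ⟨x, hx⟩ := hcont.exists_forall_le' x₀ (by
    have htend := tendsto_norm_cocompact_atTop (E := ι → ℝ)
    filter_upwards [htend.eventually_gt_atTop (4 * (m + 1))] with y hy
    obtain ⟨i, hi⟩ : ∃ i, 4 * (m + 1) < ‖y i‖ := by
      by_contra! hcon
      exact absurd ((pi_norm_le_iff_of_nonneg (by positivity)).mpr hcon) (not_le.mpr hy)
    have h1 := hsingle y i
    rw [Real.norm_eq_abs] at hi
    have h2 : (4 * (m + 1)) ^ 2 ≤ y i ^ 2 := by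
      rw [← sq_abs (y i)]
      exact pow_le_pow_left₀ (by positivity) hi.le 2
    have h3 : 0 ≤ ∑ i, (ε⁻¹ * eval y (pderiv i g)) ^ 2 := Finset.sum_nonneg fun _ _ => sq_nonneg _
    nlinarith [hlow y, sq_nonneg (ε⁻¹ * (c - eval y g))])
  -- Compared with its value at x₀, the minimum gives ½(…) + ¼∑ x_i² ≤ 3m + ½. Each square is thus
  -- at most 12m + 2 ≤ (4(m + 1))².
  have hbd := (hlow x).trans ((hx x₀).trans hH₀)
  have hs1 : 0 ≤ ∑ i, (ε⁻¹ * eval x (pderiv i g)) ^ 2 := Finset.sum_nonneg fun _ _ => sq_nonneg _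
  have hs2 : 0 ≤ ∑ i, x i ^ 2 := Finset.sum_nonneg fun _ _ => sq_nonneg _
  have hs3 := sq_nonneg (ε⁻¹ * (c - eval x g))
  have hR : (0 : ℝ) ≤ 4 * (m + 1) := by positivity
  refine ⟨x, ?_, fun i => ?_, fun i => ?_, ?_⟩
  · intro j
    have hmin : IsLocalMin (fun x => eval x H) x := Filter.Eventually.of_forall hx
    have h0 := hmin.hasFDerivAt_eq_zero (hasFDerivAt_eval H x)
    have h1 := congrArg (fun L : (ι → ℝ) →L[ℝ] ℝ => L (Pi.single j 1)) h0
    simpa [Pi.single_apply] using h1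
  · refine abs_le_of_sq_le_sq' ?_ hR |> abs_le.mpr
    nlinarith [hsingle x i]
  · have : |ε⁻¹ * eval x (pderiv i g)| ≤ 4 * (m + 1) := by
      refine abs_le_of_sq_le_sq' ?_ hR |> abs_le.mpr
      nlinarith [hsingle (fun i => ε⁻¹ * eval x (pderiv i g)) i]
    rwa [abs_mul, abs_of_pos (inv_pos.mpr hε), inv_mul_le_iff₀ hε, mul_comm] at this
  · refine abs_le_of_sq_le_sq' ?_ hR |> abs_le.mpr
    nlinarith

/-- The gradient in `x` of the penalized energy (up to the linear term), as a polynomial in `x` and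
`t = (c - g x) / ε`; the variable `t` is `none`. -/
noncomputable def penalizedGradient (g : MvPolynomial ι ℝ) (ε : ℝ) (j : ι) :
    MvPolynomial (Option ι) ℝ :=
  C (ε⁻¹ ^ 2) * ∑ i, rename some (pderiv i g) * rename some (pderiv j (pderiv i g)) + X (some j)
    - C ε⁻¹ * X none * rename some (pderiv j g)

lemma eval_penalizedGradient (g : MvPolynomial ι ℝ) (ε : ℝ) (j : ι) (y : Option ι → ℝ) :
    eval y (penalizedGradient g ε j) = ε⁻¹ ^ 2 * ∑ i, eval (y ∘ some) (pderiv i g) *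
      eval (y ∘ some) (pderiv j (pderiv i g)) + y (some j)
        - ε⁻¹ * y none * eval (y ∘ some) (pderiv j g) := by
  simp [penalizedGradient, eval_rename]

lemma totalDegree_penalizedGradient (g : MvPolynomial ι ℝ) (ε : ℝ) (j : ι) {d : ℕ}
    (hd : g.totalDegree ≤ d) : (penalizedGradient g ε j).totalDegree ≤ 2 * d + 1 := by
  classical
  have h1 : ∀ i, (rename some (pderiv i g) : MvPolynomial (Option ι) ℝ).totalDegree ≤ d := fun i =>
    (totalDegree_rename_le _ _).trans ((totalDegree_pderiv_le _ _).trans hd)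
  have h2 : ∀ i, (rename some (pderiv j (pderiv i g)) : MvPolynomial (Option ι) ℝ).totalDegree
      ≤ d := fun i =>
    (totalDegree_rename_le _ _).trans
      ((totalDegree_pderiv_le _ _).trans ((totalDegree_pderiv_le _ _).trans hd))
  refine (totalDegree_sub _ _).trans (max_le ((totalDegree_add _ _).trans (max_le ?_ ?_)) ?_)
  · rw [← smul_eq_C_mul]
    refine (totalDegree_smul_le _ _).trans (totalDegree_finsetSum_le fun i _ => ?_)
    have := totalDegree_mul (rename some (pderiv i g) : MvPolynomial (Option ι) ℝ)
      (rename some (pderiv j (pderiv i g)))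
    have := h1 i
    have := h2 i
    omega
  · rw [totalDegree_X]
    omega
  · rw [mul_assoc, ← smul_eq_C_mul]
    refine (totalDegree_smul_le _ _).trans ?_
    have := totalDegree_mul (X none : MvPolynomial (Option ι) ℝ) (rename some (pderiv j g))
    rw [totalDegree_X] at this
    have := h1 j
    omega

/-- The penalized gradient, completed by a last component. -/
noncomputable def gradientWith (g : MvPolynomial ι ℝ) (ε : ℝ) (ℓ : MvPolynomial (Option ι) ℝ) :
    Option ι → MvPolynomial (Option ι) ℝ :=
  fun o => o.elim ℓ (penalizedGradient g ε)

variable [DecidableEq ι]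

/-- The determinant is linear in the row indexed by `none`. For the component g + εt this row is
(∇g, ε), with entries at most Rε, and it is expanded in coordinate rows, which are the differentials
of the X o. -/
lemma abs_det_jacobian_gradientWith_le (g : MvPolynomial ι ℝ) {ε R : ℝ} (hε : 0 ≤ ε) (hR : 1 ≤ R)
    (y : Option ι → ℝ) (hy : ∀ i, |eval (y ∘ some) (pderiv i g)| ≤ R * ε) :
    |(jacobian (gradientWith g ε (rename some g + C ε * X none)) y).det|
      ≤ R * ε * ∑ o, |(jacobian (gradientWith g ε (X o)) y).det| := by
  set A := jacobian (gradientWith g ε 0) y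
  have hA : ∀ ℓ, jacobian (gradientWith g ε ℓ) y
      = A.updateRow none fun o => eval y (pderiv o ℓ) := by
    intro ℓ
    ext i j
    cases i with
    | none => simp [jacobian, gradientWith]
    | some i => simp [jacobian, gradientWith, A]
  have hX : ∀ o, jacobian (gradientWith g ε (X o)) y = A.updateRow none (Pi.single o 1) := by
    intro o
    rw [hA]
    congr 1
    ext o'
    by_cases h : o = o'
    · subst h
      simp
    · simp [pderiv_X_of_ne h, Ne.symm h]
  set v : Option ι → ℝ := fun o => eval y (pderiv o (rename some g + C ε * X none))
  have hv : ∀ o, |v o| ≤ R * ε := by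
    intro o
    cases o with
    | none =>
      have h0 : pderiv none (rename some g : MvPolynomial (Option ι) ℝ) = 0 := by
        refine pderiv_eq_zero_of_notMem_vars fun h => ?_
        have := vars_rename some g h
        simp at this
      simp only [v, map_add, h0, ← smul_eq_C_mul, Derivation.map_smul, pderiv_X_self, map_zero,
        zero_add, smul_eval, map_one, mul_one, abs_of_nonneg hε]
      nlinarith
    | some i =>
      have h0 : pderiv (some i) (rename some g : MvPolynomial (Option ι) ℝ)
          = rename some (pderiv i g) := pderiv_rename (Option.some_injective _) _ _
      have hne : (none : Option ι) ≠ some i := by simp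
      simp only [v, map_add, h0, ← smul_eq_C_mul, Derivation.map_smul, pderiv_X_of_ne hne,
        smul_zero, map_zero, add_zero, eval_rename]
      exact hy i
  have hdet : (jacobian (gradientWith g ε (rename some g + C ε * X none)) y).det
      = ∑ o, v o * (jacobian (gradientWith g ε (X o)) y).det := by
    rw [hA]
    simp only [hX, ← Matrix.cramer_transpose_apply]
    change Matrix.cramer A.transpose v none = _
    conv_lhs => rw [pi_eq_sum_univ' v, map_sum, Finset.sum_apply]
    refine Finset.sum_congr rfl fun o _ => ?_
    rw [map_smul]
    rfl
  rw [hdet, Finset.mul_sum]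
  refine (Finset.abs_sum_le_sum_abs _ _).trans (Finset.sum_le_sum fun o _ => ?_)
  rw [abs_mul]
  exact mul_le_mul_of_nonneg_right (hv o) (abs_nonneg _)

/-- **Quantitative Morse–Sard theorem** for polynomials: the values of a polynomial at the points
of the unit cube where its partial derivatives are at most `ε` have an `ε`-neighbourhood of measure
at most `ε` times a polynomial in the degree. -/
theorem volume_nhd_nearCriticalValues_le (g : MvPolynomial ι ℝ) {d m : ℕ} (hd : g.totalDegree ≤ d)
    (hm : Fintype.card ι = m) {ε : ℝ} (hε : 0 < ε) :
    volume {c : ℝ | ∃ x : ι → ℝ, (∀ i, |x i| ≤ 1) ∧ (∀ i, |eval x (pderiv i g)| ≤ ε) ∧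
        |c - eval x g| ≤ ε} ≤
      ENNReal.ofReal (32 * (m + 1) ^ 3 * (1 + (m + 1) * (2 * d + 1)) ^ ((m + 1) ^ 2) * ε) := by
  set N := {c : ℝ | ∃ x : ι → ℝ, (∀ i, |x i| ≤ 1) ∧ (∀ i, |eval x (pderiv i g)| ≤ ε) ∧
        |c - eval x g| ≤ ε}
  set R : ℝ := 4 * (m + 1) with hRdef
  have hR1 : 1 ≤ R := by
    have : (0 : ℝ) ≤ m := Nat.cast_nonneg m
    linarith
  -- These closed conditions hold at the minima found above. They make the gradient row small and
  -- keep the images under the maps completed by a coordinate in a fixed box.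
  set W : Set (Option ι → ℝ) := {y | (∀ o, |y o| ≤ R) ∧
    (∀ i, |eval (y ∘ some) (pderiv i g)| ≤ R * ε) ∧
    ∀ j, eval y (penalizedGradient g ε j) ∈ Set.Icc (0 : ℝ) 1}
  have hWc : IsClosed W := by
    have hsome : Continuous fun y : Option ι → ℝ => y ∘ some :=
      continuous_pi fun i => continuous_apply _
    have h1 : IsClosed (⋂ o, {y : Option ι → ℝ | |y o| ≤ R}) :=
      isClosed_iInter fun o => isClosed_le (continuous_apply o).abs continuous_const
    have h2 : IsClosed (⋂ i, {y : Option ι → ℝ | |eval (y ∘ some) (pderiv i g)| ≤ R * ε}) :=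
      isClosed_iInter fun i =>
        isClosed_le ((continuous_eval _).comp hsome).abs continuous_const
    have h3 : IsClosed (⋂ j, {y : Option ι → ℝ |
        eval y (penalizedGradient g ε j) ∈ Set.Icc (0 : ℝ) 1}) :=
      isClosed_iInter fun j => isClosed_Icc.preimage (continuous_eval _)
    convert h1.inter (h2.inter h3) using 1
    ext y
    simp [W]
  have hW := hWc.measurableSet
  set ℓ : MvPolynomial (Option ι) ℝ := rename some g + C ε * X none
  have hcube : ∀ S : Set ℝ, volume (Set.pi Set.univ fun o : Option ι =>
      o.elim S fun _ => Set.Icc (0 : ℝ) 1) = volume S := by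
    intro S
    rw [volume_pi, Measure.pi_pi, Fintype.prod_option]
    simp
  -- With t = (c - g)/ε as an independent variable, the gradient equations no longer contain c, so a
  -- single map covers all c and a; its last component g + εt returns c.
  have hsub : (Set.pi Set.univ fun o : Option ι => o.elim N fun _ => Set.Icc (0 : ℝ) 1)
      ⊆ evalMap (gradientWith g ε ℓ) '' W := by
    intro z hz
    have hzN : z none ∈ N := hz none trivial
    have hz1 : ∀ i, z (some i) ∈ Set.Icc (0 : ℝ) 1 := fun i => hz (some i) trivial
    obtain ⟨x₀, hx₀, hg₀, hc₀⟩ := hzN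
    obtain ⟨x, hx, hxR, hgR, htR⟩ := exists_penalized_critical_point g hε (z none)
      (fun i => z (some i)) hz1 x₀ hx₀ hg₀ hc₀
    rw [hm] at hxR hgR htR
    set y : Option ι → ℝ := fun o => o.elim (ε⁻¹ * (z none - eval x g)) x
    have hys : y ∘ some = x := rfl
    have hgrad : ∀ j, eval y (penalizedGradient g ε j) = z (some j) := by
      intro j
      have := hx j
      rw [eval_pderiv_penalizedEnergy] at this
      rw [eval_penalizedGradient, hys]
      change _ + x j - ε⁻¹ * (ε⁻¹ * (z none - eval x g)) * _ = _
      linarith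
    refine ⟨y, ⟨?_, ?_, ?_⟩, ?_⟩
    · intro o
      cases o with
      | none => exact htR
      | some i => exact hxR i
    · exact hgR
    · intro j
      rw [hgrad]
      exact hz1 j
    · ext o
      cases o with
      | none =>
        change eval y (rename some g + C ε * X none) = z none
        rw [eval_add, eval_rename, hys, eval_mul, eval_C, eval_X]
        change eval x g + ε * (ε⁻¹ * (z none - eval x g)) = z none
        rw [mul_inv_cancel_left₀ hε.ne']
        ring
      | some j => exact hgrad j
  -- With a coordinate as last component, the image of W lies in [-R, R] × [0, 1]^ι.
  have himg : ∀ o : Option ι, volume (evalMap (gradientWith g ε (X o)) '' W)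
      ≤ ENNReal.ofReal (2 * R) := by
    intro o
    calc _ ≤ volume (Set.pi Set.univ fun o : Option ι =>
          o.elim (Set.Icc (-R) R) fun _ => Set.Icc (0 : ℝ) 1) := by
          refine measure_mono ?_
          rintro _ ⟨y, hy, rfl⟩ o' -
          cases o' with
          | none =>
            change eval y (X o) ∈ Set.Icc (-R) R
            rw [eval_X]
            exact abs_le.mp (hy.1 o)
          | some j => exact hy.2.2 j
      _ = ENNReal.ofReal (2 * R) := by
          rw [hcube, Real.volume_Icc]
          congr 1
          ring
  set r : ℕ := (1 + (m + 1) * (2 * d + 1)) ^ (m + 1) with hr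
  have hcard : Fintype.card (Option ι) = m + 1 := by rw [Fintype.card_option, hm]
  have hmult : ∀ o : Option ι,
      ∫⁻ y in W, ENNReal.ofReal |(jacobian (gradientWith g ε (X o)) y).det|
        ≤ (r ^ (m + 1) : ℕ) * ENNReal.ofReal (2 * R) := by
    intro o
    have h := lintegral_jacobian_le (gradientWith g ε (X o)) (2 * d + 1) r (by
      intro o'
      cases o' with
      | none =>
        change (X o : MvPolynomial (Option ι) ℝ).totalDegree ≤ _
        rw [totalDegree_X]
        omega
      | some j => exact totalDegree_penalizedGradient g ε j hd) (by rw [hcard]) hW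
    rw [hcard] at h
    exact h.trans (mul_le_mul_right (himg o) _)
  have hmeas : ∀ o : Option ι, Measurable fun y =>
      ENNReal.ofReal |(jacobian (gradientWith g ε (X o)) y).det| := fun o =>
    ((continuous_jacobian _).matrix_det.abs.measurable).ennreal_ofReal
  calc volume N = volume (Set.pi Set.univ fun o : Option ι =>
        o.elim N fun _ => Set.Icc (0 : ℝ) 1) := (hcube N).symm
    _ ≤ volume (evalMap (gradientWith g ε ℓ) '' W) := measure_mono hsub
    _ ≤ ∫⁻ y in W, ENNReal.ofReal |(jacobian (gradientWith g ε ℓ) y).det| := volume_image_le _ hW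
    _ ≤ ∫⁻ y in W, ENNReal.ofReal (R * ε) *
          ∑ o, ENNReal.ofReal |(jacobian (gradientWith g ε (X o)) y).det| := by
        refine setLIntegral_mono' hW fun y hy => ?_
        rw [← ENNReal.ofReal_sum_of_nonneg (fun _ _ => abs_nonneg _),
          ← ENNReal.ofReal_mul (by positivity)]
        exact ENNReal.ofReal_le_ofReal (abs_det_jacobian_gradientWith_le g hε.le hR1 y hy.2.1)
    _ = ENNReal.ofReal (R * ε) *
          ∑ o, ∫⁻ y in W, ENNReal.ofReal |(jacobian (gradientWith g ε (X o)) y).det| := by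
        rw [lintegral_const_mul _ (Finset.measurable_sum _ fun o _ => hmeas o),
          lintegral_finsetSum _ fun o _ => hmeas o]
    _ ≤ ENNReal.ofReal (R * ε) * ∑ _o : Option ι, (r ^ (m + 1) : ℕ) * ENNReal.ofReal (2 * R) := by
        gcongr with o
        exact hmult o
    -- Here R = 4(m + 1), so Rε · (m + 1) · 2R = 32(m + 1)³ε; the remaining factor is r^(m + 1).
    _ = ENNReal.ofReal (32 * (m + 1) ^ 3 * (1 + (m + 1) * (2 * d + 1)) ^ ((m + 1) ^ 2) * ε) := by
        rw [Finset.sum_const, Finset.card_univ, hcard, nsmul_eq_mul, ← ENNReal.ofReal_natCast,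
          ← ENNReal.ofReal_natCast, ← ENNReal.ofReal_mul (by positivity),
          ← ENNReal.ofReal_mul (by positivity), ← ENNReal.ofReal_mul (by positivity)]
        congr 1
        rw [hr, ← pow_mul, ← sq, hRdef]
        push_cast
        ring

end NearCriticalValues

/-! ### Variation of parametric integrals -/

section ParametricCircle

open MeasureTheory

/-- A mean value inequality for parametric integrals. -/
lemma norm_integral_sub_le_of_deriv {F F' : ℝ → ℝ → ℂ} {a b c d M : ℝ} (hab : a ≤ b) (hcd : c ≤ d)
    (hF : ∀ s ∈ Set.Icc a b, ∀ θ ∈ Set.Icc c d, HasDerivAt (fun s => F s θ) (F' s θ) s)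
    (hF' : ContinuousOn (fun q : ℝ × ℝ => F' q.1 q.2) (Set.Icc a b ×ˢ Set.Icc c d))
    (ha : IntervalIntegrable (F a) volume c d) (hb : IntervalIntegrable (F b) volume c d)
    (hM : ∀ s ∈ Set.Ioc a b, ‖∫ θ in c..d, F' s θ‖ ≤ M) :
    ‖(∫ θ in c..d, F b θ) - ∫ θ in c..d, F a θ‖ ≤ M * (b - a) := by
  have hint : IntegrableOn (Function.uncurry F') (Set.uIoc a b ×ˢ Set.uIoc c d) := by
    rw [Set.uIoc_of_le hab, Set.uIoc_of_le hcd]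
    exact ((hF'.integrableOn_compact (isCompact_Icc.prod isCompact_Icc)).mono_set
      (Set.prod_mono Set.Ioc_subset_Icc_self Set.Ioc_subset_Icc_self))
  rw [← intervalIntegral.integral_sub hb ha]
  have h1 : ∫ θ in c..d, (F b θ - F a θ) = ∫ θ in c..d, ∫ s in a..b, F' s θ := by
    refine intervalIntegral.integral_congr fun θ hθ => ?_
    rw [Set.uIcc_of_le hcd] at hθ
    refine (intervalIntegral.integral_eq_sub_of_hasDerivAt (f := fun s => F s θ) ?_ ?_).symm
    · intro s hs
      rw [Set.uIcc_of_le hab] at hs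
      exact hF s hs θ hθ
    · refine ContinuousOn.intervalIntegrable ?_
      rw [Set.uIcc_of_le hab]
      exact hF'.comp (f := fun s => (s, θ)) (by fun_prop) fun s hs => ⟨hs, hθ⟩
  rw [h1, ← intervalIntegral_intervalIntegral_swap hint, ← abs_of_nonneg (sub_nonneg.mpr hab)]
  refine intervalIntegral.norm_integral_le_of_norm_le_const fun s hs => ?_
  rw [Set.uIoc_of_le hab] at hs
  exact hM s hs

end ParametricCircle

/-! ### Complex-linear and antilinear parts of the differential -/

section Dbar

variable {n : ℕ}

/-- The complex-linear part of the differential. -/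
noncomputable def del (f : CSpace n → ℂ) (z : CSpace n) : CSpace n →L[ℝ] ℂ :=
  fderiv ℝ f z - dbar f z

lemma dbar_apply (f : CSpace n → ℂ) (z v : CSpace n) :
    dbar f z v = 1 / 2 * (fderiv ℝ f z v + Complex.I * fderiv ℝ f z (Complex.I • v)) := by
  simp [dbar]
  ring

lemma smul_eq_re_add_im (c : ℂ) (v : CSpace n) : c • v = c.re • v + c.im • (Complex.I • v) := by
  ext i
  simp only [PiLp.smul_apply, PiLp.add_apply, smul_eq_mul, Complex.real_smul]
  conv_lhs => rw [← Complex.re_add_im c]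
  ring

lemma dbar_smul (f : CSpace n → ℂ) (z : CSpace n) (c : ℂ) (v : CSpace n) :
    dbar f z (c • v) = conj c * dbar f z v := by
  have hI : Complex.I • Complex.I • v = -v := by rw [smul_smul, Complex.I_mul_I, neg_one_smul]
  have hIv : dbar f z (Complex.I • v) = -Complex.I * dbar f z v := by
    simp only [dbar_apply, hI, map_neg]
    linear_combination ((1 / 2) * fderiv ℝ f z (Complex.I • v)) * Complex.I_mul_I
  rw [smul_eq_re_add_im, map_add, map_smul, map_smul, hIv]
  simp only [Complex.real_smul]
  have : conj c = c.re - c.im * Complex.I := by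
    apply Complex.ext <;> simp
  rw [this]
  ring

lemma del_smul (f : CSpace n → ℂ) (z : CSpace n) (c : ℂ) (v : CSpace n) :
    del f z (c • v) = c * del f z v := by
  have hI : Complex.I • Complex.I • v = -v := by rw [smul_smul, Complex.I_mul_I, neg_one_smul]
  have hIv : del f z (Complex.I • v) = Complex.I * del f z v := by
    simp only [del, sub_apply, dbar_apply, hI, map_neg]
    linear_combination ((1 / 2) * fderiv ℝ f z (Complex.I • v)) * Complex.I_mul_I
  rw [smul_eq_re_add_im, map_add, map_smul, map_smul, hIv]
  simp only [Complex.real_smul]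
  conv_rhs => rw [← Complex.re_add_im c]
  ring

lemma fderiv_eq_del_add_dbar (f : CSpace n → ℂ) (z v : CSpace n) :
    fderiv ℝ f z v = del f z v + dbar f z v := by
  simp [del]

end Dbar

/-! ### Cauchy formula and gradient estimate with a ∂̄ error -/

section SliceEstimates

open MeasureTheory

variable {n : ℕ} {u : CSpace n → ℂ} {U : Set (CSpace n)}

lemma continuousOn_fderiv_of_contDiffOn (hU : IsOpen U) (hu : ContDiffOn ℝ 1 u U) :
    ContinuousOn (fderiv ℝ u) U :=
  hu.continuousOn_fderiv_of_isOpen hU le_rfl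

lemma continuousOn_dbar (hU : IsOpen U) (hu : ContDiffOn ℝ 1 u U) : ContinuousOn (dbar u) U := by
  have h := continuousOn_fderiv_of_contDiffOn hU hu
  unfold dbar
  exact (h.add ((h.clm_comp continuousOn_const).const_smul Complex.I)).const_smul (1 / 2 : ℂ)

lemma differentiableAt_dbar (hU : IsOpen U) (hu : ContDiffOn ℝ 2 u U) {z : CSpace n} (hz : z ∈ U) :
    DifferentiableAt ℝ (dbar u) z := by
  have h : DifferentiableAt ℝ (fderiv ℝ u) z :=
    ((hu.contDiffAt (hU.mem_nhds hz)).fderiv_right (m := 1) (by norm_num)).differentiableAt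
      (by norm_num)
  unfold dbar
  exact (h.add ((h.clm_comp (differentiableAt_const _)).const_smul Complex.I)).const_smul (1 / 2 : ℂ)

set_option maxHeartbeats 1000000 in
/-- An approximate Cauchy formula on complex discs. -/
lemma norm_sub_cauchyIntegral_le (hU : IsOpen U) (hu : ContDiffOn ℝ 1 u U) {σ : ℝ}
    (hσ : ∀ z ∈ U, ‖dbar u z‖ ≤ σ) (q e : CSpace n) (he : ‖e‖ ≤ 1) {ρ : ℝ} (hρ : 0 < ρ)
    (hsub : ∀ ζ : ℂ, ‖ζ‖ ≤ ρ → q + ζ • e ∈ U) {ξ : ℂ} (hξ : ‖ξ‖ < ρ) :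
    ‖u (q + ξ • e) - (2 * Real.pi * Complex.I)⁻¹ *
      ∮ ζ in C(0, ρ), (ζ - ξ)⁻¹ * u (q + ζ • e)‖ ≤ 2 * ρ * σ := by
  have hne : ∀ θ, circleMap 0 ρ θ - ξ ≠ 0 := by
    intro θ h
    have : ‖circleMap 0 ρ θ‖ = ρ := by simp [abs_of_pos hρ]
    rw [sub_eq_zero.mp h] at this
    exact hξ.ne this
  -- A homotopy from the constant point with parameter ξ (s = 0) to the circle (s = 1). The Cauchy
  -- integrals at the two ends are the two terms to be compared.
  set pt : ℝ → ℝ → CSpace n := fun s θ => q + (ξ + s * (circleMap 0 ρ θ - ξ)) • e with hpt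
  have hptU : ∀ s ∈ Set.Icc (0 : ℝ) 1, ∀ θ, pt s θ ∈ U := by
    intro s hs θ
    refine hsub _ ?_
    have h1 : ξ + s * (circleMap 0 ρ θ - ξ) = (1 - s : ℝ) * ξ + (s : ℝ) * circleMap 0 ρ θ := by
      push_cast; ring
    rw [h1]
    refine (norm_add_le _ _).trans ?_
    rw [norm_mul, norm_mul, Complex.norm_real, Complex.norm_real, Real.norm_of_nonneg hs.1,
      Real.norm_of_nonneg (sub_nonneg.mpr hs.2), norm_circleMap_zero, abs_of_pos hρ]
    nlinarith [hs.1, hs.2, mul_le_mul_of_nonneg_left hξ.le (sub_nonneg.mpr hs.2)]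
  have hptc : Continuous fun p : ℝ × ℝ => pt p.1 p.2 := by
    simp only [hpt]
    have := continuous_circleMap 0 ρ
    fun_prop
  have hpts : ∀ s, Continuous (pt s) := fun s => by
    have := continuous_circleMap 0 ρ
    simp only [hpt]
    fun_prop
  have hdiff : ∀ z ∈ U, HasFDerivAt u (fderiv ℝ u z) z := fun z hz =>
    ((hu.contDiffAt (hU.mem_nhds hz)).differentiableAt (by norm_num)).hasFDerivAt
  set k : ℝ → ℂ := fun θ => circleMap 0 ρ θ * Complex.I / (circleMap 0 ρ θ - ξ) with hk
  have hkc : Continuous k := by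
    have := continuous_circleMap 0 ρ
    exact (this.mul continuous_const).div (this.sub continuous_const) hne
  set F : ℝ → ℝ → ℂ := fun s θ => u (pt s θ) * k θ
  set F' : ℝ → ℝ → ℂ := fun s θ => fderiv ℝ u (pt s θ) ((circleMap 0 ρ θ - ξ) • e) * k θ
  have hFc : ∀ s ∈ Set.Icc (0 : ℝ) 1, Continuous (F s) := by
    intro s hs
    exact (hu.continuousOn.comp_continuous (hpts s) (hptU s hs)).mul hkc
  have hfd := continuousOn_fderiv_of_contDiffOn hU hu
  have hdb := continuousOn_dbar hU hu
  have hI1 : ∫ θ in (0 : ℝ)..2 * Real.pi, F 1 θ = ∮ ζ in C(0, ρ), (ζ - ξ)⁻¹ * u (q + ζ • e) := by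
    rw [circleIntegral]
    refine intervalIntegral.integral_congr fun θ _ => ?_
    simp only [F, hpt, hk, deriv_circleMap, smul_eq_mul, Complex.ofReal_one, one_mul,
      add_sub_cancel]
    ring
  have hI0 : ∫ θ in (0 : ℝ)..2 * Real.pi, F 0 θ
      = (2 * Real.pi * Complex.I) * u (q + ξ • e) := by
    have h := circleIntegral.integral_sub_inv_of_mem_ball
      (show ξ ∈ Metric.ball (0 : ℂ) ρ by simpa using hξ)
    rw [← h, circleIntegral, ← intervalIntegral.integral_mul_const]
    refine intervalIntegral.integral_congr fun θ _ => ?_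
    simp only [F, hpt, hk, deriv_circleMap, smul_eq_mul, Complex.ofReal_zero, zero_mul, add_zero]
    ring
  have hmain : ‖(∫ θ in (0 : ℝ)..2 * Real.pi, F 1 θ) - ∫ θ in (0 : ℝ)..2 * Real.pi, F 0 θ‖
      ≤ (2 * ρ * σ * (2 * Real.pi)) * (1 - 0) := by
    refine norm_integral_sub_le_of_deriv (F' := F') zero_le_one (by positivity) ?_ ?_
      ((hFc 0 (by simp)).intervalIntegrable _ _) ((hFc 1 (by simp)).intervalIntegrable _ _) ?_
    · intro s hs θ _
      have h1 : HasDerivAt (fun s : ℝ => pt s θ) ((circleMap 0 ρ θ - ξ) • e) s := by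
        have h2 : HasDerivAt (fun s : ℝ => ξ + (s : ℂ) * (circleMap 0 ρ θ - ξ))
            (1 * (circleMap 0 ρ θ - ξ)) s :=
          ((Complex.ofRealCLM.hasDerivAt (x := s)).mul_const _).const_add ξ
        rw [one_mul] at h2
        exact (h2.smul_const e).const_add q
      exact ((hdiff _ (hptU s hs θ)).comp_hasDerivAt s h1).mul_const (k θ)
    · refine ContinuousOn.mul ?_ (hkc.comp continuous_snd).continuousOn
      refine ContinuousOn.clm_apply (hfd.comp hptc.continuousOn fun p hp => hptU p.1 hp.1 p.2) ?_
      have := continuous_circleMap 0 ρ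
      fun_prop
    · intro s hs
      have hs' : s ∈ Set.Icc (0 : ℝ) 1 := ⟨hs.1.le, hs.2⟩
      -- Up to the factor s, the θ-derivative of u along a closed loop, so its integral vanishes;
      -- subtracting it from F' cancels the complex-linear part of du and leaves only ∂̄u.
      set G : ℝ → ℂ := fun θ => fderiv ℝ u (pt s θ) ((circleMap 0 ρ θ * Complex.I) • e)
      have hfds : Continuous fun θ => fderiv ℝ u (pt s θ) :=
        hfd.comp_continuous (hpts s) (hptU s hs')
      have hGc : Continuous G := by
        refine hfds.clm_apply ?_
        have := continuous_circleMap 0 ρ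
        fun_prop
      have hF'c : Continuous (F' s) := by
        refine (hfds.clm_apply ?_).mul hkc
        have := continuous_circleMap 0 ρ
        fun_prop
      have hG0 : ∫ θ in (0 : ℝ)..2 * Real.pi, G θ = 0 := by
        have h3 : ∀ θ, HasDerivAt (fun θ => u (pt s θ)) (s * G θ) θ := by
          intro θ
          have h1 : HasDerivAt (fun θ : ℝ => pt s θ)
              (((s : ℂ) * (circleMap 0 ρ θ * Complex.I)) • e) θ :=
            (((((hasDerivAt_circleMap 0 ρ θ).sub_const ξ).const_mul (s : ℂ)).const_add
              ξ).smul_const e).const_add q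
          have h2 := (hdiff _ (hptU s hs' θ)).comp_hasDerivAt θ h1
          rw [mul_smul, Complex.coe_smul, map_smul] at h2
          exact h2.congr_deriv (by simp [G])
        have h4 := intervalIntegral.integral_eq_sub_of_hasDerivAt
          (a := 0) (b := 2 * Real.pi) (fun θ _ => h3 θ)
          ((continuous_const.mul hGc).intervalIntegrable _ _)
        rw [intervalIntegral.integral_const_mul] at h4
        have h5 : pt s (2 * Real.pi) = pt s 0 := by
          simp only [hpt]
          have := periodic_circleMap 0 ρ 0
          rw [zero_add] at this
          rw [this]
        rw [h5, sub_self] at h4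
        exact (mul_eq_zero.mp h4).resolve_left (by exact_mod_cast hs.1.ne')
      have h6 : ∫ θ in (0 : ℝ)..2 * Real.pi, F' s θ
          = ∫ θ in (0 : ℝ)..2 * Real.pi, (F' s θ - G θ) := by
        rw [intervalIntegral.integral_sub (hF'c.intervalIntegrable _ _)
          (hGc.intervalIntegrable _ _), hG0, sub_zero]
      rw [h6]
      have h7 : ∀ θ, ‖F' s θ - G θ‖ ≤ 2 * ρ * σ := by
        intro θ
        have h8 : F' s θ - G θ = (conj (circleMap 0 ρ θ - ξ) * k θ
            - conj (circleMap 0 ρ θ * Complex.I)) * dbar u (pt s θ) e := by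
          simp only [F', G, fderiv_eq_del_add_dbar, del_smul, dbar_smul]
          have : (circleMap 0 ρ θ - ξ) * k θ = circleMap 0 ρ θ * Complex.I := by
            simp only [hk]
            field_simp [hne θ]
          linear_combination (del u (pt s θ) e) * this
        have h9 : ‖conj (circleMap 0 ρ θ - ξ) * k θ‖ = ρ := by
          have := hne θ
          simp only [hk, norm_mul, norm_div, RCLike.norm_conj, norm_circleMap_zero, abs_of_pos hρ,
            Complex.norm_I, mul_one]
          field_simp [norm_ne_zero_iff.mpr this]
        have h10 : ‖conj (circleMap 0 ρ θ * Complex.I)‖ = ρ := by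
          simp [abs_of_pos hρ]
        have h11 : ‖dbar u (pt s θ) e‖ ≤ σ :=
          ((dbar u (pt s θ)).le_opNorm e).trans
            ((mul_le_of_le_one_right (norm_nonneg _) he).trans (hσ _ (hptU s hs' θ)))
        rw [h8, norm_mul]
        have h12 := norm_sub_le (conj (circleMap 0 ρ θ - ξ) * k θ)
          (conj (circleMap 0 ρ θ * Complex.I))
        rw [h9, h10] at h12
        calc _ ≤ (ρ + ρ) * σ := mul_le_mul h12 h11 (norm_nonneg _) (by positivity)
          _ = 2 * ρ * σ := by ring
      have h13 := intervalIntegral.norm_integral_le_of_norm_le_const (a := 0) (b := 2 * Real.pi)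
        (fun θ _ => h7 θ)
      rwa [sub_zero, abs_of_pos Real.two_pi_pos] at h13
  rw [hI1, hI0] at hmain
  have h2pi : (2 * Real.pi * Complex.I) ≠ 0 := Complex.two_pi_I_ne_zero
  have hnorm : ‖(2 * Real.pi * Complex.I : ℂ)‖ = 2 * Real.pi := by
    simp [abs_of_pos Real.pi_pos]
  have hpos := Real.two_pi_pos
  rw [← norm_neg, ← mul_le_mul_iff_right₀ hpos, ← hnorm, ← norm_mul, hnorm, neg_sub, mul_sub,
    mul_inv_cancel_left₀ h2pi]
  exact hmain.trans (le_of_eq (by ring))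

set_option maxHeartbeats 1000000 in
/-- An interior gradient estimate for approximately holomorphic functions. -/
lemma norm_del_apply_le (hU : IsOpen U) (hu : ContDiffOn ℝ 2 u U) {σ M r : ℝ} (hr : 0 < r)
    {z₀ : CSpace n} (hball : Metric.closedBall z₀ r ⊆ U)
    (hM : ∀ z ∈ Metric.closedBall z₀ r, ‖u z‖ ≤ M)
    (hσ : ∀ z ∈ U, ‖fderiv ℝ (dbar u) z‖ ≤ σ) (v : CSpace n) (hv : ‖v‖ ≤ 1) :
    ‖del u z₀ v‖ ≤ M / r + 2 * σ * r := by
  have hu1 : ContDiffOn ℝ 1 u U := hu.of_le (by norm_num)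
  have hfd := continuousOn_fderiv_of_contDiffOn hU hu1
  have hdb := continuousOn_dbar hU hu1
  have hdiff : ∀ z ∈ U, HasFDerivAt u (fderiv ℝ u z) z := fun z hz =>
    ((hu1.contDiffAt (hU.mem_nhds hz)).differentiableAt (by norm_num)).hasFDerivAt
  have hz₀ : z₀ ∈ U := hball (Metric.mem_closedBall_self hr.le)
  have hσ0 : 0 ≤ σ := (norm_nonneg (fderiv ℝ (dbar u) z₀)).trans (hσ z₀ hz₀)
  let E : ℝ → ℂ := circleMap 0 1
  have hEc : Continuous E := continuous_circleMap 0 1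
  have hE1 : ∀ θ, ‖E θ‖ = 1 := fun θ => by simp [E]
  have hE0 : ∀ θ, E θ ≠ 0 := fun θ h => by simpa [h] using hE1 θ
  have hconj : ∀ θ, conj (E θ) = (E θ)⁻¹ := fun θ => by
    rw [Complex.inv_def, Complex.normSq_eq_norm_sq, hE1]
    simp
  have hEic : Continuous fun θ => (E θ)⁻¹ := hEc.inv₀ hE0
  have hEd : ∀ θ, HasDerivAt E (E θ * Complex.I) θ := fun θ => hasDerivAt_circleMap 0 1 θ
  have hEid : ∀ θ, HasDerivAt (fun θ => (E θ)⁻¹) (-Complex.I * (E θ)⁻¹) θ := fun θ => by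
    refine ((hEd θ).inv (hE0 θ)).congr_deriv ?_
    have := hE0 θ
    field_simp
  have hEper : E (2 * Real.pi) = E 0 := by
    have := periodic_circleMap 0 1 0
    rwa [zero_add] at this
  have hint1 : ∫ θ in (0 : ℝ)..2 * Real.pi, (E θ)⁻¹ = 0 := by
    have h := intervalIntegral.integral_eq_sub_of_hasDerivAt (a := 0) (b := 2 * Real.pi)
      (fun θ _ => hEid θ) ((continuous_const.mul hEic).intervalIntegrable _ _)
    rw [hEper, sub_self, intervalIntegral.integral_const_mul] at h
    exact (mul_eq_zero.mp h).resolve_left (by simp)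
  have hint2 : ∫ θ in (0 : ℝ)..2 * Real.pi, (E θ)⁻¹ * (E θ)⁻¹ = 0 := by
    have hd : ∀ θ, HasDerivAt (fun θ => (E θ)⁻¹ * (E θ)⁻¹)
        (-2 * Complex.I * ((E θ)⁻¹ * (E θ)⁻¹)) θ := fun θ =>
      ((hEid θ).mul (hEid θ)).congr_deriv (by ring)
    have h := intervalIntegral.integral_eq_sub_of_hasDerivAt (a := 0) (b := 2 * Real.pi)
      (fun θ _ => hd θ) ((continuous_const.mul (hEic.mul hEic)).intervalIntegrable _ _)
    rw [hEper, sub_self, intervalIntegral.integral_const_mul] at h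
    exact (mul_eq_zero.mp h).resolve_left (by simp)
  let pt : ℝ → ℝ → CSpace n := fun s θ => z₀ + ((s : ℂ) * E θ) • v
  have hptball : ∀ s ∈ Set.Icc (0 : ℝ) r, ∀ θ, ‖pt s θ - z₀‖ ≤ s := by
    intro s hs θ
    simp only [pt, add_sub_cancel_left, norm_smul, norm_mul, hE1, mul_one, Complex.norm_real,
      Real.norm_of_nonneg hs.1]
    exact mul_le_of_le_one_right hs.1 hv
  have hptB : ∀ s ∈ Set.Icc (0 : ℝ) r, ∀ θ, pt s θ ∈ Metric.closedBall z₀ r := fun s hs θ =>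
    mem_closedBall_iff_norm.mpr ((hptball s hs θ).trans hs.2)
  have hptU : ∀ s ∈ Set.Icc (0 : ℝ) r, ∀ θ, pt s θ ∈ U := fun s hs θ => hball (hptB s hs θ)
  have hptc : Continuous fun p : ℝ × ℝ => pt p.1 p.2 := by
    simp only [pt]
    fun_prop
  have hpts : ∀ s, Continuous (pt s) := fun s => by
    simp only [pt]
    fun_prop
  have hds : ∀ s θ, HasDerivAt (fun s : ℝ => pt s θ) (E θ • v) s := by
    intro s θ
    have h2 : HasDerivAt (fun s : ℝ => (s : ℂ) * E θ) (1 * E θ) s :=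
      (Complex.ofRealCLM.hasDerivAt (x := s)).mul_const _
    rw [one_mul] at h2
    exact (h2.smul_const v).const_add z₀
  have hBdiff : ∀ s ∈ Set.Icc (0 : ℝ) r, ∀ θ, ‖dbar u (pt s θ) v - dbar u z₀ v‖ ≤ σ * s := by
    intro s hs θ
    have h := (convex_closedBall z₀ r).norm_image_sub_le_of_norm_fderiv_le (𝕜 := ℝ)
      (fun z hz => differentiableAt_dbar hU hu (hball hz)) (fun z hz => hσ z (hball hz))
      (Metric.mem_closedBall_self hr.le) (hptB s hs θ)
    rw [← sub_apply]
    refine ((dbar u (pt s θ) - dbar u z₀).le_opNorm v).trans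
      ((mul_le_of_le_one_right (norm_nonneg _) hv).trans (h.trans ?_))
    exact mul_le_mul_of_nonneg_left (hptball s hs θ) hσ0
  -- Cauchy integrand for the first derivative: its θ-integral tends to 2π `del u z₀ v` as s → 0 and
  -- is at most 2πM/r at s = r. The proof bounds its variation in s.
  let F : ℝ → ℝ → ℂ := fun s θ => (s : ℂ)⁻¹ * u (pt s θ) * (E θ)⁻¹
  let F' : ℝ → ℝ → ℂ := fun s θ =>
    ((s : ℂ)⁻¹ * fderiv ℝ u (pt s θ) (E θ • v) - ((s : ℂ) ^ 2)⁻¹ * u (pt s θ)) * (E θ)⁻¹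
  have huc : ∀ s ∈ Set.Icc (0 : ℝ) r, Continuous fun θ => u (pt s θ) := fun s hs =>
    hu.continuousOn.comp_continuous (hpts s) (hptU s hs)
  have hfdc : ∀ s ∈ Set.Icc (0 : ℝ) r, ∀ w : ℝ → CSpace n, Continuous w →
      Continuous fun θ => fderiv ℝ u (pt s θ) (w θ) := fun s hs w hw =>
    (hfd.comp_continuous (hpts s) (hptU s hs)).clm_apply hw
  have hFc : ∀ s ∈ Set.Icc (0 : ℝ) r, Continuous (F s) := fun s hs =>
    (continuous_const.mul (huc s hs)).mul hEic
  have hF'c : ∀ s ∈ Set.Icc (0 : ℝ) r, Continuous (F' s) := fun s hs =>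
    ((continuous_const.mul (hfdc s hs _ (hEc.smul continuous_const))).sub
      (continuous_const.mul (huc s hs))).mul hEic
  have hinner : ∀ s ∈ Set.Ioc (0 : ℝ) r,
      ‖∫ θ in (0 : ℝ)..2 * Real.pi, F' s θ‖ ≤ 2 * σ * (2 * Real.pi) := by
    intro s hs
    have hs' : s ∈ Set.Icc (0 : ℝ) r := ⟨hs.1.le, hs.2⟩
    have hs0 : (s : ℂ) ≠ 0 := by exact_mod_cast hs.1.ne'
    let G : ℝ → ℂ := fun θ => s * fderiv ℝ u (pt s θ) ((E θ * Complex.I) • v) * (E θ)⁻¹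
      + u (pt s θ) * (-Complex.I * (E θ)⁻¹)
    have hGc : Continuous G :=
      ((continuous_const.mul (hfdc s hs' _
        ((hEc.mul continuous_const).smul continuous_const))).mul hEic).add
        ((huc s hs').mul (continuous_const.mul hEic))
    have hG0 : ∫ θ in (0 : ℝ)..2 * Real.pi, G θ = 0 := by
      have h3 : ∀ θ, HasDerivAt (fun θ => u (pt s θ) * (E θ)⁻¹) (G θ) θ := by
        intro θ
        have h1 : HasDerivAt (fun θ : ℝ => pt s θ) (((s : ℂ) * (E θ * Complex.I)) • v) θ :=
          (((hEd θ).const_mul (s : ℂ)).smul_const v).const_add z₀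
        have h2 := (hdiff _ (hptU s hs' θ)).comp_hasDerivAt θ h1
        rw [mul_smul, Complex.coe_smul, map_smul] at h2
        exact (h2.mul (hEid θ)).congr_deriv (by simp [G])
      have h4 := intervalIntegral.integral_eq_sub_of_hasDerivAt
        (a := 0) (b := 2 * Real.pi) (fun θ _ => h3 θ) (hGc.intervalIntegrable _ _)
      have h5 : pt s (2 * Real.pi) = pt s 0 := by simp only [pt, hEper]
      rw [h4, h5, hEper, sub_self]
    -- Two terms of mean zero are removed. The multiple of G cancels u and the complex-linear part;
    -- ∂̄u frozen at z₀ leaves only the oscillation of ∂̄u, at most σs, which pays for the factor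
    -- s⁻¹.
    have hsplit : ∫ θ in (0 : ℝ)..2 * Real.pi, F' s θ = ∫ θ in (0 : ℝ)..2 * Real.pi,
        (F' s θ - (Complex.I * (s : ℂ) ^ 2)⁻¹ * G θ
          - 2 * (s : ℂ)⁻¹ * dbar u z₀ v * ((E θ)⁻¹ * (E θ)⁻¹)) := by
      rw [intervalIntegral.integral_sub, intervalIntegral.integral_sub,
        intervalIntegral.integral_const_mul, intervalIntegral.integral_const_mul, hG0, hint2]
      · simp
      · exact (hF'c s hs').intervalIntegrable _ _
      · exact (continuous_const.mul hGc).intervalIntegrable _ _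
      · exact ((hF'c s hs').sub (continuous_const.mul hGc)).intervalIntegrable _ _
      · exact (continuous_const.mul (hEic.mul hEic)).intervalIntegrable _ _
    rw [hsplit]
    have hpoint : ∀ θ, ‖F' s θ - (Complex.I * (s : ℂ) ^ 2)⁻¹ * G θ
          - 2 * (s : ℂ)⁻¹ * dbar u z₀ v * ((E θ)⁻¹ * (E θ)⁻¹)‖ ≤ 2 * σ := by
      intro θ
      have h8 : F' s θ - (Complex.I * (s : ℂ) ^ 2)⁻¹ * G θ
          - 2 * (s : ℂ)⁻¹ * dbar u z₀ v * ((E θ)⁻¹ * (E θ)⁻¹)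
          = 2 * (s : ℂ)⁻¹ * ((E θ)⁻¹ * (E θ)⁻¹) * (dbar u (pt s θ) v - dbar u z₀ v) := by
        have := hE0 θ
        simp only [F', G, fderiv_eq_del_add_dbar, del_smul, dbar_smul, map_mul, hconj,
          Complex.conj_I]
        have hI := Complex.I_ne_zero
        have hI2 := Complex.I_sq
        field_simp
        ring
      rw [h8, norm_mul, norm_mul, norm_mul, norm_mul, norm_inv, norm_inv, hE1, Complex.norm_real,
        Real.norm_of_nonneg hs.1.le, Complex.norm_ofNat]
      have h9 := hBdiff s hs' θ
      have hspos := hs.1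
      calc 2 * s⁻¹ * (1⁻¹ * 1⁻¹) * ‖dbar u (pt s θ) v - dbar u z₀ v‖
          ≤ 2 * s⁻¹ * (1⁻¹ * 1⁻¹) * (σ * s) := by gcongr
        _ = 2 * σ := by field_simp
    have h13 := intervalIntegral.norm_integral_le_of_norm_le_const (a := 0) (b := 2 * Real.pi)
      (fun θ _ => hpoint θ)
    rwa [sub_zero, abs_of_pos Real.two_pi_pos] at h13
  have hpos := Real.two_pi_pos
  have houter : ‖∫ θ in (0 : ℝ)..2 * Real.pi, F r θ‖ ≤ M / r * (2 * Real.pi) := by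
    have h := intervalIntegral.norm_integral_le_of_norm_le_const (a := 0) (b := 2 * Real.pi)
      (f := F r) (C := M / r) (fun θ _ => by
        simp only [F, norm_mul, norm_inv, hE1, Complex.norm_real, Real.norm_of_nonneg hr.le,
          inv_one, mul_one]
        rw [div_eq_inv_mul]
        exact mul_le_mul_of_nonneg_left (hM _ (hptB r ⟨hr.le, le_rfl⟩ θ)) (inv_nonneg.mpr hr.le))
    rwa [sub_zero, abs_of_pos hpos] at h
  refine le_of_forall_pos_le_add fun ε hε => ?_
  obtain ⟨η₀, hη₀, hη₀d⟩ := Metric.eventually_nhds_iff_ball.mp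
    ((hasFDerivAt_iff_isLittleO.mp (hdiff z₀ hz₀)).def hε)
  -- On the circle of radius η, u agrees with its first-order expansion up to ε times the distance,
  -- so the mean of F recovers `del u z₀ v` up to ε.
  set η := min (η₀ / 2) r
  have hη : 0 < η := lt_min (half_pos hη₀) hr
  have hηr : η ≤ r := min_le_right _ _
  have hηI : η ∈ Set.Icc (0 : ℝ) r := ⟨hη.le, hηr⟩
  have hη0 : (η : ℂ) ≠ 0 := by exact_mod_cast hη.ne'
  have hsmall : ‖2 * Real.pi * del u z₀ v - ∫ θ in (0 : ℝ)..2 * Real.pi, F η θ‖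
      ≤ ε * (2 * Real.pi) := by
    have hsplit : 2 * Real.pi * del u z₀ v - ∫ θ in (0 : ℝ)..2 * Real.pi, F η θ
        = ∫ θ in (0 : ℝ)..2 * Real.pi, (del u z₀ v - F η θ + (η : ℂ)⁻¹ * u z₀ * (E θ)⁻¹
          + dbar u z₀ v * ((E θ)⁻¹ * (E θ)⁻¹)) := by
      rw [intervalIntegral.integral_add, intervalIntegral.integral_add,
        intervalIntegral.integral_sub, intervalIntegral.integral_const_mul,
        intervalIntegral.integral_const_mul, hint1, hint2, intervalIntegral.integral_const]
      · simp
      · exact continuous_const.intervalIntegrable _ _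
      · exact (hFc η hηI).intervalIntegrable _ _
      · exact (continuous_const.sub (hFc η hηI)).intervalIntegrable _ _
      · exact (continuous_const.mul hEic).intervalIntegrable _ _
      · exact ((continuous_const.sub (hFc η hηI)).add
          (continuous_const.mul hEic)).intervalIntegrable _ _
      · exact (continuous_const.mul (hEic.mul hEic)).intervalIntegrable _ _
    rw [hsplit]
    have h13 := intervalIntegral.norm_integral_le_of_norm_le_const (a := 0) (b := 2 * Real.pi)
      (C := ε) (f := fun θ => del u z₀ v - F η θ + (η : ℂ)⁻¹ * u z₀ * (E θ)⁻¹
          + dbar u z₀ v * ((E θ)⁻¹ * (E θ)⁻¹)) (fun θ _ => by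
        have h1 : ‖pt η θ - z₀‖ ≤ η := hptball η hηI θ
        have h2 := hη₀d (pt η θ) (by
          rw [mem_ball_iff_norm]
          exact h1.trans_lt ((min_le_left _ _).trans_lt (half_lt_self hη₀)))
        have h3 : pt η θ - z₀ = ((η : ℂ) * E θ) • v := by simp [pt]
        have h4 : del u z₀ v - F η θ + (η : ℂ)⁻¹ * u z₀ * (E θ)⁻¹
          + dbar u z₀ v * ((E θ)⁻¹ * (E θ)⁻¹)
          = -((η : ℂ)⁻¹ * (E θ)⁻¹ * (u (pt η θ) - u z₀ - fderiv ℝ u z₀ (pt η θ - z₀))) := by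
          have := hE0 θ
          rw [h3]
          simp only [F, fderiv_eq_del_add_dbar, del_smul, dbar_smul, map_mul, hconj,
            Complex.conj_ofReal]
          field_simp
          ring
        rw [h4, norm_neg, norm_mul, norm_mul, norm_inv, norm_inv, hE1, Complex.norm_real,
          Real.norm_of_nonneg hη.le, inv_one, mul_one]
        rw [inv_mul_le_iff₀ hη]
        refine h2.trans ?_
        rw [mul_comm]
        exact mul_le_mul_of_nonneg_right h1 hε.le)
    rwa [sub_zero, abs_of_pos hpos] at h13
  have hmain : ‖(∫ θ in (0 : ℝ)..2 * Real.pi, F r θ) - ∫ θ in (0 : ℝ)..2 * Real.pi, F η θ‖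
      ≤ (2 * σ * (2 * Real.pi)) * (r - η) := by
    refine norm_integral_sub_le_of_deriv (F' := F') hηr hpos.le ?_ ?_
      ((hFc η hηI).intervalIntegrable _ _) ((hFc r ⟨hr.le, le_rfl⟩).intervalIntegrable _ _)
      fun s hs => hinner s ⟨hη.trans hs.1, hs.2⟩
    · intro s hs θ _
      have hs0 : (s : ℂ) ≠ 0 := by exact_mod_cast (hη.trans_le hs.1).ne'
      have h1 := (hdiff _ (hptU s ⟨hη.le.trans hs.1, hs.2⟩ θ)).comp_hasDerivAt s (hds s θ)
      have h2 : HasDerivAt (fun s : ℝ => (s : ℂ)⁻¹) (-1 / (s : ℂ) ^ 2) s :=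
        (Complex.ofRealCLM.hasDerivAt (x := s)).inv hs0
      refine ((h2.mul h1).mul_const (E θ)⁻¹).congr_deriv ?_
      simp only [F', Function.comp]
      ring
    · have hcs : ContinuousOn (fun p : ℝ × ℝ => ((p.1 : ℂ))⁻¹)
          (Set.Icc η r ×ˢ Set.Icc 0 (2 * Real.pi)) := by
        refine ContinuousOn.inv₀ (by fun_prop) fun p hp => ?_
        exact_mod_cast (hη.trans_le hp.1.1).ne'
      have hcs2 : ContinuousOn (fun p : ℝ × ℝ => ((p.1 : ℂ) ^ 2)⁻¹)
          (Set.Icc η r ×ˢ Set.Icc 0 (2 * Real.pi)) := by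
        refine ContinuousOn.inv₀ (by fun_prop) fun p hp => pow_ne_zero 2 ?_
        exact_mod_cast (hη.trans_le hp.1.1).ne'
      have hmaps : ∀ p ∈ Set.Icc η r ×ˢ Set.Icc 0 (2 * Real.pi), pt p.1 p.2 ∈ U :=
        fun p hp => hptU p.1 ⟨hη.le.trans hp.1.1, hp.1.2⟩ p.2
      have hEs : Continuous fun p : ℝ × ℝ => E p.2 • v :=
        (hEc.comp continuous_snd).smul continuous_const
      exact ((hcs.mul ((hfd.comp hptc.continuousOn hmaps).clm_apply hEs.continuousOn)).sub
        (hcs2.mul (hu.continuousOn.comp hptc.continuousOn hmaps))).mul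
        (hEic.comp continuous_snd).continuousOn
  have hnorm : ‖(2 * Real.pi * del u z₀ v : ℂ)‖ = 2 * Real.pi * ‖del u z₀ v‖ := by
    simp [abs_of_pos Real.pi_pos]
  have htri : ‖(2 * Real.pi * del u z₀ v : ℂ)‖ ≤ ε * (2 * Real.pi)
      + (2 * σ * (2 * Real.pi)) * (r - η) + M / r * (2 * Real.pi) := by
    have h1 := norm_sub_norm_le (2 * Real.pi * del u z₀ v) (∫ θ in (0 : ℝ)..2 * Real.pi, F η θ)
    have h2 := norm_sub_norm_le (∫ θ in (0 : ℝ)..2 * Real.pi, F η θ)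
      (∫ θ in (0 : ℝ)..2 * Real.pi, F r θ)
    rw [norm_sub_rev] at h2
    linarith
  rw [hnorm] at htri
  have h5 : 2 * σ * (2 * Real.pi) * (r - η) ≤ 2 * σ * (2 * Real.pi) * r := by
    refine mul_le_mul_of_nonneg_left (by linarith) (by positivity)
  rw [← mul_le_mul_iff_right₀ hpos]
  linarith

end SliceEstimates

/-! ### Polynomial approximation, one complex variable at a time -/

section PolynomialApproximation

open MeasureTheory

variable {n : ℕ}

/-- The point obtained from `z` by replacing the `j`-th coordinate by `p j + ζ`. -/
noncomputable def setCoord (p : CSpace n) (j : Fin n) (ζ : ℂ) (z : CSpace n) : CSpace n :=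
  z + (p j - z j) • EuclideanSpace.single j 1 + ζ • EuclideanSpace.single j 1

lemma setCoord_apply (p : CSpace n) (j : Fin n) (ζ : ℂ) (z : CSpace n) (i : Fin n) :
    setCoord p j ζ z i = if i = j then p j + ζ else z i := by
  by_cases h : i = j
  · subst h
    simp [setCoord]
  · simp [setCoord, h]

lemma setCoord_setCoord (p : CSpace n) (j : Fin n) (ζ ζ' : ℂ) (z : CSpace n) :
    setCoord p j ζ (setCoord p j ζ' z) = setCoord p j ζ z := by
  ext i
  simp only [setCoord_apply]
  split_ifs <;> rfl

lemma setCoord_comm (p : CSpace n) {i j : Fin n} (hij : i ≠ j) (ζ ζ' : ℂ) (z : CSpace n) :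
    setCoord p j ζ (setCoord p i ζ' z) = setCoord p i ζ' (setCoord p j ζ z) := by
  ext k
  simp only [setCoord_apply]
  by_cases h : k = j
  · subst h
    simp [hij.symm]
  · simp [h]

lemma continuous_setCoord (p : CSpace n) (j : Fin n) :
    Continuous fun q : ℂ × CSpace n => setCoord p j q.1 q.2 := by
  unfold setCoord
  fun_prop

/-- The `k`-th Cauchy coefficient of `φ` in the `j`-th variable, on the circle of radius `ρ`
around `p j`. -/
noncomputable def cauchyCoeff (p : CSpace n) (ρ : ℝ) (j : Fin n) (k : ℕ) (φ : CSpace n → ℂ)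
    (z : CSpace n) : ℂ :=
  (2 * Real.pi : ℂ)⁻¹ *
    ∫ θ in (0 : ℝ)..2 * Real.pi, φ (setCoord p j (circleMap 0 ρ θ) z) * (circleMap 0 ρ θ)⁻¹ ^ k

/-- The Taylor polynomial of degree less than `d` in the `j`-th variable. -/
noncomputable def taylorCoord (p : CSpace n) (ρ : ℝ) (d : ℕ) (j : Fin n) (φ : CSpace n → ℂ)
    (z : CSpace n) : ℂ :=
  ∑ k ∈ Finset.range d, (z j - p j) ^ k * cauchyCoeff p ρ j k φ z

lemma continuous_inv_circleMap {ρ : ℝ} (hρ : 0 < ρ) : Continuous fun θ => (circleMap 0 ρ θ)⁻¹ :=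
  (continuous_circleMap 0 ρ).inv₀ fun θ h => by
    have := norm_circleMap_zero ρ θ
    rw [h, norm_zero, abs_of_pos hρ] at this
    exact hρ.ne this

lemma continuous_cauchyIntegrand (p : CSpace n) {ρ : ℝ} (hρ : 0 < ρ) (j : Fin n) (k : ℕ)
    {φ : CSpace n → ℂ} (hφ : Continuous φ) :
    Continuous fun q : CSpace n × ℝ =>
      φ (setCoord p j (circleMap 0 ρ q.2) q.1) * (circleMap 0 ρ q.2)⁻¹ ^ k := by
  refine Continuous.mul ?_ (((continuous_inv_circleMap hρ).comp continuous_snd).pow k)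
  exact hφ.comp ((continuous_setCoord p j).comp
    (((continuous_circleMap 0 ρ).comp continuous_snd).prodMk continuous_fst))

lemma intervalIntegrable_cauchyIntegrand (p : CSpace n) {ρ : ℝ} (hρ : 0 < ρ) (j : Fin n) (k : ℕ)
    {φ : CSpace n → ℂ} (hφ : Continuous φ) (z : CSpace n) (a b : ℝ) :
    IntervalIntegrable (fun θ => φ (setCoord p j (circleMap 0 ρ θ) z) * (circleMap 0 ρ θ)⁻¹ ^ k)
      volume a b :=
  ((continuous_cauchyIntegrand p hρ j k hφ).comp
    (Continuous.prodMk_right z)).intervalIntegrable a b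

lemma continuous_cauchyCoeff (p : CSpace n) {ρ : ℝ} (hρ : 0 < ρ) (j : Fin n) (k : ℕ)
    {φ : CSpace n → ℂ} (hφ : Continuous φ) : Continuous (cauchyCoeff p ρ j k φ) := by
  unfold cauchyCoeff
  exact continuous_const.mul (intervalIntegral.continuous_parametric_intervalIntegral_of_continuous'
    (continuous_cauchyIntegrand p hρ j k hφ) _ _)

lemma cauchyCoeff_add (p : CSpace n) {ρ : ℝ} (hρ : 0 < ρ) (j : Fin n) (k : ℕ)
    {φ ψ : CSpace n → ℂ} (hφ : Continuous φ) (hψ : Continuous ψ) :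
    cauchyCoeff p ρ j k (φ + ψ) = cauchyCoeff p ρ j k φ + cauchyCoeff p ρ j k ψ := by
  ext z
  simp only [cauchyCoeff, Pi.add_apply, add_mul]
  rw [intervalIntegral.integral_add (intervalIntegrable_cauchyIntegrand p hρ j k hφ z _ _)
    (intervalIntegrable_cauchyIntegrand p hρ j k hψ z _ _), mul_add]

lemma cauchyCoeff_smul (p : CSpace n) (ρ : ℝ) (j : Fin n) (k : ℕ) (a : ℂ) (φ : CSpace n → ℂ) :
    cauchyCoeff p ρ j k (a • φ) = a • cauchyCoeff p ρ j k φ := by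
  ext z
  simp only [cauchyCoeff, Pi.smul_apply, smul_eq_mul, mul_assoc,
    intervalIntegral.integral_const_mul]
  ring

lemma norm_cauchyCoeff_sub_le (p : CSpace n) {ρ : ℝ} (hρ : 0 < ρ) (j : Fin n) (k : ℕ)
    {φ ψ : CSpace n → ℂ} (hφ : Continuous φ) (hψ : Continuous ψ) (z : CSpace n) {η : ℝ}
    (h : ∀ ζ : ℂ, ‖ζ‖ = ρ → ‖φ (setCoord p j ζ z) - ψ (setCoord p j ζ z)‖ ≤ η) :
    ‖cauchyCoeff p ρ j k φ z - cauchyCoeff p ρ j k ψ z‖ ≤ η * ρ⁻¹ ^ k := by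
  simp only [cauchyCoeff]
  rw [← mul_sub, ← intervalIntegral.integral_sub (intervalIntegrable_cauchyIntegrand p hρ j k hφ z _ _)
    (intervalIntegrable_cauchyIntegrand p hρ j k hψ z _ _)]
  have hbd := intervalIntegral.norm_integral_le_of_norm_le_const (a := 0) (b := 2 * Real.pi)
    (C := η * ρ⁻¹ ^ k) (f := fun θ => φ (setCoord p j (circleMap 0 ρ θ) z) * (circleMap 0 ρ θ)⁻¹ ^ k
      - ψ (setCoord p j (circleMap 0 ρ θ) z) * (circleMap 0 ρ θ)⁻¹ ^ k) (fun θ _ => by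
      have hn : ‖circleMap 0 ρ θ‖ = ρ := by rw [norm_circleMap_zero, abs_of_pos hρ]
      rw [← sub_mul, norm_mul, norm_pow, norm_inv, hn]
      exact mul_le_mul_of_nonneg_right (h _ hn) (by positivity))
  rw [sub_zero, abs_of_pos Real.two_pi_pos] at hbd
  have hnorm : ‖(2 * Real.pi : ℂ)⁻¹‖ = (2 * Real.pi)⁻¹ := by simp [abs_of_pos Real.pi_pos]
  rw [norm_mul, hnorm, inv_mul_le_iff₀ Real.two_pi_pos]
  linarith

/-- An approximately holomorphic function is close to its Taylor polynomial in one variable. -/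
lemma norm_sub_taylorCoord_le {u : CSpace n → ℂ} {U : Set (CSpace n)} (hU : IsOpen U)
    (hu : ContDiffOn ℝ 1 u U) {σ : ℝ} (hσ : ∀ z ∈ U, ‖dbar u z‖ ≤ σ) (hu1 : ∀ z ∈ U, ‖u z‖ ≤ 1)
    (p : CSpace n) {ρ : ℝ} (hρ : 0 < ρ) (d : ℕ) (j : Fin n) (z : CSpace n)
    (hsub : ∀ ζ : ℂ, ‖ζ‖ ≤ ρ → setCoord p j ζ z ∈ U) (hz : ‖z j - p j‖ ≤ ρ / 2) :
    ‖u z - taylorCoord p ρ d j u z‖ ≤ 2 * ρ * σ + 2 * (1 / 2) ^ d := by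
  set e : CSpace n := EuclideanSpace.single j 1
  set ξ := z j - p j
  have he : ‖e‖ ≤ 1 := by simp [e]
  have hzξ : z + (p j - z j) • e + ξ • e = z := by
    rw [add_assoc, ← add_smul]
    simp [ξ]
  have hc := norm_sub_cauchyIntegral_le hU hu hσ (z + (p j - z j) • e) e he hρ hsub
    (ξ := ξ) (by linarith)
  rw [hzξ] at hc
  have hn : ∀ θ, ‖circleMap 0 ρ θ‖ = ρ := fun θ => by rw [norm_circleMap_zero, abs_of_pos hρ]
  have h0 : ∀ θ, circleMap 0 ρ θ ≠ 0 := fun θ h => by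
    have := hn θ
    rw [h, norm_zero] at this
    exact hρ.ne this
  have hlow : ∀ θ, ρ / 2 ≤ ‖circleMap 0 ρ θ - ξ‖ := fun θ => by
    have := norm_sub_norm_le (circleMap 0 ρ θ) ξ
    rw [hn] at this
    linarith
  have h1 : ∀ θ, circleMap 0 ρ θ - ξ ≠ 0 := fun θ h => by
    have := hlow θ
    rw [h, norm_zero] at this
    linarith
  have huc : Continuous fun θ => u (setCoord p j (circleMap 0 ρ θ) z) := by
    refine hu.continuousOn.comp_continuous ?_ fun θ => hsub _ (hn θ).le
    exact (continuous_setCoord p j).comp ((continuous_circleMap 0 ρ).prodMk continuous_const)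
  have hic := continuous_inv_circleMap hρ
  -- The first d terms of the geometric series of ζ/(ζ - ξ) are the Taylor kernel; the remainder is
  -- (ξ/ζ)^d ζ/(ζ - ξ), of size at most 2·2⁻ᵈ because |ξ| ≤ ρ/2.
  have hdiff : (2 * Real.pi * Complex.I)⁻¹ * (∮ ζ in C(0, ρ),
      (ζ - ξ)⁻¹ * u (z + (p j - z j) • e + ζ • e)) - taylorCoord p ρ d j u z
      = (2 * Real.pi : ℂ)⁻¹ * ∫ θ in (0 : ℝ)..2 * Real.pi, (ξ * (circleMap 0 ρ θ)⁻¹) ^ d *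
        (circleMap 0 ρ θ / (circleMap 0 ρ θ - ξ)) * u (setCoord p j (circleMap 0 ρ θ) z) := by
    have h2 : (∮ ζ in C(0, ρ), (ζ - ξ)⁻¹ * u (z + (p j - z j) • e + ζ • e))
        = Complex.I * ∫ θ in (0 : ℝ)..2 * Real.pi, (circleMap 0 ρ θ / (circleMap 0 ρ θ - ξ)) *
          u (setCoord p j (circleMap 0 ρ θ) z) := by
      rw [circleIntegral, ← intervalIntegral.integral_const_mul]
      refine intervalIntegral.integral_congr fun θ _ => ?_
      simp only [deriv_circleMap, smul_eq_mul, setCoord, e]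
      ring
    have h3 : taylorCoord p ρ d j u z = (2 * Real.pi : ℂ)⁻¹ * ∫ θ in (0 : ℝ)..2 * Real.pi,
        ∑ k ∈ Finset.range d, ξ ^ k *
          (u (setCoord p j (circleMap 0 ρ θ) z) * (circleMap 0 ρ θ)⁻¹ ^ k) := by
      rw [intervalIntegral.integral_finsetSum, Finset.mul_sum]
      · refine Finset.sum_congr rfl fun k _ => ?_
        rw [intervalIntegral.integral_const_mul, cauchyCoeff]
        ring
      · intro k _
        exact (continuous_const.mul (huc.mul (hic.pow k))).intervalIntegrable _ _
    rw [h2, h3, mul_inv, mul_assoc, inv_mul_cancel_left₀ Complex.I_ne_zero, ← mul_sub,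
      ← intervalIntegral.integral_sub]
    · congr 1
      refine intervalIntegral.integral_congr fun θ _ => ?_
      have hx1 : ξ * (circleMap 0 ρ θ)⁻¹ ≠ 1 := by
        intro h
        apply h1 θ
        have := h0 θ
        field_simp at h
        rw [h, sub_self]
      have hgeom := geom_sum_eq hx1 d
      have hsum : ∑ k ∈ Finset.range d, ξ ^ k *
          (u (setCoord p j (circleMap 0 ρ θ) z) * (circleMap 0 ρ θ)⁻¹ ^ k)
          = u (setCoord p j (circleMap 0 ρ θ) z) *
            ∑ k ∈ Finset.range d, (ξ * (circleMap 0 ρ θ)⁻¹) ^ k := by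
        rw [Finset.mul_sum]
        refine Finset.sum_congr rfl fun k _ => ?_
        rw [mul_pow]
        ring
      have hinv : circleMap 0 ρ θ / (circleMap 0 ρ θ - ξ)
          = -(ξ * (circleMap 0 ρ θ)⁻¹ - 1)⁻¹ := by
        have := h0 θ
        have := h1 θ
        have : ξ * (circleMap 0 ρ θ)⁻¹ - 1 = -((circleMap 0 ρ θ - ξ) / circleMap 0 ρ θ) := by
          field_simp
          ring
        rw [this, inv_neg, neg_neg, inv_div]
      simp only [hsum, hgeom, hinv]
      ring
    · exact (((continuous_circleMap 0 ρ).div ((continuous_circleMap 0 ρ).sub continuous_const)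
        h1).mul huc).intervalIntegrable _ _
    · exact (continuous_finsetSum _ fun k _ =>
        continuous_const.mul (huc.mul (hic.pow k))).intervalIntegrable _ _
  have htail : ‖(2 * Real.pi * Complex.I)⁻¹ * (∮ ζ in C(0, ρ),
      (ζ - ξ)⁻¹ * u (z + (p j - z j) • e + ζ • e)) - taylorCoord p ρ d j u z‖
      ≤ 2 * (1 / 2) ^ d := by
    rw [hdiff]
    have hbd := intervalIntegral.norm_integral_le_of_norm_le_const (a := 0) (b := 2 * Real.pi)
      (C := 2 * (1 / 2) ^ d) (f := fun θ => (ξ * (circleMap 0 ρ θ)⁻¹) ^ d *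
        (circleMap 0 ρ θ / (circleMap 0 ρ θ - ξ)) * u (setCoord p j (circleMap 0 ρ θ) z))
      (fun θ _ => by
        have h4 : ‖ξ * (circleMap 0 ρ θ)⁻¹‖ ≤ 1 / 2 := by
          rw [norm_mul, norm_inv, hn, ← div_eq_mul_inv, div_le_iff₀ hρ]
          linarith
        have h5 : ‖circleMap 0 ρ θ / (circleMap 0 ρ θ - ξ)‖ ≤ 2 := by
          rw [norm_div, hn, div_le_iff₀ (by linarith [hlow θ])]
          linarith [hlow θ]
        have h6 := hu1 _ (hsub _ (hn θ).le)
        rw [norm_mul, norm_mul, norm_pow]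
        calc ‖ξ * (circleMap 0 ρ θ)⁻¹‖ ^ d * ‖circleMap 0 ρ θ / (circleMap 0 ρ θ - ξ)‖ *
              ‖u (setCoord p j (circleMap 0 ρ θ) z)‖ ≤ (1 / 2) ^ d * 2 * 1 := by gcongr
          _ = 2 * (1 / 2) ^ d := by ring)
    rw [sub_zero, abs_of_pos Real.two_pi_pos] at hbd
    have hnorm : ‖(2 * Real.pi : ℂ)⁻¹‖ = (2 * Real.pi)⁻¹ := by simp [abs_of_pos Real.pi_pos]
    rw [norm_mul, hnorm, inv_mul_le_iff₀ Real.two_pi_pos]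
    linarith
  calc _ = ‖(u z - (2 * Real.pi * Complex.I)⁻¹ * (∮ ζ in C(0, ρ),
      (ζ - ξ)⁻¹ * u (z + (p j - z j) • e + ζ • e)))
      + ((2 * Real.pi * Complex.I)⁻¹ * (∮ ζ in C(0, ρ),
      (ζ - ξ)⁻¹ * u (z + (p j - z j) • e + ζ • e)) - taylorCoord p ρ d j u z)‖ := by
        congr 1
        ring
    _ ≤ _ := (norm_add_le _ _).trans (add_le_add hc htail)

/-- Functions that are polynomial (of degree less than `d`) in each of the variables in `J`, with
continuous coefficients. -/
noncomputable def partialPoly (p : CSpace n) (d : ℕ) (J : Finset (Fin n)) :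
    Submodule ℂ (CSpace n → ℂ) :=
  Submodule.span ℂ {φ | ∃ (α : Fin n → ℕ) (c : CSpace n → ℂ), (∀ j, α j ≤ d) ∧
    (∀ j, j ∉ J → α j = 0) ∧ Continuous c ∧ (∀ j ∈ J, ∀ ζ z, c (setCoord p j ζ z) = c z) ∧
    φ = fun z => (∏ j, (z j - p j) ^ α j) * c z}

lemma continuous_of_mem_partialPoly {p : CSpace n} {d : ℕ} {J : Finset (Fin n)}
    {φ : CSpace n → ℂ} (hφ : φ ∈ partialPoly p d J) : Continuous φ := by
  induction hφ using Submodule.span_induction with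
  | mem φ h =>
    obtain ⟨α, c, -, -, hc, -, rfl⟩ := h
    refine Continuous.mul (continuous_finsetProd _ fun j _ => ?_) hc
    fun_prop
  | zero => exact continuous_const
  | add φ ψ _ _ h1 h2 => exact h1.add h2
  | smul a φ _ h => exact h.const_smul a

/-- Monomials in the variables of J do not involve z_j, so they pass through the Cauchy integral.
The new coefficients do not depend on z_j, which is overwritten, and remain independent of the
variables in J because coordinate replacements commute. -/
lemma taylorCoord_mem_partialPoly {p : CSpace n} {ρ : ℝ} (hρ : 0 < ρ) {d : ℕ}
    {J : Finset (Fin n)} {j : Fin n} (hj : j ∉ J) {φ : CSpace n → ℂ}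
    (hφ : φ ∈ partialPoly p d J) : taylorCoord p ρ d j φ ∈ partialPoly p d (insert j J) := by
  induction hφ using Submodule.span_induction with
  | mem φ h =>
    obtain ⟨α, c, hαd, hα, hc, hinv, rfl⟩ := h
    have hcoeff : ∀ k z, cauchyCoeff p ρ j k (fun z => (∏ j, (z j - p j) ^ α j) * c z) z
        = (∏ j, (z j - p j) ^ α j) * cauchyCoeff p ρ j k c z := by
      intro k z
      have hmono : ∀ ζ, (∏ i, (setCoord p j ζ z i - p i) ^ α i) = ∏ i, (z i - p i) ^ α i := by
        intro ζ
        refine Finset.prod_congr rfl fun i _ => ?_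
        by_cases hi : i = j
        · subst hi
          simp [hα i hj]
        · rw [setCoord_apply, if_neg hi]
      simp only [cauchyCoeff, hmono, mul_assoc, intervalIntegral.integral_const_mul]
      ring
    have hsum : taylorCoord p ρ d j (fun z => (∏ j, (z j - p j) ^ α j) * c z)
        = ∑ k ∈ Finset.range d, fun z => (∏ i, (z i - p i) ^ (Function.update α j k) i) *
          cauchyCoeff p ρ j k c z := by
      ext z
      simp only [taylorCoord, hcoeff, Finset.sum_apply]
      refine Finset.sum_congr rfl fun k _ => ?_
      rw [← Finset.mul_prod_erase _ _ (Finset.mem_univ j),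
        ← Finset.mul_prod_erase _ (fun i => (z i - p i) ^ (Function.update α j k) i)
          (Finset.mem_univ j), hα j hj, Function.update_self]
      have : ∏ i ∈ Finset.univ.erase j, (z i - p i) ^ (Function.update α j k) i
          = ∏ i ∈ Finset.univ.erase j, (z i - p i) ^ α i := by
        refine Finset.prod_congr rfl fun i hi => ?_
        rw [Function.update_of_ne (Finset.ne_of_mem_erase hi)]
      rw [this]
      ring
    rw [hsum]
    refine Submodule.sum_mem _ fun k hk => Submodule.subset_span
      ⟨Function.update α j k, cauchyCoeff p ρ j k c, ?_, ?_, continuous_cauchyCoeff p hρ j k hc,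
        ?_, rfl⟩
    · intro i
      by_cases hi : i = j
      · subst hi
        simpa using (Finset.mem_range.mp hk).le
      · simpa [hi] using hαd i
    · intro i hi
      rw [Finset.mem_insert, not_or] at hi
      rw [Function.update_of_ne hi.1]
      exact hα i hi.2
    · intro i hi ζ z
      simp only [cauchyCoeff]
      congr 1
      refine intervalIntegral.integral_congr fun θ _ => ?_
      congr 1
      by_cases hij : i = j
      · subst hij
        rw [setCoord_setCoord]
      · rw [setCoord_comm p hij]
        exact hinv i ((Finset.mem_insert.mp hi).resolve_left hij) _ _
  | zero =>
    have : taylorCoord p ρ d j 0 = 0 := by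
      ext z
      simp [taylorCoord, cauchyCoeff]
    rw [this]
    exact Submodule.zero_mem _
  | add φ ψ h1 h2 ih1 ih2 =>
    have : taylorCoord p ρ d j (φ + ψ) = taylorCoord p ρ d j φ + taylorCoord p ρ d j ψ := by
      ext z
      simp only [taylorCoord, Pi.add_apply, cauchyCoeff_add p hρ j _
        (continuous_of_mem_partialPoly h1) (continuous_of_mem_partialPoly h2), mul_add,
        Finset.sum_add_distrib]
    rw [this]
    exact Submodule.add_mem _ ih1 ih2
  | smul a φ _ ih =>
    have : taylorCoord p ρ d j (a • φ) = a • taylorCoord p ρ d j φ := by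
      ext z
      simp only [taylorCoord, Pi.smul_apply, cauchyCoeff_smul, smul_eq_mul, Finset.mul_sum]
      exact Finset.sum_congr rfl fun k _ => by ring
    rw [this]
    exact Submodule.smul_mem _ _ ih

/-- Each new variable turns an error e into at most η + 2e, with η the one-variable error; this
gives (2^|J| - 1)η. The factor 2 bounds ∑ (ρ/2)^k ρ^(-k). Variables outside J keep the full radius
ρ, since the next Cauchy integral runs over that circle. -/
lemma exists_partialPoly_approx {u : CSpace n → ℂ} {U : Set (CSpace n)} (hU : IsOpen U)
    (hu : ContDiffOn ℝ 1 u U) {σ : ℝ} (hσ : ∀ z ∈ U, ‖dbar u z‖ ≤ σ) (hu1 : ∀ z ∈ U, ‖u z‖ ≤ 1)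
    (hσ0 : 0 ≤ σ) (p : CSpace n) {ρ : ℝ} (hρ : 0 < ρ) (d : ℕ)
    (hsub : ∀ z : CSpace n, (∀ i, ‖z i - p i‖ ≤ ρ) → z ∈ U) (J : Finset (Fin n)) :
    ∃ φ ∈ partialPoly p d J, ∀ z : CSpace n, (∀ i, ‖z i - p i‖ ≤ ρ) →
      (∀ i ∈ J, ‖z i - p i‖ ≤ ρ / 2) →
      ‖u z - φ z‖ ≤ (2 ^ J.card - 1) * (2 * ρ * σ + 2 * (1 / 2) ^ d) := by
  set K : Set (CSpace n) := {z | ∀ i, ‖z i - p i‖ ≤ ρ}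
  have hK : IsClosed K := by
    have : IsClosed (⋂ i, {z : CSpace n | ‖z i - p i‖ ≤ ρ}) :=
      isClosed_iInter fun i => isClosed_le (by fun_prop) continuous_const
    convert this using 1
    ext z
    simp [K]
  -- Tietze extension: `partialPoly` consists of functions on all of ℂⁿ with globally continuous
  -- coefficients, while u is controlled only on U. Only values on K enter the estimates.
  obtain ⟨g, hg⟩ := ContinuousMap.exists_restrict_eq hK
    ⟨K.domRestrict u, (hu.continuousOn.mono hsub).domRestrict⟩
  have hgu : ∀ z ∈ K, g z = u z := fun z hz => by
    have := congrArg (fun f : C(K, ℂ) => f ⟨z, hz⟩) hg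
    exact this
  induction J using Finset.induction_on with
  | empty =>
    refine ⟨g, Submodule.subset_span ⟨fun _ => 0, g, by simp, by simp, g.continuous, by simp, ?_⟩,
      fun z hz _ => ?_⟩
    · ext z
      simp
    · rw [hgu z hz]
      simp
  | insert j J hj ih =>
    obtain ⟨φ, hφ, hb⟩ := ih
    set η := 2 * ρ * σ + 2 * (1 / 2) ^ d
    have hη : 0 ≤ η := by positivity
    refine ⟨taylorCoord p ρ d j φ, taylorCoord_mem_partialPoly hρ hj hφ, fun z hz hzJ => ?_⟩
    have hset : ∀ ζ : ℂ, ‖ζ‖ ≤ ρ → setCoord p j ζ z ∈ K := by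
      intro ζ hζ i
      rw [setCoord_apply]
      split_ifs with h
      · subst h
        simpa using hζ
      · exact hz i
    have hzj : ‖z j - p j‖ ≤ ρ / 2 := hzJ j (Finset.mem_insert_self _ _)
    have h1 := norm_sub_taylorCoord_le hU hu hσ hu1 p hρ d j z
      (fun ζ hζ => hsub _ (hset ζ hζ)) hzj
    have h2 : taylorCoord p ρ d j u z = taylorCoord p ρ d j g z := by
      refine Finset.sum_congr rfl fun k _ => ?_
      simp only [cauchyCoeff]
      congr 2
      refine intervalIntegral.integral_congr fun θ _ => ?_
      rw [hgu _ (hset _ _)]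
      rw [norm_circleMap_zero, abs_of_pos hρ]
    have hJ0 : (0 : ℝ) ≤ 2 ^ J.card - 1 := sub_nonneg.mpr (one_le_pow₀ (by norm_num))
    have h3 : ‖taylorCoord p ρ d j g z - taylorCoord p ρ d j φ z‖ ≤ 2 * ((2 ^ J.card - 1) * η) := by
      simp only [taylorCoord]
      rw [← Finset.sum_sub_distrib]
      calc _ ≤ ∑ k ∈ Finset.range d, ((2 ^ J.card - 1) * η) * (1 / 2) ^ k := by
            refine norm_sum_le_of_le _ fun k _ => ?_
            rw [← mul_sub, norm_mul, norm_pow]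
            have h4 := norm_cauchyCoeff_sub_le p hρ j k g.continuous
              (continuous_of_mem_partialPoly hφ) z (η := (2 ^ J.card - 1) * η) (fun ζ hζ => by
                rw [hgu _ (hset ζ hζ.le)]
                refine hb _ (hset ζ hζ.le) fun i hi => ?_
                have hij : i ≠ j := fun h => hj (h ▸ hi)
                rw [setCoord_apply, if_neg hij]
                exact hzJ i (Finset.mem_insert_of_mem hi))
            calc _ ≤ (ρ / 2) ^ k * ((2 ^ J.card - 1) * η * ρ⁻¹ ^ k) := by gcongr
              _ = ((2 ^ J.card - 1) * η) * (1 / 2) ^ k := by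
                have : (ρ / 2) ^ k * ρ⁻¹ ^ k = (1 / 2) ^ k := by
                  rw [← mul_pow]
                  congr 1
                  field_simp
                rw [← this]
                ring
        _ = ((2 ^ J.card - 1) * η) * ∑ k ∈ Finset.range d, (1 / 2 : ℝ) ^ k :=
            (Finset.mul_sum _ _ _).symm
        _ ≤ ((2 ^ J.card - 1) * η) * 2 := by
            gcongr
            exact sum_geometric_two_le d
        _ = _ := by ring
    rw [Finset.card_insert_of_notMem hj]
    calc ‖u z - taylorCoord p ρ d j φ z‖
        = ‖(u z - taylorCoord p ρ d j u z)
          + (taylorCoord p ρ d j g z - taylorCoord p ρ d j φ z)‖ := by rw [h2]; congr 1; ring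
      _ ≤ η + 2 * ((2 ^ J.card - 1) * η) := (norm_add_le _ _).trans (add_le_add h1 h3)
      _ = _ := by rw [pow_succ]; ring

end PolynomialApproximation

/-! ### Polynomials in the real coordinates -/

section RealPolynomials

open MvPolynomial

variable {n : ℕ}

/-- The real coordinates of a point of `ℂⁿ`: real parts, then imaginary parts. -/
noncomputable def realCoord (z : CSpace n) : Fin n ⊕ Fin n → ℝ :=
  Sum.elim (fun j => (z j).re) fun j => (z j).im

/-- `φ` is a complex-valued polynomial of degree at most `D` in the real coordinates. -/
def IsRealPoly (D : ℕ) (φ : CSpace n → ℂ) : Prop :=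
  ∃ a b : MvPolynomial (Fin n ⊕ Fin n) ℝ, a.totalDegree ≤ D ∧ b.totalDegree ≤ D ∧
    ∀ z, φ z = (eval (realCoord z) a : ℝ) + (eval (realCoord z) b : ℝ) * Complex.I

lemma IsRealPoly.mono {D D' : ℕ} {φ : CSpace n → ℂ} (h : IsRealPoly D φ) (hD : D ≤ D') :
    IsRealPoly D' φ := by
  obtain ⟨a, b, ha, hb, h⟩ := h
  exact ⟨a, b, ha.trans hD, hb.trans hD, h⟩

lemma isRealPoly_const (D : ℕ) (c : ℂ) : IsRealPoly D fun _ : CSpace n => c :=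
  ⟨C c.re, C c.im, by simp, by simp, fun z => by simp⟩

lemma isRealPoly_coord (j : Fin n) : IsRealPoly 1 fun z : CSpace n => z j :=
  ⟨X (Sum.inl j), X (Sum.inr j), by simp, by simp, fun z => by simp [realCoord]⟩

lemma IsRealPoly.add {D : ℕ} {φ ψ : CSpace n → ℂ} (hφ : IsRealPoly D φ) (hψ : IsRealPoly D ψ) :
    IsRealPoly D fun z => φ z + ψ z := by
  obtain ⟨a, b, ha, hb, h⟩ := hφ
  obtain ⟨a', b', ha', hb', h'⟩ := hψ
  refine ⟨a + a', b + b', (totalDegree_add _ _).trans (max_le ha ha'),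
    (totalDegree_add _ _).trans (max_le hb hb'), fun z => ?_⟩
  simp only [h, h', map_add, Complex.ofReal_add]
  ring

lemma IsRealPoly.mul {D D' : ℕ} {φ ψ : CSpace n → ℂ} (hφ : IsRealPoly D φ)
    (hψ : IsRealPoly D' ψ) : IsRealPoly (D + D') fun z => φ z * ψ z := by
  obtain ⟨a, b, ha, hb, h⟩ := hφ
  obtain ⟨a', b', ha', hb', h'⟩ := hψ
  refine ⟨a * a' - b * b', a * b' + b * a',
    (totalDegree_sub _ _).trans (max_le ((totalDegree_mul _ _).trans (add_le_add ha ha'))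
      ((totalDegree_mul _ _).trans (add_le_add hb hb'))),
    (totalDegree_add _ _).trans (max_le ((totalDegree_mul _ _).trans (add_le_add ha hb'))
      ((totalDegree_mul _ _).trans (add_le_add hb ha'))), fun z => ?_⟩
  simp only [h, h', map_add, map_sub, map_mul, Complex.ofReal_add, Complex.ofReal_sub, Complex.ofReal_mul]
  linear_combination ((eval (realCoord z) b : ℝ) : ℂ) * ((eval (realCoord z) b' : ℝ) : ℂ)
    * Complex.I_sq

lemma IsRealPoly.star {D : ℕ} {φ : CSpace n → ℂ} (hφ : IsRealPoly D φ) :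
    IsRealPoly D fun z => conj (φ z) := by
  obtain ⟨a, b, ha, hb, h⟩ := hφ
  refine ⟨a, -b, ha, by rwa [totalDegree_neg], fun z => ?_⟩
  simp [h]

lemma IsRealPoly.sub {D : ℕ} {φ ψ : CSpace n → ℂ} (hφ : IsRealPoly D φ) (hψ : IsRealPoly D ψ) :
    IsRealPoly D fun z => φ z - ψ z := by
  have h := hφ.add ((isRealPoly_const 0 (-1)).mul hψ |>.mono (by omega : 0 + D ≤ D))
  convert h using 2
  ring

lemma IsRealPoly.pow {D : ℕ} {φ : CSpace n → ℂ} (hφ : IsRealPoly D φ) (k : ℕ) :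
    IsRealPoly (k * D) fun z => φ z ^ k := by
  induction k with
  | zero => simpa using isRealPoly_const (n := n) 0 1
  | succ k ih =>
    simp only [pow_succ]
    exact (ih.mul hφ).mono (by rw [Nat.succ_mul])

lemma IsRealPoly.sum {β : Type*} {D : ℕ} (s : Finset β) {φ : β → CSpace n → ℂ}
    (h : ∀ i ∈ s, IsRealPoly D (φ i)) : IsRealPoly D fun z => ∑ i ∈ s, φ i z := by
  classical
  induction s using Finset.induction_on with
  | empty => simpa using isRealPoly_const (n := n) D 0
  | insert i s hi ih =>
    simp only [Finset.sum_insert hi]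
    exact (h i (Finset.mem_insert_self _ _)).add
      (ih fun k hk => h k (Finset.mem_insert_of_mem hk))

lemma IsRealPoly.prod {β : Type*} {D : ℕ} (s : Finset β) {φ : β → CSpace n → ℂ}
    (h : ∀ i ∈ s, IsRealPoly D (φ i)) : IsRealPoly (s.card * D) fun z => ∏ i ∈ s, φ i z := by
  classical
  induction s using Finset.induction_on with
  | empty => simpa using isRealPoly_const (n := n) 0 1
  | insert i s hi ih =>
    simp only [Finset.prod_insert hi, Finset.card_insert_of_notMem hi]
    exact ((h i (Finset.mem_insert_self _ _)).mul
      (ih fun k hk => h k (Finset.mem_insert_of_mem hk))).mono (by rw [Nat.succ_mul, add_comm])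

lemma IsRealPoly.contDiff {D : ℕ} {φ : CSpace n → ℂ} (hφ : IsRealPoly D φ) {k : WithTop ℕ∞} :
    ContDiff ℝ k φ := by
  obtain ⟨a, b, -, -, h⟩ := hφ
  have hcoord : ContDiff ℝ k (realCoord (n := n)) := by
    rw [contDiff_pi]
    have h1 : ∀ j, ContDiff ℝ k fun z : CSpace n => z j := fun j =>
      ((EuclideanSpace.proj j : CSpace n →L[ℂ] ℂ).restrictScalars ℝ).contDiff
    rintro (j | j)
    · exact Complex.reCLM.contDiff.comp (h1 j)
    · exact Complex.imCLM.contDiff.comp (h1 j)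
  have heval : ∀ p : MvPolynomial (Fin n ⊕ Fin n) ℝ,
      ContDiff ℝ k fun z : CSpace n => (eval (realCoord z) p : ℝ) := fun p =>
    (AnalyticOnNhd.eval_mvPolynomial p).contDiff.comp hcoord
  rw [funext h]
  exact (Complex.ofRealCLM.contDiff.comp (heval a)).add
    ((Complex.ofRealCLM.contDiff.comp (heval b)).mul contDiff_const)

/-- The partial derivatives of the real and imaginary parts of a polynomial are bounded by its
differential. -/
lemma abs_pderiv_le_norm_fderiv {φ : CSpace n → ℂ} {a b : MvPolynomial (Fin n ⊕ Fin n) ℝ}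
    (h : ∀ z, φ z = (eval (realCoord z) a : ℝ) + (eval (realCoord z) b : ℝ) * Complex.I)
    (z : CSpace n) (hφ : DifferentiableAt ℝ φ z) (i : Fin n ⊕ Fin n) :
    |eval (realCoord z) (pderiv i a)| ≤ ‖fderiv ℝ φ z‖ ∧
      |eval (realCoord z) (pderiv i b)| ≤ ‖fderiv ℝ φ z‖ := by
  classical
  set v : CSpace n := Sum.elim (fun j => EuclideanSpace.single j 1)
    (fun j => EuclideanSpace.single j Complex.I) i with hv
  have hvn : ‖v‖ ≤ 1 := by
    rcases i with j | j <;> simp [hv]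
  have hline : ∀ s : ℝ, realCoord (z + s • v) = realCoord z + s • Pi.single i 1 := by
    intro s
    ext k
    rcases i with j | j <;> rcases k with k | k <;> by_cases hjk : k = j <;>
      simp [hv, realCoord, hjk]
  have hd : ∀ p : MvPolynomial (Fin n ⊕ Fin n) ℝ,
      HasDerivAt (fun s : ℝ => eval (realCoord (z + s • v)) p) (eval (realCoord z) (pderiv i p)) 0 := by
    intro p
    have h1 : HasDerivAt (fun s : ℝ => realCoord z + s • (Pi.single i 1 : Fin n ⊕ Fin n → ℝ))
        (Pi.single i 1) 0 := by
      simpa using ((hasDerivAt_id (0 : ℝ)).smul_const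
        (Pi.single i 1 : Fin n ⊕ Fin n → ℝ)).const_add (realCoord z)
    have h0 : realCoord z + (0 : ℝ) • (Pi.single i 1 : Fin n ⊕ Fin n → ℝ) = realCoord z := by simp
    have h2 := (h0.symm ▸ hasFDerivAt_eval p (realCoord z) :
      HasFDerivAt (fun x => eval x p) _
        (realCoord z + (0 : ℝ) • (Pi.single i 1 : Fin n ⊕ Fin n → ℝ))).comp_hasDerivAt 0 h1
    simp only [hline]
    refine h2.congr_deriv ?_
    simp only [zero_smul, add_zero, sum_apply, smul_apply, ContinuousLinearMap.proj_apply,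
      smul_eq_mul]
    rw [Finset.sum_eq_single i]
    · simp
    · intro k _ hk
      simp [hk]
    · simp
  have hφd : HasDerivAt (fun s : ℝ => φ (z + s • v)) (fderiv ℝ φ z v) 0 := by
    have h1 : HasDerivAt (fun s : ℝ => z + s • v) v 0 := by
      simpa using ((hasDerivAt_id (0 : ℝ)).smul_const v).const_add z
    have h0 : z + (0 : ℝ) • v = z := by simp
    exact (h0.symm ▸ hφ.hasFDerivAt : HasFDerivAt φ _ (z + (0 : ℝ) • v)).comp_hasDerivAt 0 h1
  have hval : fderiv ℝ φ z v
      = (eval (realCoord z) (pderiv i a) : ℝ) + (eval (realCoord z) (pderiv i b) : ℝ) * Complex.I := by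
    refine hφd.unique ?_
    simp only [h]
    exact (hd a).ofReal_comp.add ((hd b).ofReal_comp.mul_const Complex.I)
  have hle : ‖fderiv ℝ φ z v‖ ≤ ‖fderiv ℝ φ z‖ :=
    ((fderiv ℝ φ z).le_opNorm v).trans (mul_le_of_le_one_right (norm_nonneg _) hvn)
  rw [hval] at hle
  constructor
  · refine le_trans ?_ ((Complex.abs_re_le_norm _).trans hle)
    simp
  · refine le_trans ?_ ((Complex.abs_im_le_norm _).trans hle)
    simp

lemma eq_of_setCoord_invariant {p : CSpace n} {c : CSpace n → ℂ}
    (hc : ∀ j ζ z, c (setCoord p j ζ z) = c z) (z w : CSpace n) : c z = c w := by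
  have key : ∀ (s : Finset (Fin n)) (z : CSpace n), (∀ j ∉ s, z j = w j) → c z = c w := by
    intro s
    induction s using Finset.induction_on with
    | empty =>
      intro z hz
      congr 1
      ext j
      exact hz j (Finset.notMem_empty j)
    | insert j s _ ih =>
      intro z hz
      rw [← hc j (w j - p j) z]
      refine ih _ fun i hi => ?_
      rw [setCoord_apply]
      split_ifs with hij
      · rw [hij, add_sub_cancel]
      · exact hz i (by simp [hij, hi])
  exact key Finset.univ z fun j hj => absurd (Finset.mem_univ j) hj

/-- Once every variable has been treated, the coefficients are invariant under changing any
coordinate, hence constant: what remains is a polynomial in z, of degree at most d in each variable.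
-/
lemma isRealPoly_of_mem_partialPoly {p : CSpace n} {d : ℕ} {φ : CSpace n → ℂ}
    (hφ : φ ∈ partialPoly p d Finset.univ) : IsRealPoly (n * d) φ ∧ Differentiable ℂ φ := by
  induction hφ using Submodule.span_induction with
  | mem φ h =>
    obtain ⟨α, c, hαd, -, -, hinv, rfl⟩ := h
    have hc : c = fun _ => c p := funext fun z =>
      eq_of_setCoord_invariant (fun j ζ z => hinv j (Finset.mem_univ j) ζ z) z p
    rw [hc]
    constructor
    · have h1 : ∀ j ∈ Finset.univ, IsRealPoly d fun z : CSpace n => (z j - p j) ^ α j := fun j _ =>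
        (((isRealPoly_coord j).sub (isRealPoly_const 1 (p j))).pow (α j)).mono
          (by simpa using hαd j)
      have h2 := (IsRealPoly.prod Finset.univ h1).mul (isRealPoly_const 0 (c p))
      simpa using h2
    · have h1 : ∀ j, ContDiff ℂ 1 fun z : CSpace n => z j := fun j =>
        (EuclideanSpace.proj j : CSpace n →L[ℂ] ℂ).contDiff
      have h2 : ContDiff ℂ 1 fun z : CSpace n => ∏ j, (z j - p j) ^ α j :=
        contDiff_prod fun j _ => ((h1 j).sub contDiff_const).pow _
      exact (h2.differentiable one_ne_zero).mul (differentiable_const _)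
  | zero => exact ⟨isRealPoly_const _ 0, differentiable_const 0⟩
  | add φ ψ _ _ h1 h2 => exact ⟨h1.1.add h2.1, h1.2.add h2.2⟩
  | smul a φ _ h =>
    exact ⟨((isRealPoly_const 0 a).mul h.1).mono (by omega), h.2.const_smul a⟩

end RealPolynomials

/-! ### C¹ comparison, right inverses and approximate solutions -/

section Comparison

variable {n : ℕ}

lemma dbar_eq_zero_of_differentiableAt {φ : CSpace n → ℂ} {z : CSpace n}
    (hφ : DifferentiableAt ℂ φ z) : dbar φ z = 0 := by
  ext v
  rw [dbar_apply, hφ.fderiv_restrictScalars ℝ]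
  simp only [ContinuousLinearMap.coe_restrictScalars', map_smul, smul_eq_mul, zero_apply]
  linear_combination (1 / 2 * fderiv ℂ φ z v) * Complex.I_sq

lemma dbar_sub_of_holomorphic {g φ : CSpace n → ℂ} {z : CSpace n} (hg : DifferentiableAt ℝ g z)
    (hφ : DifferentiableAt ℂ φ z) : dbar (fun z => g z - φ z) z = dbar g z := by
  have h0 := dbar_eq_zero_of_differentiableAt hφ
  ext v
  have h1 := congrArg (fun L : CSpace n →L[ℝ] ℂ => L v) h0
  simp only [dbar_apply, zero_apply] at h1 ⊢
  rw [fderiv_fun_sub hg (hφ.restrictScalars ℝ), sub_apply, sub_apply]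
  linear_combination -h1

/-- If an approximately holomorphic function is close to a holomorphic function, then so is its
differential. -/
lemma norm_fderiv_sub_le {g φ : CSpace n → ℂ} {U : Set (CSpace n)} (hU : IsOpen U)
    (hg : ContDiffOn ℝ 2 g U) {σ M r : ℝ} (hdbar : ∀ z ∈ U, ‖dbar g z‖ ≤ σ)
    (hgrad : ∀ z ∈ U, ‖fderiv ℝ (dbar g) z‖ ≤ σ) (hφ : Differentiable ℂ φ)
    (hφ2 : ContDiff ℝ 2 φ) (hr : 0 < r) {z : CSpace n} (hball : Metric.closedBall z r ⊆ U)
    (hM : ∀ y ∈ Metric.closedBall z r, ‖g y - φ y‖ ≤ M) :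
    ‖fderiv ℝ g z - fderiv ℝ φ z‖ ≤ M / r + 2 * σ * r + σ := by
  set u : CSpace n → ℂ := fun z => g z - φ z
  have hdiff : ∀ y ∈ U, DifferentiableAt ℝ g y := fun y hy =>
    (hg.contDiffAt (hU.mem_nhds hy)).differentiableAt (by norm_num)
  have hu : ContDiffOn ℝ 2 u U := hg.sub hφ2.contDiffOn
  -- Subtracting a holomorphic function leaves ∂̄ unchanged, so the gradient estimate applies to the
  -- difference with the same σ.
  have hdu : ∀ y ∈ U, dbar u y = dbar g y := fun y hy => dbar_sub_of_holomorphic (hdiff y hy) (hφ y)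
  have hgu : ∀ y ∈ U, ‖fderiv ℝ (dbar u) y‖ ≤ σ := fun y hy => by
    have : dbar u =ᶠ[nhds y] dbar g := by
      filter_upwards [hU.mem_nhds hy] with x hx using hdu x hx
    rw [this.fderiv_eq]
    exact hgrad y hy
  have hz : z ∈ U := hball (Metric.mem_closedBall_self hr.le)
  have hσ0 : 0 ≤ σ := (norm_nonneg (dbar g z)).trans (hdbar z hz)
  have hM0 : 0 ≤ M := (norm_nonneg _).trans (hM z (Metric.mem_closedBall_self hr.le))
  have hfu : fderiv ℝ g z - fderiv ℝ φ z = fderiv ℝ u z :=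
    (fderiv_fun_sub (hdiff z hz) ((hφ z).restrictScalars ℝ)).symm
  rw [hfu]
  have hdel : ‖del u z‖ ≤ M / r + 2 * σ * r := by
    refine ContinuousLinearMap.opNorm_le_of_unit_norm (by positivity) fun v hv => ?_
    exact norm_del_apply_le hU hu hr hball hM hgu v hv.le
  have hsum : fderiv ℝ u z = del u z + dbar u z := by simp [del]
  rw [hsum]
  refine (norm_add_le _ _).trans (add_le_add hdel ?_)
  rw [hdu z hz]
  exact hdbar z hz

/-- If the differential of `s` is large compared to its anti-linear part, then it has a right
inverse of controlled norm. -/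
lemma exists_rightInverse {s : CSpace n → ℂ} {z : CSpace n} {σ : ℝ} (hσ : 0 < σ)
    (hB : ‖dbar s z‖ ≤ 2 * σ) (hL : 10 * σ < ‖fderiv ℝ s z‖) :
    ∃ θ : ℂ →L[ℝ] CSpace n,
      (fderiv ℝ s z).comp θ = ContinuousLinearMap.id ℝ ℂ ∧ ‖θ‖ < σ⁻¹ := by
  obtain ⟨v, hv, hLv⟩ := (fderiv ℝ s z).exists_lt_apply_of_lt_opNorm hL
  set A := del s z v with hA
  set B := dbar s z v with hBdef
  have hBv : ‖B‖ ≤ 2 * σ := ((dbar s z).le_opNorm v).trans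
    ((mul_le_of_le_one_right (norm_nonneg _) hv.le).trans hB)
  rw [fderiv_eq_del_add_dbar] at hLv
  have hAn : 8 * σ < ‖A‖ := by
    have := norm_add_le A B
    linarith
  have hA0 : A ≠ 0 := norm_pos_iff.mp (by linarith)
  set β := B / conj A with hβ
  have hβn : ‖β‖ ≤ 1 / 4 := by
    rw [hβ, norm_div, RCLike.norm_conj, div_le_iff₀ (by linarith)]
    linarith
  set D : ℂ := 1 - β * conj β with hD
  have hDn : 15 / 16 ≤ ‖D‖ := by
    have h1 := norm_sub_norm_le (1 : ℂ) (β * conj β)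
    rw [norm_mul, RCLike.norm_conj, norm_one] at h1
    nlinarith [norm_nonneg β]
  have hD0 : D ≠ 0 := norm_pos_iff.mp (by linarith)
  have hDconj : conj D = D := by simp [hD, mul_comm]
  -- On the complex line through v, ds(cv) = Ac + B c̄ with B = βĀ. Solving Ac + βĀc̄ = ζ gives c =
  -- (ζ - βζ̄)/(A(1 - |β|²)); the bounds |A| > 8σ and |β| ≤ 1/4 give norm at most 1/(6σ).
  let θ₀ : ℂ →ₗ[ℝ] CSpace n :=
    { toFun := fun ζ => ((ζ - β * conj ζ) / (D * A)) • v
      map_add' := fun x y => by rw [← add_smul, map_add]; congr 1; ring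
      map_smul' := fun a x => by
        rw [RingHom.id_apply, Complex.real_smul, map_mul, Complex.conj_ofReal, ← Complex.coe_smul,
          smul_smul]
        congr 1
        ring }
  refine ⟨LinearMap.toContinuousLinearMap θ₀, ?_, ?_⟩
  · ext1 ζ
    change fderiv ℝ s z (((ζ - β * conj ζ) / (D * A)) • v) = ζ
    rw [fderiv_eq_del_add_dbar, del_smul, dbar_smul, ← hA, ← hBdef]
    have hBA : B = β * conj A := by
      rw [hβ, div_mul_cancel₀ _ (by simpa using hA0)]
    have hcA : conj A ≠ 0 := by simpa using hA0
    rw [hBA]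
    simp only [map_div₀, map_sub, map_mul, Complex.conj_conj, hDconj]
    field_simp
    rw [hD]
    ring
  · have hbound : ‖LinearMap.toContinuousLinearMap θ₀‖ ≤ (5 / 4) / (15 / 16 * (8 * σ)) := by
      refine ContinuousLinearMap.opNorm_le_bound _ (by positivity) fun ζ => ?_
      change ‖((ζ - β * conj ζ) / (D * A)) • v‖ ≤ _
      rw [norm_smul, norm_div, norm_mul]
      have h1 : ‖ζ - β * conj ζ‖ ≤ 5 / 4 * ‖ζ‖ := by
        refine (norm_sub_le _ _).trans ?_
        rw [norm_mul, RCLike.norm_conj]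
        nlinarith [norm_nonneg ζ]
      have h2 : 15 / 16 * (8 * σ) ≤ ‖D‖ * ‖A‖ :=
        mul_le_mul hDn hAn.le (by positivity) (norm_nonneg _)
      calc ‖ζ - β * conj ζ‖ / (‖D‖ * ‖A‖) * ‖v‖
          ≤ (5 / 4 * ‖ζ‖) / (15 / 16 * (8 * σ)) * 1 := by
            gcongr
        _ = _ := by ring
    refine hbound.trans_lt ?_
    rw [inv_eq_one_div, div_lt_div_iff₀ (by positivity) hσ]
    linarith

/-- Values and differentials of an approximate solution `G` of `w + w̄ χ = φ`. -/
lemma norm_approxSolution_le {G χ φ E : CSpace n → ℂ} (hG : Differentiable ℝ G)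
    (hχ : Differentiable ℝ χ) (hφ : Differentiable ℝ φ) (hE : Differentiable ℝ E)
    (heq : ∀ z, G z + χ z * conj (G z) = φ z - E z) {κ : ℝ} {z : CSpace n}
    (hχz : ‖χ z‖ ≤ 1 - κ) (w : ℂ) :
    κ * ‖G z - w‖ ≤ ‖φ z - w - conj w * χ z‖ + ‖E z‖ ∧
      κ * ‖fderiv ℝ G z‖ ≤ ‖fderiv ℝ φ z - conj w • fderiv ℝ χ z‖
        + ‖G z - w‖ * ‖fderiv ℝ χ z‖ + ‖fderiv ℝ E z‖ := by
  -- The real-linear map x ↦ x + χx̄ expands by at least κ, because |χ| ≤ 1 - κ. It is applied to G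
  -- - w and to the derivatives of G.
  have key : ∀ x y : ℂ, x + χ z * conj x = y → κ * ‖x‖ ≤ ‖y‖ := by
    intro x y hxy
    have h1 : ‖x‖ ≤ ‖y‖ + ‖χ z‖ * ‖x‖ := by
      calc ‖x‖ = ‖y - χ z * conj x‖ := by rw [← hxy, add_sub_cancel_right]
        _ ≤ ‖y‖ + ‖χ z * conj x‖ := norm_sub_le _ _
        _ = _ := by rw [norm_mul, RCLike.norm_conj]
    nlinarith [mul_le_mul_of_nonneg_right hχz (norm_nonneg x)]
  constructor
  · refine (key (G z - w) (φ z - w - conj w * χ z - E z) ?_).trans (norm_sub_le _ _)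
    rw [map_sub]
    linear_combination heq z
  · rcases le_or_gt κ 0 with hκ | hκ
    · exact (mul_nonpos_of_nonpos_of_nonneg hκ (norm_nonneg _)).trans (by positivity)
    rw [mul_comm, ← le_div_iff₀ hκ]
    refine ContinuousLinearMap.opNorm_le_bound _ (by positivity) fun v => ?_
    have hcG : HasFDerivAt (fun z => conj (G z))
        ((Complex.conjCLE : ℂ →L[ℝ] ℂ).comp (fderiv ℝ G z)) z :=
      (Complex.conjCLE : ℂ →L[ℝ] ℂ).hasFDerivAt.comp z (hG z).hasFDerivAt
    have h1 := (hG z).hasFDerivAt.add ((hχ z).hasFDerivAt.mul hcG)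
    have h2 := (hφ z).hasFDerivAt.sub (hE z).hasFDerivAt
    have h3 := (h1.congr_of_eventuallyEq (Filter.Eventually.of_forall
      fun z => (heq z).symm)).unique h2
    have h4 := congrArg (fun L : CSpace n →L[ℝ] ℂ => L v) h3
    simp only [add_apply, sub_apply, smul_apply, smul_eq_mul, ContinuousLinearMap.comp_apply,
      ContinuousLinearEquiv.coe_coe, Complex.conjCLE_apply] at h4
    have h5 := key (fderiv ℝ G z v) ((fderiv ℝ φ z - conj w • fderiv ℝ χ z) v
      - conj (G z - w) * fderiv ℝ χ z v - fderiv ℝ E z v) (by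
        simp only [sub_apply, smul_apply, smul_eq_mul, map_sub]
        linear_combination h4)
    rw [div_mul_eq_mul_div, le_div_iff₀ hκ, mul_comm]
    refine h5.trans ((norm_sub_le _ _).trans ?_)
    have h6 := norm_sub_le ((fderiv ℝ φ z - conj w • fderiv ℝ χ z) v)
      (conj (G z - w) * fderiv ℝ χ z v)
    have h7 := (fderiv ℝ φ z - conj w • fderiv ℝ χ z).le_opNorm v
    have h8 := (fderiv ℝ χ z).le_opNorm v
    have h9 := (fderiv ℝ E z).le_opNorm v
    rw [norm_mul, RCLike.norm_conj] at h6
    have h10 := mul_le_mul_of_nonneg_left h8 (norm_nonneg (G z - w))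
    linarith

/-- The remainder `|χ|^{2(k+1)} φ` and its differential are small. -/
lemma norm_remainder_le {χ φ : CSpace n → ℂ} (hχ : Differentiable ℝ χ) (hφ : Differentiable ℝ φ)
    {q c : ℝ} {z : CSpace n} (hq1 : q ≤ 1) (hχz : ‖χ z‖ ≤ q) (hφz : ‖φ z‖ ≤ c)
    (hdχ : ‖fderiv ℝ χ z‖ ≤ c) (hdφ : ‖fderiv ℝ φ z‖ ≤ c) (k : ℕ) :
    ‖(χ z * conj (χ z)) ^ (k + 1) * φ z‖ ≤ c * (q ^ 2) ^ k ∧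
      ‖fderiv ℝ (fun z => (χ z * conj (χ z)) ^ (k + 1) * φ z) z‖
        ≤ (2 * (k + 1) * c + 1) * c * (q ^ 2) ^ k := by
  have hq0 : 0 ≤ q := (norm_nonneg _).trans hχz
  have hc0 : 0 ≤ c := (norm_nonneg _).trans hφz
  have hNz : ‖χ z * conj (χ z)‖ ≤ q ^ 2 := by
    rw [norm_mul, RCLike.norm_conj, sq]
    exact mul_le_mul hχz hχz (norm_nonneg _) hq0
  have hq2 : q ^ 2 ≤ 1 := pow_le_one₀ hq0 hq1
  have hpk : ‖(χ z * conj (χ z)) ^ k‖ ≤ (q ^ 2) ^ k := by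
    rw [norm_pow]
    exact pow_le_pow_left₀ (norm_nonneg _) hNz k
  have hpk1 : ‖(χ z * conj (χ z)) ^ (k + 1)‖ ≤ (q ^ 2) ^ k := by
    rw [pow_succ, norm_mul]
    exact (mul_le_mul hpk (hNz.trans hq2) (norm_nonneg _) (by positivity)).trans (mul_one _).le
  refine ⟨?_, ?_⟩
  · rw [norm_mul, mul_comm]
    exact mul_le_mul hφz hpk1 (norm_nonneg _) hc0
  · have hcχ : HasFDerivAt (fun z => conj (χ z))
        ((Complex.conjCLE : ℂ →L[ℝ] ℂ).comp (fderiv ℝ χ z)) z :=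
      (Complex.conjCLE : ℂ →L[ℝ] ℂ).hasFDerivAt.comp z (hχ z).hasFDerivAt
    have hN := (hχ z).hasFDerivAt.mul hcχ
    have hP := (hN.pow (k + 1)).mul (hφ z).hasFDerivAt
    refine ContinuousLinearMap.opNorm_le_bound _ (by positivity) fun v => ?_
    have hfd := congrArg (fun L : CSpace n →L[ℝ] ℂ => L v) hP.fderiv
    have hEq : fderiv ℝ (fun z => (χ z * conj (χ z)) ^ (k + 1) * φ z) z v
        = (χ z * conj (χ z)) ^ (k + 1) * fderiv ℝ φ z v
          + φ z * ((k + 1) * (χ z * conj (χ z)) ^ k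
            * (χ z * conj (fderiv ℝ χ z v) + conj (χ z) * fderiv ℝ χ z v)) := by
      refine hfd.trans ?_
      simp [mul_assoc]
      ring
    rw [hEq]
    have hdχv : ‖fderiv ℝ χ z v‖ ≤ c * ‖v‖ := ((fderiv ℝ χ z).le_opNorm v).trans (by gcongr)
    have hdφv : ‖fderiv ℝ φ z v‖ ≤ c * ‖v‖ := ((fderiv ℝ φ z).le_opNorm v).trans (by gcongr)
    have hdN : ‖χ z * conj (fderiv ℝ χ z v) + conj (χ z) * fderiv ℝ χ z v‖ ≤ 2 * (c * ‖v‖) := by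
      refine (norm_add_le _ _).trans ?_
      rw [norm_mul, norm_mul, RCLike.norm_conj, RCLike.norm_conj, ← two_mul]
      have : ‖χ z‖ * ‖fderiv ℝ χ z v‖ ≤ 1 * (c * ‖v‖) :=
        mul_le_mul (hχz.trans hq1) hdχv (norm_nonneg _) zero_le_one
      linarith
    have hk1 : ‖((k : ℂ) + 1)‖ = k + 1 := by
      have : ((k : ℂ) + 1) = ((k + 1 : ℕ) : ℂ) := by push_cast; rfl
      rw [this, Complex.norm_natCast]
      push_cast
      rfl
    refine (norm_add_le _ _).trans ?_
    rw [norm_mul, norm_mul, norm_mul, norm_mul, hk1]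
    calc ‖(χ z * conj (χ z)) ^ (k + 1)‖ * ‖fderiv ℝ φ z v‖
        + ‖φ z‖ * ((k + 1) * ‖(χ z * conj (χ z)) ^ k‖
          * ‖χ z * conj (fderiv ℝ χ z v) + conj (χ z) * fderiv ℝ χ z v‖)
        ≤ (q ^ 2) ^ k * (c * ‖v‖) + c * ((k + 1) * (q ^ 2) ^ k * (2 * (c * ‖v‖))) := by gcongr
      _ = (2 * (k + 1) * c + 1) * c * (q ^ 2) ^ k * ‖v‖ := by ring

end Comparison

/-! ### Local polynomial models of the solution w -/

section LocalModels

variable {n : ℕ}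

lemma norm_le_of_coord_le {z p : CSpace n} {ρ : ℝ} (hρ : 0 ≤ ρ) (h : ∀ i, ‖z i - p i‖ ≤ ρ) :
    ‖z - p‖ ≤ (n + 1) * ρ := by
  rw [EuclideanSpace.norm_eq]
  refine Real.sqrt_le_iff.mpr ⟨by positivity, ?_⟩
  calc ∑ i, ‖(z - p) i‖ ^ 2 ≤ ∑ _i : Fin n, ρ ^ 2 :=
        Finset.sum_le_sum fun i _ => pow_le_pow_left₀ (norm_nonneg _) (h i) 2
    _ = n * ρ ^ 2 := by simp
    _ ≤ ((n + 1) * ρ) ^ 2 := by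
        have : (0 : ℝ) ≤ n := Nat.cast_nonneg n
        nlinarith [sq_nonneg ρ, mul_nonneg this (sq_nonneg ρ),
          mul_nonneg (mul_nonneg this this) (sq_nonneg ρ)]

/-- An approximately holomorphic function is close to a holomorphic polynomial near each point of
the unit ball. -/
lemma exists_holomorphic_poly_approx {f : CSpace n → ℂ} {σ : ℝ} (hσ0 : 0 ≤ σ)
    (hf : ContDiffOn ℝ 2 f (Metric.ball 0 (11 / 10)))
    (hf1 : ∀ z ∈ Metric.ball (0 : CSpace n) (11 / 10), ‖f z‖ ≤ 1)
    (hdbar : ∀ z ∈ Metric.ball (0 : CSpace n) (11 / 10), ‖dbar f z‖ ≤ σ) {ρ : ℝ} (hρ : 0 < ρ)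
    (hρn : (n + 1) * ρ ≤ 1 / 20) {d : ℕ} (hd : 2 * (1 / 2) ^ d ≤ σ) {p : CSpace n}
    (hp : ‖p‖ ≤ 1) :
    ∃ φ : CSpace n → ℂ, IsRealPoly (n * d) φ ∧ Differentiable ℂ φ ∧
      ∀ z ∈ Metric.closedBall p (ρ / 2), ‖f z - φ z‖ ≤ 2 ^ (n + 1) * σ := by
  have hn : (0 : ℝ) ≤ n := Nat.cast_nonneg n
  obtain ⟨φ, hφ, hb⟩ := exists_partialPoly_approx Metric.isOpen_ball (hf.of_le (by norm_num)) hdbar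
    -- The polydisc of radius ρ about p stays in the ball of radius 1 + (n + 1)ρ ≤ 21/20.
    hf1 hσ0 p hρ d (fun z hz => by
      rw [mem_ball_zero_iff]
      have h1 := norm_le_of_coord_le hρ.le hz
      have h2 := norm_le_norm_add_norm_sub' z p
      linarith) Finset.univ
  obtain ⟨h1, h2⟩ := isRealPoly_of_mem_partialPoly hφ
  refine ⟨φ, h1, h2, fun z hz => ?_⟩
  have hz' : ∀ i, ‖z i - p i‖ ≤ ρ / 2 := fun i => by
    have := (PiLp.norm_apply_le (z - p) i).trans (mem_closedBall_iff_norm.mp hz)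
    simpa using this
  refine (hb z (fun i => (hz' i).trans (by linarith)) fun i _ => hz' i).trans ?_
  rw [Finset.card_univ, Fintype.card_fin]
  have hρ1 : 2 * ρ ≤ 1 := by nlinarith
  have h3 : 2 * ρ * σ + 2 * (1 / 2) ^ d ≤ 2 * σ := by
    have := mul_le_mul_of_nonneg_right hρ1 hσ0
    linarith
  calc (2 ^ n - 1) * (2 * ρ * σ + 2 * (1 / 2) ^ d) ≤ 2 ^ n * (2 * σ) :=
        mul_le_mul (by linarith) h3 (by positivity) (by positivity)
    _ = 2 ^ (n + 1) * σ := by ring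

/-- A polynomial whose nearly critical values contain all the values of `w` for which
`f - w - w̄ h` is not transverse to `0` near `p`. -/
lemma exists_local_model {C κ κ' σ ρ M M₁ q c : ℝ} (hC : 0 < C) (hκ' : 0 < κ') (hκκ : 2 * κ' ≤ κ)
    (hσ : 0 < σ) (hσ1 : σ ≤ 1) (hρ : 0 < ρ) (hρn : (n + 1) * ρ ≤ 1 / 20)
    (hM : M = 2 ^ (n + 1) + 1) (hM₁ : M₁ = 4 * M / ρ + 2) (hq : q = 1 - κ') (hc : c = C + 24)
    (hMσ : M * σ ≤ κ') (hκ1 : κ' ≤ 1) (hM₁σ : M₁ * σ ≤ 1) {d k : ℕ} (hd : 2 * (1 / 2) ^ d ≤ σ)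
    (hk : (2 * (k + 1) * c + 1) * c * (q ^ 2) ^ k ≤ σ) {f₀ h₀ : CSpace n → ℂ}
    (h₀b : LocalBounds C κ σ f₀ h₀) {p : CSpace n} (hp : ‖p‖ ≤ 1) :
    ∃ G : CSpace n → ℂ, IsRealPoly ((k + 1) * (2 * (n * d))) G ∧
      ∀ f h : CSpace n → ℂ, LocalBounds C κ σ f h →
        (∀ z ∈ Metric.closedBall (0 : CSpace n) (21 / 20),
          ‖f z - f₀ z‖ ≤ σ ∧ ‖h z - h₀ z‖ ≤ σ) →
        ∀ z ∈ Metric.closedBall p (ρ / 4), ‖z‖ ≤ 1 → ∀ w : ℂ, ‖w‖ ≤ 1 →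
          ‖f z - w - conj w * h z‖ ≤ σ → ‖fderiv ℝ f z - conj w • fderiv ℝ h z‖ ≤ 10 * σ →
          κ' * ‖G z - w‖ ≤ (2 + 2 * M) * σ ∧
          κ' * ‖fderiv ℝ G z‖ ≤ (11 + 2 * M₁) * σ + ‖G z - w‖ * (C + 1) := by
  have hn : (0 : ℝ) ≤ n := Nat.cast_nonneg n
  have hρ1 : ρ ≤ 1 / 20 := by nlinarith
  have hh1 : ∀ h : CSpace n → ℂ, (∀ z ∈ Metric.ball (0 : CSpace n) (11 / 10), ‖h z‖ ≤ 1 - κ) →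
      ∀ z ∈ Metric.ball (0 : CSpace n) (11 / 10), ‖h z‖ ≤ 1 := fun h hh z hz =>
    (hh z hz).trans (by linarith)
  -- The polynomials are built from f₀ and h₀ alone, so the same G serves every pair within σ of
  -- them.
  obtain ⟨φ, hφp, hφd, hφ⟩ := exists_holomorphic_poly_approx hσ.le h₀b.contDiff_f h₀b.norm_f
    h₀b.dbar_f hρ hρn hd hp
  obtain ⟨χ, hχp, hχd, hχ⟩ := exists_holomorphic_poly_approx hσ.le h₀b.contDiff_h
    (hh1 _ h₀b.norm_h) h₀b.dbar_h hρ hρn hd hp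
  -- Truncated series of 1/(1 - |χ|²). With it, G solves G + χḠ = φ up to E = |χ|^(2(k+1)) φ and
  -- remains polynomial in the real coordinates.
  set T : CSpace n → ℂ := fun z => ∑ i ∈ Finset.range (k + 1), (χ z * conj (χ z)) ^ i with hT
  set G : CSpace n → ℂ := fun z => (φ z - χ z * conj (φ z)) * T z with hG
  set E : CSpace n → ℂ := fun z => (χ z * conj (χ z)) ^ (k + 1) * φ z with hE
  have hNp : IsRealPoly (2 * (n * d)) fun z => χ z * conj (χ z) :=
    (hχp.mul hχp.star).mono (by omega)
  have hTp : IsRealPoly (k * (2 * (n * d))) T := IsRealPoly.sum _ fun i hi =>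
    (hNp.pow i).mono (Nat.mul_le_mul_right _ (Nat.lt_succ_iff.mp (Finset.mem_range.mp hi)))
  have hGp : IsRealPoly ((k + 1) * (2 * (n * d))) G :=
    (((hφp.mono (by omega)).sub ((hχp.mul hφp.star).mono (by omega : _ ≤ 2 * (n * d)))).mul
      hTp).mono (le_of_eq (by ring))
  have hEp := (hNp.pow (k + 1)).mul hφp
  have heq : ∀ z, G z + χ z * conj (G z) = φ z - E z := by
    intro z
    have hTc : conj (T z) = T z := by
      simp only [hT, map_sum, map_pow, map_mul, Complex.conj_conj]
      refine Finset.sum_congr rfl fun i _ => by ring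
    have hgeom : T z * (χ z * conj (χ z) - 1) = (χ z * conj (χ z)) ^ (k + 1) - 1 :=
      geom_sum_mul _ _
    simp only [hG, hE, map_mul, map_sub, Complex.conj_conj, hTc]
    linear_combination (-φ z) * hgeom
  refine ⟨G, hGp, fun f h hb hclose z hz hz1 w hw hs hds => ?_⟩
  have hM0 : 1 ≤ M := by
    have : (0 : ℝ) ≤ 2 ^ (n + 1) := by positivity
    linarith
  have hsub2 : Metric.closedBall p (ρ / 2) ⊆ Metric.closedBall (0 : CSpace n) (21 / 20) := by
    intro y hy
    rw [mem_closedBall_zero_iff]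
    have h1 := mem_closedBall_iff_norm.mp hy
    have h2 := norm_le_norm_add_norm_sub' y p
    linarith
  have hsubB : Metric.closedBall (0 : CSpace n) (21 / 20) ⊆ Metric.ball 0 (11 / 10) :=
    Metric.closedBall_subset_ball (by norm_num)
  have hsub4 : Metric.closedBall z (ρ / 4) ⊆ Metric.closedBall p (ρ / 2) := by
    refine Metric.closedBall_subset_closedBall' ?_
    have := Metric.mem_closedBall.mp hz
    linarith
  have hfφ : ∀ y ∈ Metric.closedBall p (ρ / 2), ‖f y - φ y‖ ≤ M * σ := fun y hy => by
    calc ‖f y - φ y‖ ≤ ‖f y - f₀ y‖ + ‖f₀ y - φ y‖ := norm_sub_le_norm_sub_add_norm_sub _ _ _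
      _ ≤ σ + 2 ^ (n + 1) * σ := add_le_add (hclose y (hsub2 hy)).1 (hφ y hy)
      _ = M * σ := by rw [hM]; ring
  have hhχ : ∀ y ∈ Metric.closedBall p (ρ / 2), ‖h y - χ y‖ ≤ M * σ := fun y hy => by
    calc ‖h y - χ y‖ ≤ ‖h y - h₀ y‖ + ‖h₀ y - χ y‖ := norm_sub_le_norm_sub_add_norm_sub _ _ _
      _ ≤ σ + 2 ^ (n + 1) * σ := add_le_add (hclose y (hsub2 hy)).2 (hχ y hy)
      _ = M * σ := by rw [hM]; ring
  have hzp : z ∈ Metric.closedBall p (ρ / 2) :=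
    hsub4 (Metric.mem_closedBall_self (by positivity))
  have hzB : z ∈ Metric.ball (0 : CSpace n) (11 / 10) := hsubB (hsub2 hzp)
  have hbd : M * σ / (ρ / 4) + 2 * σ * (ρ / 4) + σ ≤ M₁ * σ := by
    rw [hM₁]
    have : M * σ / (ρ / 4) = 4 * M / ρ * σ := by field_simp
    rw [this]
    nlinarith
  have hdf := (norm_fderiv_sub_le Metric.isOpen_ball hb.contDiff_f hb.dbar_f hb.grad_dbar_f hφd
    hφp.contDiff (by positivity : 0 < ρ / 4) (hsub4.trans (hsub2.trans hsubB))
    fun y hy => hfφ y (hsub4 hy)).trans hbd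
  have hdh := (norm_fderiv_sub_le Metric.isOpen_ball hb.contDiff_h hb.dbar_h hb.grad_dbar_h hχd
    hχp.contDiff (by positivity : 0 < ρ / 4) (hsub4.trans (hsub2.trans hsubB))
    fun y hy => hhχ y (hsub4 hy)).trans hbd
  -- No bound on df is assumed: it comes from |f| ≤ 1 by the gradient estimate on a ball of radius
  -- 1/20, compared with the zero function.
  have hdf22 : ‖fderiv ℝ f z‖ ≤ 22 := by
    have hball : Metric.closedBall z (1 / 20) ⊆ Metric.ball (0 : CSpace n) (11 / 10) := by
      refine Metric.closedBall_subset_ball' ?_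
      rw [dist_zero_right]
      linarith
    have h1 := norm_fderiv_sub_le Metric.isOpen_ball hb.contDiff_f hb.dbar_f hb.grad_dbar_f
      (differentiable_const (0 : ℂ)) contDiff_const (by norm_num : (0 : ℝ) < 1 / 20) hball
      (M := 1) fun y hy => by simpa using hb.norm_f y (hball hy)
    rw [fderiv_const_apply, sub_zero] at h1
    linarith
  have hφz : ‖φ z‖ ≤ 2 := by
    have h1 := norm_le_norm_add_norm_sub' (φ z) (f z)
    rw [norm_sub_rev] at h1
    have h2 := hfφ z hzp
    have h3 := hb.norm_f z hzB
    linarith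
  have hχz : ‖χ z‖ ≤ 1 - κ' := by
    have h1 := norm_le_norm_add_norm_sub' (χ z) (h z)
    rw [norm_sub_rev] at h1
    have h2 := hhχ z hzp
    have h3 := hb.norm_h z hzB
    linarith
  have hdφ : ‖fderiv ℝ φ z‖ ≤ 23 := by
    have h1 := norm_le_norm_add_norm_sub' (fderiv ℝ φ z) (fderiv ℝ f z)
    rw [norm_sub_rev] at h1
    linarith
  have hdχ : ‖fderiv ℝ χ z‖ ≤ C + 1 := by
    have h1 := norm_le_norm_add_norm_sub' (fderiv ℝ χ z) (fderiv ℝ h z)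
    rw [norm_sub_rev] at h1
    have h2 := hb.deriv_h z hzB
    linarith
  have hφR := hφd.restrictScalars ℝ
  have hχR := hχd.restrictScalars ℝ
  have hq0 : 0 ≤ q := by rw [hq]; linarith
  obtain ⟨hE1, hE2⟩ := norm_remainder_le hχR hφR (q := q) (c := c) (z := z) (by linarith)
    (by rw [hq]; exact hχz) (by linarith) (by linarith) (by linarith) k
  have hEσ : ‖E z‖ ≤ σ := by
    refine hE1.trans (le_trans ?_ hk)
    have hc0 : 0 ≤ c := by linarith
    have : 0 ≤ 2 * ((k : ℝ) + 1) * c := by positivity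
    refine mul_le_mul_of_nonneg_right ?_ (by positivity)
    nlinarith
  have hdEσ : ‖fderiv ℝ E z‖ ≤ σ := hE2.trans hk
  obtain ⟨hA1, hA2⟩ := norm_approxSolution_le
    ((hGp.contDiff (k := 1)).differentiable one_ne_zero) hχR hφR
    ((hEp.contDiff (k := 1)).differentiable one_ne_zero) heq hχz w
  have hwc : ‖conj w‖ ≤ 1 := by rwa [RCLike.norm_conj]
  constructor
  · have h1 : φ z - w - conj w * χ z
        = (f z - w - conj w * h z) - (f z - φ z) + conj w * (h z - χ z) := by ring
    have h2 : ‖conj w * (h z - χ z)‖ ≤ M * σ := by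
      rw [norm_mul]
      exact (mul_le_of_le_one_left (norm_nonneg _) hwc).trans (hhχ z hzp)
    have h3 := norm_add_le ((f z - w - conj w * h z) - (f z - φ z)) (conj w * (h z - χ z))
    have h4 := norm_sub_le (f z - w - conj w * h z) (f z - φ z)
    have h5 := hfφ z hzp
    rw [h1] at hA1
    linarith
  · have h1 : fderiv ℝ φ z - conj w • fderiv ℝ χ z = (fderiv ℝ f z - conj w • fderiv ℝ h z)
        - (fderiv ℝ f z - fderiv ℝ φ z) + conj w • (fderiv ℝ h z - fderiv ℝ χ z) := by
      rw [smul_sub]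
      abel
    have h2 : ‖conj w • (fderiv ℝ h z - fderiv ℝ χ z)‖ ≤ M₁ * σ := by
      rw [norm_smul]
      exact (mul_le_of_le_one_left (norm_nonneg _) hwc).trans hdh
    have h3 := norm_add_le ((fderiv ℝ f z - conj w • fderiv ℝ h z)
        - (fderiv ℝ f z - fderiv ℝ φ z)) (conj w • (fderiv ℝ h z - fderiv ℝ χ z))
    have h4 := norm_sub_le (fderiv ℝ f z - conj w • fderiv ℝ h z) (fderiv ℝ f z - fderiv ℝ φ z)
    have h5 := mul_le_mul_of_nonneg_left hdχ (norm_nonneg (G z - w))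
    rw [h1] at hA2
    linarith

end LocalModels

/-! ### Measure of the set of non-transverse values -/

section BadSets

open MvPolynomial MeasureTheory

variable {n : ℕ}

/-- With L = log δ⁻¹ the right side is δ^N: a geometric error reaches any fixed power of δ after
O(log δ⁻¹) terms. This is what keeps the degrees logarithmic. -/
lemma exists_mul_pow_le_exp {q c N : ℝ} (hq0 : 0 < q) (hq1 : q < 1) (hc : 0 < c) (hN : 0 ≤ N) :
    ∃ A : ℝ, 0 ≤ A ∧ ∀ L : ℝ, 1 ≤ L → ∃ k : ℕ, (k : ℝ) ≤ A * L ∧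
      c * q ^ k ≤ Real.exp (-(N * L)) := by
  have hlog : 0 < -Real.log q := neg_pos.mpr (Real.log_neg hq0 hq1)
  set A₀ := (N + |Real.log c|) / -Real.log q with hA₀
  have hA₀0 : 0 ≤ A₀ := by positivity
  refine ⟨A₀ + 1, by positivity, fun L hL => ⟨⌈A₀ * L⌉₊, ?_, ?_⟩⟩
  · have := Nat.ceil_lt_add_one (mul_nonneg hA₀0 (zero_le_one.trans hL))
    linarith
  · have h1 : A₀ * L ≤ ⌈A₀ * L⌉₊ := Nat.le_ceil _
    have h2 : c * q ^ ⌈A₀ * L⌉₊ = Real.exp (Real.log c + ⌈A₀ * L⌉₊ * Real.log q) := by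
      rw [Real.exp_add, Real.exp_log hc, Real.exp_nat_mul, Real.exp_log hq0]
    rw [h2, Real.exp_le_exp]
    have h3 : A₀ * L * -Real.log q = (N + |Real.log c|) * L := by
      rw [hA₀, mul_right_comm, div_mul_cancel₀ _ hlog.ne']
    have h4 := mul_le_mul_of_nonneg_right h1 hlog.le
    have h5 := le_abs_self (Real.log c)
    have h6 : |Real.log c| ≤ |Real.log c| * L := le_mul_of_one_le_right (abs_nonneg _) hL
    linarith

/-- Each of the first k + 1 terms of the geometric series is at least q^k. -/
lemma succ_mul_pow_le {q : ℝ} (hq0 : 0 ≤ q) (hq1 : q < 1) (k : ℕ) :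
    ((k : ℝ) + 1) * q ^ k ≤ (1 - q)⁻¹ := by
  have h1 : ∑ i ∈ Finset.range (k + 1), q ^ k ≤ ∑ i ∈ Finset.range (k + 1), q ^ i :=
    Finset.sum_le_sum fun i hi =>
      pow_le_pow_of_le_one hq0 hq1.le (Nat.lt_succ_iff.mp (Finset.mem_range.mp hi))
  rw [Finset.sum_const, Finset.card_range, nsmul_eq_mul] at h1
  push_cast at h1
  refine h1.trans ?_
  rw [← tsum_geometric_of_lt_one hq0 hq1]
  exact (summable_geometric_of_lt_one hq0 hq1).sum_le_tsum _ fun _ _ => pow_nonneg hq0 _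

/-- At a point where `f - w - w̄ h` fails to be transverse to `0`, it is small together with its
differential. -/
lemma exists_small_of_not_transverse {C κ σ : ℝ} (hσ : 0 < σ) {f h : CSpace n → ℂ}
    (hb : LocalBounds C κ σ f h) {w : ℂ} (hw : ‖w‖ ≤ 1)
    (hnot : ¬ TransverseToZeroOn σ (fun z => f z - w - conj w * h z) (Metric.closedBall 0 1)) :
    ∃ z : CSpace n, ‖z‖ ≤ 1 ∧ ‖f z - w - conj w * h z‖ ≤ σ ∧
      ‖fderiv ℝ f z - conj w • fderiv ℝ h z‖ ≤ 10 * σ := by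
  unfold TransverseToZeroOn at hnot
  push Not at hnot
  obtain ⟨z, hz, hs, hno⟩ := hnot
  have hzB : z ∈ Metric.ball (0 : CSpace n) (11 / 10) :=
    Metric.closedBall_subset_ball (by norm_num) hz
  have hnhds := Metric.isOpen_ball.mem_nhds hzB
  have hf : DifferentiableAt ℝ f z := (hb.contDiff_f.contDiffAt hnhds).differentiableAt (by norm_num)
  have hh : DifferentiableAt ℝ h z := (hb.contDiff_h.contDiffAt hnhds).differentiableAt (by norm_num)
  have hfd : fderiv ℝ (fun z => f z - w - conj w * h z) z
      = fderiv ℝ f z - conj w • fderiv ℝ h z :=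
    ((hf.hasFDerivAt.sub_const w).sub (hh.hasFDerivAt.const_mul (conj w))).fderiv
  refine ⟨z, mem_closedBall_zero_iff.mp hz, hs.le, ?_⟩
  by_contra hlarge
  push Not at hlarge
  have hdb : dbar (fun z => f z - w - conj w * h z) z = dbar f z - conj w • dbar h z := by
    ext v
    simp only [sub_apply, smul_apply, dbar_apply, hfd, smul_eq_mul]
    ring
  obtain ⟨θ, hθ, hθn⟩ := exists_rightInverse (s := fun z => f z - w - conj w * h z) (z := z) hσ
    (by
      rw [hdb]
      refine (norm_sub_le _ _).trans ?_
      rw [norm_smul, RCLike.norm_conj]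
      have h1 := hb.dbar_f z hzB
      have h2 := hb.dbar_h z hzB
      have h3 : ‖w‖ * ‖dbar h z‖ ≤ ‖dbar h z‖ := mul_le_of_le_one_left (norm_nonneg _) hw
      linarith) (by rwa [hfd])
  exact absurd hθn (not_lt.mpr (hno θ hθ))

set_option maxHeartbeats 1000000 in
/-- The values of `w` for which `f - w - w̄ h` is not transverse to `0` lie in a product of two sets
of small measure, which can be chosen uniformly for all pairs close to a given one. -/
theorem exists_bad_sets (n : ℕ) {C κ : ℝ} (hC : 0 < C) (hκ : 0 < κ) :
    ∃ (p : ℕ) (δ₀ : ℝ), 0 < δ₀ ∧ ∀ δ σ : ℝ, 0 < δ → δ < δ₀ →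
      σ = δ * (Real.log δ⁻¹) ^ (-(p : ℤ)) → 0 < σ ∧
        ∀ f₀ h₀ : CSpace n → ℂ, LocalBounds C κ σ f₀ h₀ → ∃ X Y : Set ℝ,
          volume X < ENNReal.ofReal (δ / 2) ∧ volume Y < ENNReal.ofReal (δ / 2) ∧
          ∀ f h : CSpace n → ℂ, LocalBounds C κ σ f h →
            (∀ z ∈ Metric.closedBall (0 : CSpace n) (21 / 20),
              ‖f z - f₀ z‖ ≤ σ ∧ ‖h z - h₀ z‖ ≤ σ) →
            ∀ w : ℂ, ‖w‖ < δ →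
              ¬ TransverseToZeroOn σ (fun z => f z - w - conj w * h z) (Metric.closedBall 0 1) →
              w.re ∈ X ∧ w.im ∈ Y := by
  have hn : (0 : ℝ) ≤ n := Nat.cast_nonneg n
  -- Half of the gap κ is given up so that the approximating polynomial χ still satisfies |χ| ≤ 1 -
  -- κ'.
  obtain ⟨κ', hκ', hκκ, hκ2⟩ : ∃ κ' : ℝ, 0 < κ' ∧ 2 * κ' ≤ κ ∧ κ' ≤ 1 / 2 :=
    ⟨min κ 1 / 2, by positivity, by linarith [min_le_left κ 1], by linarith [min_le_right κ 1]⟩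
  obtain ⟨ρ, hρ, hρn⟩ : ∃ ρ : ℝ, 0 < ρ ∧ (n + 1) * ρ ≤ 1 / 20 :=
    ⟨1 / (20 * (n + 1)), by positivity, le_of_eq (by field_simp)⟩
  obtain ⟨M, hM⟩ : ∃ M : ℝ, M = 2 ^ (n + 1) + 1 := ⟨_, rfl⟩
  obtain ⟨M₁, hM₁⟩ : ∃ M₁ : ℝ, M₁ = 4 * M / ρ + 2 := ⟨_, rfl⟩
  obtain ⟨q, hq⟩ : ∃ q : ℝ, q = 1 - κ' := ⟨_, rfl⟩
  obtain ⟨c, hc⟩ : ∃ c : ℝ, c = C + 24 := ⟨_, rfl⟩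
  have hM0 : 0 < M := by rw [hM]; positivity
  have hM₁0 : 0 < M₁ := by rw [hM₁]; positivity
  have hc0 : 0 < c := by linarith
  have hq0 : 0 < q := by linarith
  have hq1 : q < 1 := by linarith
  obtain ⟨P, hPsub, hPfin, hPcov⟩ :=
    (isCompact_closedBall (0 : CSpace n) 1).finite_cover_balls (e := ρ / 4) (by positivity)
  obtain ⟨Pf, hPf⟩ : ∃ Pf : Finset (CSpace n), ∀ x, x ∈ Pf ↔ x ∈ P :=
    ⟨hPfin.toFinset, fun x => hPfin.mem_toFinset⟩
  -- Q is the Morse–Sard exponent in 2n real variables. Degrees of order L² cost L^(2Q), and p = 2Q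
  -- + 1 keeps one logarithm in reserve.
  obtain ⟨Q, hQ⟩ : ∃ Q : ℕ, Q = (2 * n + 1) ^ 2 := ⟨_, rfl⟩
  obtain ⟨p, hp⟩ : ∃ p : ℕ, p = 2 * Q + 1 := ⟨_, rfl⟩
  obtain ⟨A₁, hA₁, hdL⟩ := exists_mul_pow_le_exp (q := 1 / 2) (c := 2) (N := 1 + p) (by norm_num)
    (by norm_num) (by norm_num) (by positivity)
  obtain ⟨c', hc'⟩ : ∃ c' : ℝ, c' = (2 * (1 - q)⁻¹ * c + 1) * c := ⟨_, rfl⟩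
  have h1q : 0 < 1 - q := by linarith
  have hc'0 : 0 < c' := by rw [hc']; positivity
  obtain ⟨A₂, hA₂, hkL⟩ := exists_mul_pow_le_exp (q := q) (c := c') (N := 1 + p) hq0 hq1 hc'0
    (by positivity)
  obtain ⟨M₂, hM₂⟩ : ∃ M₂ : ℝ, M₂ = (2 + 2 * M) / κ' := ⟨_, rfl⟩
  obtain ⟨M₃, hM₃⟩ : ∃ M₃ : ℝ, M₃ = (11 + 2 * M₁ + M₂ * (C + 1)) / κ' := ⟨_, rfl⟩
  have hM₂0 : 0 < M₂ := by rw [hM₂]; positivity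
  have hM₃0 : 0 < M₃ := by rw [hM₃]; positivity
  obtain ⟨A₃, hA₃⟩ : ∃ A₃ : ℝ, A₃ = (A₂ + 1) * (2 * (n * A₁)) := ⟨_, rfl⟩
  have hA₃0 : 0 ≤ A₃ := by rw [hA₃]; positivity
  obtain ⟨A₄, hA₄⟩ : ∃ A₄ : ℝ, A₄ = 1 + (2 * n + 1) * (2 * A₃ + 1) := ⟨_, rfl⟩
  have hA₄0 : 0 ≤ A₄ := by rw [hA₄]; positivity
  obtain ⟨A₅, hA₅⟩ : ∃ A₅ : ℝ, A₅ = Pf.card * (32 * (2 * n + 1) ^ 3 * A₄ ^ Q * (M₂ + M₃)) :=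
    ⟨_, rfl⟩
  have hA₅0 : 0 ≤ A₅ := by rw [hA₅]; positivity
  -- A single threshold for all smallness conditions: δ < e^(-Λ) gives log δ⁻¹ > Λ, and Λσ ≤ Λδ ≤ 1.
  obtain ⟨Λ, hΛ⟩ : ∃ Λ : ℝ, Λ = 1 + M / κ' + M₁ + 2 * A₅ := ⟨_, rfl⟩
  have hMκ : 0 < M / κ' := by positivity
  refine ⟨p, Real.exp (-Λ), Real.exp_pos _, fun δ σ hδ hδ₀ hσdef => ?_⟩
  obtain ⟨L, hL⟩ : ∃ L : ℝ, L = Real.log δ⁻¹ := ⟨_, rfl⟩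
  rw [← hL, zpow_neg, zpow_natCast] at hσdef
  have hδL : δ = Real.exp (-L) := by rw [hL, Real.log_inv, neg_neg, Real.exp_log hδ]
  have hΛL : Λ < L := by
    rw [hδL, Real.exp_lt_exp] at hδ₀
    linarith
  have hL1 : 1 ≤ L := by linarith
  have hL0 : 0 < L := by linarith
  have hσ : 0 < σ := by rw [hσdef]; positivity
  have hσδ : σ ≤ δ := by
    rw [hσdef]
    exact mul_le_of_le_one_right hδ.le (inv_le_one_of_one_le₀ (one_le_pow₀ hL1))
  have hΛδ : Λ * δ ≤ 1 := by
    have h1 : Λ ≤ Real.exp Λ := by linarith [Real.add_one_le_exp Λ]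
    calc Λ * δ ≤ Real.exp Λ * Real.exp (-Λ) := mul_le_mul h1 hδ₀.le hδ.le (Real.exp_pos _).le
      _ = 1 := by rw [← Real.exp_add, add_neg_cancel, Real.exp_zero]
  have hΛσ : Λ * σ ≤ 1 := (mul_le_mul_of_nonneg_left hσδ (by linarith)).trans hΛδ
  have hmulσ : ∀ x : ℝ, x ≤ Λ → x * σ ≤ 1 := fun x hx =>
    (mul_le_mul_of_nonneg_right hx hσ.le).trans hΛσ
  have hδ1 : δ ≤ 1 := by
    have h1 : 1 * δ ≤ Λ * δ := mul_le_mul_of_nonneg_right (by linarith) hδ.le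
    linarith
  have hσ1 : σ ≤ 1 := hσδ.trans hδ1
  have hMσ : M * σ ≤ κ' := by
    have h1 : M / κ' * σ ≤ 1 := hmulσ _ (by linarith)
    rw [div_mul_eq_mul_div, div_le_one hκ'] at h1
    exact h1
  have hM₁σ : M₁ * σ ≤ 1 := hmulσ _ (by linarith)
  -- Since L ≤ e^L, δ^(1+p) is at most δL^(-p) = σ; this is why the exponent N = 1 + p was used for
  -- d and k.
  have hexp : Real.exp (-((1 + p) * L)) ≤ σ := by
    have h1 : -((1 + (p : ℝ)) * L) = -L + -(p * L) := by ring
    rw [h1, Real.exp_add, ← hδL, hσdef, Real.exp_neg, Real.exp_nat_mul]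
    have h2 : L ≤ Real.exp L := by linarith [Real.add_one_le_exp L]
    gcongr
  obtain ⟨d, hdA, hd⟩ := hdL L hL1
  obtain ⟨k, hkA, hk⟩ := hkL L hL1
  have hdσ : 2 * (1 / 2) ^ d ≤ σ := hd.trans hexp
  -- One of the two factors q^k absorbs the k + 1 produced by differentiating the remainder; the
  -- other supplies the smallness.
  have hkσ : (2 * (k + 1) * c + 1) * c * (q ^ 2) ^ k ≤ σ := by
    refine le_trans ?_ (hk.trans hexp)
    have h1 := succ_mul_pow_le hq0.le hq1 k
    have h2 : q ^ k ≤ 1 := pow_le_one₀ hq0.le hq1.le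
    have h3 : (2 * (k + 1) * c + 1) * q ^ k ≤ 2 * (1 - q)⁻¹ * c + 1 := by
      have := mul_le_mul_of_nonneg_right h1 hc0.le
      linarith
    calc (2 * (k + 1) * c + 1) * c * (q ^ 2) ^ k
        = ((2 * (k + 1) * c + 1) * q ^ k) * (c * q ^ k) := by ring
      _ ≤ (2 * (1 - q)⁻¹ * c + 1) * (c * q ^ k) := by gcongr
      _ = c' * q ^ k := by rw [hc']; ring
  refine ⟨hσ, fun f₀ h₀ hb₀ => ?_⟩
  obtain ⟨D, hD⟩ : ∃ D : ℕ, D = (k + 1) * (2 * (n * d)) := ⟨_, rfl⟩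
  obtain ⟨ε, hε⟩ : ∃ ε : ℝ, ε = (M₂ + M₃) * σ := ⟨_, rfl⟩
  have hε0 : 0 < ε := by rw [hε]; positivity
  have hmodel : ∀ x ∈ P, ∃ a b : MvPolynomial (Fin n ⊕ Fin n) ℝ,
      a.totalDegree ≤ D ∧ b.totalDegree ≤ D ∧
      ∀ f h : CSpace n → ℂ, LocalBounds C κ σ f h →
        (∀ z ∈ Metric.closedBall (0 : CSpace n) (21 / 20),
          ‖f z - f₀ z‖ ≤ σ ∧ ‖h z - h₀ z‖ ≤ σ) →
        ∀ z ∈ Metric.closedBall x (ρ / 4), ‖z‖ ≤ 1 → ∀ w : ℂ, ‖w‖ ≤ 1 →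
          ‖f z - w - conj w * h z‖ ≤ σ → ‖fderiv ℝ f z - conj w • fderiv ℝ h z‖ ≤ 10 * σ →
          ((∀ i, |eval (realCoord z) (pderiv i a)| ≤ ε) ∧ |w.re - eval (realCoord z) a| ≤ ε) ∧
          ((∀ i, |eval (realCoord z) (pderiv i b)| ≤ ε) ∧ |w.im - eval (realCoord z) b| ≤ ε) := by
    intro x hx
    obtain ⟨G, hGp, hG⟩ := exists_local_model hC hκ' hκκ hσ hσ1 hρ hρn hM hM₁ hq hc hMσ
      (by linarith) hM₁σ hdσ hkσ hb₀ (p := x) (mem_closedBall_zero_iff.mp (hPsub hx))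
    have hGd : Differentiable ℝ G := (hGp.contDiff (k := 1)).differentiable one_ne_zero
    obtain ⟨a, b, ha, hbdeg, hab⟩ := hGp
    refine ⟨a, b, ha.trans hD.ge, hbdeg.trans hD.ge,
      fun f h hb hclose z hz hz1 w hw hs hds => ?_⟩
    obtain ⟨h1, h2⟩ := hG f h hb hclose z hz hz1 w hw hs hds
    have h3 : ‖G z - w‖ ≤ M₂ * σ := by
      rw [hM₂, div_mul_eq_mul_div, le_div_iff₀ hκ', mul_comm]
      exact h1
    have h4 : ‖fderiv ℝ G z‖ ≤ M₃ * σ := by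
      rw [hM₃, div_mul_eq_mul_div, le_div_iff₀ hκ', mul_comm]
      have := mul_le_mul_of_nonneg_right h3 (by linarith : 0 ≤ C + 1)
      linarith
    have h5 : ‖G z - w‖ ≤ ε :=
      h3.trans (hε ▸ mul_le_mul_of_nonneg_right (by linarith) hσ.le)
    have h6 : ‖fderiv ℝ G z‖ ≤ ε :=
      h4.trans (hε ▸ mul_le_mul_of_nonneg_right (by linarith) hσ.le)
    have hder := abs_pderiv_le_norm_fderiv hab z (hGd z)
    have hre : (G z - w).re = -(w.re - eval (realCoord z) a) := by
      rw [hab]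
      simp
    have him : (G z - w).im = -(w.im - eval (realCoord z) b) := by
      rw [hab]
      simp
    refine ⟨⟨fun i => (hder i).1.trans h6, ?_⟩, fun i => (hder i).2.trans h6, ?_⟩
    · rw [← abs_neg, ← hre]
      exact (Complex.abs_re_le_norm _).trans h5
    · rw [← abs_neg, ← him]
      exact (Complex.abs_im_le_norm _).trans h5
  choose! a b ha hb hab using hmodel
  have hvol : ∀ g : CSpace n → MvPolynomial (Fin n ⊕ Fin n) ℝ,
      (∀ x ∈ P, (g x).totalDegree ≤ D) →
      volume (⋃ x ∈ Pf, {c : ℝ | ∃ y : Fin n ⊕ Fin n → ℝ, (∀ i, |y i| ≤ 1) ∧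
        (∀ i, |eval y (pderiv i (g x))| ≤ ε) ∧ |c - eval y (g x)| ≤ ε})
        < ENNReal.ofReal (δ / 2) := by
    intro g hg
    obtain ⟨B, hB⟩ : ∃ B : ℝ, B = 32 * (((2 * n : ℕ) : ℝ) + 1) ^ 3 *
      (1 + (((2 * n : ℕ) : ℝ) + 1) * (2 * D + 1)) ^ ((2 * n + 1) ^ 2) * ε := ⟨_, rfl⟩
    have hB0 : 0 ≤ B := by rw [hB]; positivity
    have h1 : ∀ x ∈ Pf, volume {c : ℝ | ∃ y : Fin n ⊕ Fin n → ℝ, (∀ i, |y i| ≤ 1) ∧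
        (∀ i, |eval y (pderiv i (g x))| ≤ ε) ∧ |c - eval y (g x)| ≤ ε} ≤ ENNReal.ofReal B := by
      intro x hx
      rw [hB]
      exact volume_nhd_nearCriticalValues_le (g x) (m := 2 * n) (hg x ((hPf x).mp hx))
        (by simp [two_mul]) hε0
    refine (measure_biUnion_finset_le _ _).trans_lt ((Finset.sum_le_sum h1).trans_lt ?_)
    rw [Finset.sum_const, nsmul_eq_mul, ← ENNReal.ofReal_natCast,
      ← ENNReal.ofReal_mul (Nat.cast_nonneg _)]
    refine (ENNReal.ofReal_lt_ofReal_iff (by positivity)).mpr ?_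
    -- Both the Taylor degree d and the series length k are O(L), and D is essentially their
    -- product.
    have hDL : (D : ℝ) ≤ A₃ * L ^ 2 := by
      rw [hD, hA₃]
      push_cast
      have h2 : (k : ℝ) + 1 ≤ (A₂ + 1) * L := by linarith
      calc ((k : ℝ) + 1) * (2 * (n * d)) ≤ ((A₂ + 1) * L) * (2 * (n * (A₁ * L))) := by gcongr
        _ = (A₂ + 1) * (2 * (n * A₁)) * L ^ 2 := by ring
    have hL2 : 1 ≤ L ^ 2 := one_le_pow₀ hL1
    have h3 : 1 + (((2 * n : ℕ) : ℝ) + 1) * (2 * D + 1) ≤ A₄ * L ^ 2 := by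
      rw [hA₄]
      push_cast
      have h4 : 2 * (D : ℝ) + 1 ≤ (2 * A₃ + 1) * L ^ 2 := by linarith
      have h5 := mul_le_mul_of_nonneg_left h4 (by positivity : 0 ≤ 2 * (n : ℝ) + 1)
      linarith
    have h6 : (1 + (((2 * n : ℕ) : ℝ) + 1) * (2 * D + 1)) ^ ((2 * n + 1) ^ 2)
        ≤ A₄ ^ Q * L ^ (2 * Q) := by
      rw [← hQ, pow_mul, ← mul_pow]
      exact pow_le_pow_left₀ (by positivity) h3 _
    have h7 : (Pf.card : ℝ) * B ≤ A₅ * (L ^ (2 * Q) * σ) := by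
      rw [hB, hA₅, hε]
      calc (Pf.card : ℝ) * (32 * (((2 * n : ℕ) : ℝ) + 1) ^ 3 *
            (1 + (((2 * n : ℕ) : ℝ) + 1) * (2 * D + 1)) ^ ((2 * n + 1) ^ 2) * ((M₂ + M₃) * σ))
          ≤ (Pf.card : ℝ) * (32 * (((2 * n : ℕ) : ℝ) + 1) ^ 3 * (A₄ ^ Q * L ^ (2 * Q))
            * ((M₂ + M₃) * σ)) :=
          mul_le_mul_of_nonneg_left (by gcongr) (Nat.cast_nonneg _)
        _ = _ := by push_cast; ring
    -- The spare logarithm: the total measure is at most A₅δ/L, below δ/2 because L > 2A₅.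
    have h8 : L ^ (2 * Q) * σ = δ / L := by
      rw [hσdef, hp, pow_succ]
      field_simp
    rw [h8] at h7
    refine h7.trans_lt ?_
    rw [mul_div_assoc', div_lt_div_iff₀ hL0 two_pos]
    have h9 : 2 * A₅ < L := by linarith
    have h10 := mul_lt_mul_of_pos_right h9 hδ
    linarith
  refine ⟨_, _, hvol a ha, hvol b hb, fun f h hbd hclose w hw hnot => ?_⟩
  have hw1 : ‖w‖ ≤ 1 := hw.le.trans hδ1
  obtain ⟨z, hz1, hs, hds⟩ := exists_small_of_not_transverse hσ hbd hw1 hnot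
  obtain ⟨x, hx, hzx⟩ := Set.mem_iUnion₂.mp (hPcov (mem_closedBall_zero_iff.mpr hz1))
  obtain ⟨h1, h2⟩ := hab x hx f h hbd hclose z (Metric.ball_subset_closedBall hzx) hz1 w hw1 hs hds
  have hcoord : ∀ i, |realCoord z i| ≤ 1 := by
    rintro (i | i)
    · exact (Complex.abs_re_le_norm _).trans ((PiLp.norm_apply_le z i).trans hz1)
    · exact (Complex.abs_im_le_norm _).trans ((PiLp.norm_apply_le z i).trans hz1)
  exact ⟨Set.mem_iUnion₂.mpr ⟨x, (hPf x).mpr hx, realCoord z, hcoord, h1⟩,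
    Set.mem_iUnion₂.mpr ⟨x, (hPf x).mpr hx, realCoord z, hcoord, h2⟩⟩

end BadSets

/-! ### Staircase paths and subdivision of time -/

section Paths

open MeasureTheory

/-- Projection of the real line onto the interval `[0, 1]`. -/
noncomputable def clampUnit (x : ℝ) : ℝ := max 0 (min 1 x)

lemma continuous_clampUnit : Continuous clampUnit := by
  unfold clampUnit
  fun_prop

lemma clampUnit_of_nonpos {x : ℝ} (hx : x ≤ 0) : clampUnit x = 0 := by
  rw [clampUnit, min_eq_right (by linarith), max_eq_left hx]

lemma clampUnit_of_one_le {x : ℝ} (hx : 1 ≤ x) : clampUnit x = 1 := by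
  rw [clampUnit, min_eq_left hx, max_eq_right zero_le_one]

/-- Completed steps telescope and pending ones vanish; this evaluates a staircase function whenever
none of its steps is in progress. -/
lemma sum_step_mul_sub (a s : ℕ → ℝ) {j m : ℕ} (hjm : j ≤ m) (h1 : ∀ i < j, s i = 1)
    (h0 : ∀ i, j ≤ i → s i = 0) :
    a 0 + ∑ i ∈ Finset.range m, s i * (a (i + 1) - a i) = a j := by
  have h2 : ∑ i ∈ Finset.range j, s i * (a (i + 1) - a i)
      = ∑ i ∈ Finset.range m, s i * (a (i + 1) - a i) := by
    refine Finset.sum_subset (Finset.range_subset_range.mpr hjm) fun i _ hi => ?_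
    rw [h0 i (not_lt.mp fun h => hi (Finset.mem_range.mpr h)), zero_mul]
  have h3 : ∑ i ∈ Finset.range j, s i * (a (i + 1) - a i)
      = ∑ i ∈ Finset.range j, (a (i + 1) - a i) :=
    Finset.sum_congr rfl fun i hi => by rw [h1 i (Finset.mem_range.mp hi), one_mul]
  rw [← h2, h3, Finset.sum_range_sub]
  ring

/-- Two continuous functions such that, over each interval `[j, j + 1]`, one of them takes the
prescribed value. -/
lemma exists_staircase (a b : ℕ → ℝ) (r : ℝ) (m : ℕ) (ha : ∀ j, |a j| ≤ r) (hb : ∀ j, |b j| ≤ r) :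
    ∃ A B : ℝ → ℝ, Continuous A ∧ Continuous B ∧ (∀ t, |A t| ≤ r) ∧ (∀ t, |B t| ≤ r) ∧
      ∀ j < m, ∀ t ∈ Set.Icc (j : ℝ) (j + 1), A t = a j ∨ B t = b j := by
  have hr : -r ≤ r := by
    have := (abs_nonneg _).trans (ha 0)
    linarith
  -- A moves from a_i to a_{i+1} during the first half of [i + 1, i + 2], B from b_i to b_{i+1}
  -- during the second half of [i, i + 1]. So on [j, j + 1] B rests at b_j in the first half and A
  -- at a_j in the second.
  set A₀ : ℝ → ℝ := fun t => a 0 + ∑ i ∈ Finset.range m,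
    clampUnit (2 * (t - (i + 1))) * (a (i + 1) - a i) with hA₀
  set B₀ : ℝ → ℝ := fun t => b 0 + ∑ i ∈ Finset.range m,
    clampUnit (2 * (t - i) - 1) * (b (i + 1) - b i) with hB₀
  have hA₀c : Continuous A₀ := by
    refine continuous_const.add (continuous_finsetSum _ fun i _ => ?_)
    exact (continuous_clampUnit.comp (by fun_prop)).mul continuous_const
  have hB₀c : Continuous B₀ := by
    refine continuous_const.add (continuous_finsetSum _ fun i _ => ?_)
    exact (continuous_clampUnit.comp (by fun_prop)).mul continuous_const
  have hproj : ∀ x : ℝ, |x| ≤ r → max (-r) (min r x) = x := fun x hx => by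
    rw [abs_le] at hx
    rw [min_eq_right hx.2, max_eq_right hx.1]
  have hbound : ∀ x : ℝ, |max (-r) (min r x)| ≤ r := fun x =>
    abs_le.mpr ⟨le_max_left _ _, max_le hr (min_le_left _ _)⟩
  -- Truncation to [-r, r] gives the uniform bound at once and does not alter the prescribed values.
  refine ⟨fun t => max (-r) (min r (A₀ t)), fun t => max (-r) (min r (B₀ t)), by fun_prop,
    by fun_prop, fun t => hbound _, fun t => hbound _, fun j hj t ht => ?_⟩
  rcases le_total t (j + 1 / 2) with h | h
  · right
    have : B₀ t = b j := by
      refine sum_step_mul_sub b (fun i => clampUnit (2 * (t - i) - 1)) hj.le (fun i hi => ?_)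
        fun i hi => ?_
      · have : (i : ℝ) + 1 ≤ j := by exact_mod_cast hi
        exact clampUnit_of_one_le (by linarith [ht.1])
      · have : (j : ℝ) ≤ i := by exact_mod_cast hi
        exact clampUnit_of_nonpos (by linarith)
    simp only [this]
    exact hproj _ (hb j)
  · left
    have : A₀ t = a j := by
      refine sum_step_mul_sub a (fun i => clampUnit (2 * (t - (i + 1)))) hj.le (fun i hi => ?_)
        fun i hi => ?_
      · have : (i : ℝ) + 1 ≤ j := by exact_mod_cast hi
        exact clampUnit_of_one_le (by linarith)
      · have : (j : ℝ) ≤ i := by exact_mod_cast hi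
        exact clampUnit_of_nonpos (by linarith [ht.2])
    simp only [this]
    exact hproj _ (ha j)

/-- The interval [-δ/4, δ/4] has length δ/2, more than the measure of X. -/
lemma exists_abs_le_notMem {X : Set ℝ} {δ : ℝ} (hX : volume X < ENNReal.ofReal (δ / 2)) :
    ∃ a : ℝ, |a| ≤ δ / 4 ∧ a ∉ X := by
  by_contra! hcon
  have hsub : Set.Icc (-(δ / 4)) (δ / 4) ⊆ X := fun a ha => hcon a (abs_le.mpr ha)
  have h1 := measure_mono (μ := volume) hsub
  rw [Real.volume_Icc] at h1
  refine absurd (h1.trans_lt hX) (not_lt.mpr (le_of_eq ?_))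
  congr 1
  ring

/-- A family that is jointly continuous is uniformly close, over the ball of radius `21/20`, to its
members at finitely many equidistant times. -/
lemma exists_mesh {n : ℕ} {f : ℝ → CSpace n → ℂ}
    (hf : ContinuousOn (fun q : ℝ × CSpace n => f q.1 q.2)
      (Set.Icc 0 1 ×ˢ Metric.ball 0 (11 / 10))) {σ : ℝ} (hσ : 0 < σ) :
    ∃ r > 0, ∀ s ∈ Set.Icc (0 : ℝ) 1, ∀ t ∈ Set.Icc (0 : ℝ) 1, |s - t| < r →
      ∀ z ∈ Metric.closedBall (0 : CSpace n) (21 / 20), ‖f s z - f t z‖ ≤ σ := by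
  have hK : IsCompact (Set.Icc (0 : ℝ) 1 ×ˢ Metric.closedBall (0 : CSpace n) (21 / 20)) :=
    isCompact_Icc.prod (isCompact_closedBall _ _)
  have hu := hK.uniformContinuousOn_of_continuous (hf.mono (Set.prod_mono subset_rfl
    (Metric.closedBall_subset_ball (by norm_num))))
  obtain ⟨r, hr, h⟩ := Metric.uniformContinuousOn_iff.mp hu σ hσ
  refine ⟨r, hr, fun s hs t ht hst z hz => ?_⟩
  have := h (s, z) ⟨hs, hz⟩ (t, z) ⟨ht, hz⟩ (by
    rw [Prod.dist_eq, dist_self, max_eq_left dist_nonneg, Real.dist_eq]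
    exact hst)
  rw [← dist_eq_norm]
  exact this.le

end Paths

/-! ### Transverse values, singly and along paths -/

theorem mainTheorem10 (n : ℕ) (C κ : ℝ) (hC : 0 < C) (hκ : 0 < κ) :
    ∃ (p : ℕ) (δ₀ : ℝ), 0 < δ₀ ∧
      ∀ δ σ : ℝ, 0 < δ → δ < δ₀ → σ = δ * (Real.log δ⁻¹) ^ (-(p : ℤ)) →
        (∀ f h : CSpace n → ℂ, LocalBounds C κ σ f h →
          ∃ w : ℂ, ‖w‖ < δ ∧
            TransverseToZeroOn σ (fun z => f z - w - conj w * h z) (Metric.closedBall 0 1)) ∧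
        (∀ f h : ℝ → CSpace n → ℂ,
          ContinuousOn (fun q : ℝ × CSpace n => f q.1 q.2)
            (Set.Icc 0 1 ×ˢ Metric.ball 0 (11 / 10)) →
          ContinuousOn (fun q : ℝ × CSpace n => h q.1 q.2)
            (Set.Icc 0 1 ×ˢ Metric.ball 0 (11 / 10)) →
          (∀ t ∈ Set.Icc (0 : ℝ) 1, LocalBounds C κ σ (f t) (h t)) →
          ∃ w : ℝ → ℂ, ContinuousOn w (Set.Icc 0 1) ∧
            ∀ t ∈ Set.Icc (0 : ℝ) 1, ‖w t‖ < δ ∧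
              TransverseToZeroOn σ (fun z => f t z - w t - conj (w t) * h t z)
                (Metric.closedBall 0 1)) := by
  obtain ⟨p, δ₀, hδ₀, H⟩ := exists_bad_sets n hC hκ
  refine ⟨p, δ₀, hδ₀, fun δ σ hδ hδδ₀ hσdef => ?_⟩
  obtain ⟨hσ, H⟩ := H δ σ hδ hδδ₀ hσdef
  have hnorm : ∀ x y : ℝ, |x| ≤ δ / 4 → |y| ≤ δ / 4 → ‖(x + y * Complex.I : ℂ)‖ < δ := by
    intro x y hx hy
    have h1 := Complex.norm_le_abs_re_add_abs_im (x + y * Complex.I)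
    simp only [Complex.add_re, Complex.ofReal_re, Complex.mul_re, Complex.I_re, mul_zero,
      Complex.ofReal_im, Complex.I_im, mul_one, sub_self, add_zero, Complex.add_im, Complex.mul_im,
      zero_add] at h1
    linarith
  constructor
  · intro f h hb
    obtain ⟨X, Y, hX, hY, hXY⟩ := H f h hb
    obtain ⟨x, hx, hxX⟩ := exists_abs_le_notMem hX
    -- A real w suffices: a bad w would have its real part in X.
    refine ⟨x + (0 : ℝ) * Complex.I, hnorm x 0 hx (by rw [abs_zero]; positivity), ?_⟩
    by_contra hnot
    have := (hXY f h hb (fun z _ => by simp [hσ.le]) _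
      (hnorm x 0 hx (by rw [abs_zero]; positivity)) hnot).1
    simp only [Complex.ofReal_zero, zero_mul, add_zero, Complex.ofReal_re] at this
    exact hxX this
  · intro f h hf hh hb
    obtain ⟨r₁, hr₁, hfr⟩ := exists_mesh hf hσ
    obtain ⟨r₂, hr₂, hhr⟩ := exists_mesh hh hσ
    obtain ⟨m, hm⟩ := exists_nat_one_div_lt (lt_min hr₁ hr₂)
    set N : ℝ := (m : ℝ) + 1 with hN
    have hN0 : 0 < N := by positivity
    -- On the j-th time interval every pair is within σ of the pair at time j/N, so the bad sets of
    -- that one pair serve the whole interval.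
    have htime : ∀ j : ℕ, ∃ X Y : Set ℝ,
        MeasureTheory.volume X < ENNReal.ofReal (δ / 2) ∧ MeasureTheory.volume Y < ENNReal.ofReal (δ / 2) ∧
        (j < m + 1 → ∀ t ∈ Set.Icc (0 : ℝ) 1, N * t ∈ Set.Icc (j : ℝ) (j + 1) → ∀ w : ℂ,
          ‖w‖ < δ → ¬ TransverseToZeroOn σ (fun z => f t z - w - conj w * h t z)
            (Metric.closedBall 0 1) → w.re ∈ X ∧ w.im ∈ Y) := by
      intro j
      by_cases hj : j < m + 1
      · have hjN : (j : ℝ) / N ∈ Set.Icc (0 : ℝ) 1 := by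
          refine ⟨by positivity, (div_le_one hN0).mpr ?_⟩
          have : (j : ℝ) ≤ (m + 1 : ℕ) := by exact_mod_cast hj.le
          rw [hN]
          push_cast at this
          exact this
        obtain ⟨X, Y, hX, hY, hXY⟩ := H (f (j / N)) (h (j / N)) (hb _ hjN)
        refine ⟨X, Y, hX, hY, fun _ t ht htj w hw hnot => ?_⟩
        have hdist : |t - j / N| ≤ 1 / N := by
          have h1 : t - j / N = (N * t - j) / N := by field_simp
          rw [h1, abs_div, abs_of_pos hN0, abs_of_nonneg (by linarith [htj.1])]
          exact div_le_div_of_nonneg_right (by linarith [htj.2]) hN0.le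
        have hlt := hdist.trans_lt hm
        exact hXY (f t) (h t) (hb t ht) (fun z hz =>
          ⟨hfr t ht _ hjN (hlt.trans_le (min_le_left _ _)) z hz,
            hhr t ht _ hjN (hlt.trans_le (min_le_right _ _)) z hz⟩) w hw hnot
      -- Default sets past the last interval, so that the good values form sequences indexed by all
      -- of ℕ.
      · exact ⟨∅, ∅, by simp [hδ], by simp [hδ], fun h' => absurd h' hj⟩
    choose X Y hX hY hXY using htime
    choose a ha haX using fun j => exists_abs_le_notMem (hX j)
    choose b hb' hbY using fun j => exists_abs_le_notMem (hY j)
    obtain ⟨A, B, hA, hB, hAr, hBr, hAB⟩ := exists_staircase a b (δ / 4) (m + 1) ha hb'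
    refine ⟨fun t => A (N * t) + B (N * t) * Complex.I, ?_, fun t ht => ⟨hnorm _ _ (hAr _) (hBr _),
      ?_⟩⟩
    · exact Continuous.continuousOn (by fun_prop)
    · obtain ⟨j, hj, htj⟩ : ∃ j < m + 1, N * t ∈ Set.Icc (j : ℝ) (j + 1) := by
        -- At t = 1 the floor of Nt would be m + 1, one past the last interval, so this endpoint is
        -- assigned to interval m.
        rcases ht.2.eq_or_lt with h1 | h1
        · refine ⟨m, Nat.lt_succ_self m, ?_⟩
          rw [h1, mul_one, hN]
          exact ⟨by linarith, le_rfl⟩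
        · refine ⟨⌊N * t⌋₊, ?_, Nat.floor_le (mul_nonneg hN0.le ht.1), (Nat.lt_floor_add_one _).le⟩
          rw [Nat.floor_lt (mul_nonneg hN0.le ht.1)]
          push_cast
          nlinarith
      by_contra hnot
      have hmem := hXY j hj t ht htj _ (hnorm _ _ (hAr _) (hBr _)) hnot
      simp only [Complex.add_re, Complex.ofReal_re, Complex.mul_re, Complex.I_re, mul_zero,
        Complex.ofReal_im, Complex.I_im, mul_one, sub_self, add_zero, Complex.add_im,
        Complex.mul_im, zero_add] at hmem
      rcases hAB j hj _ htj with h1 | h1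
      · exact haX j (h1 ▸ hmem.1)
      · exact hbY j (h1 ▸ hmem.2)
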